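/- **Theorem (OTM call option price).** Let $X$ be a hyperexponential Lévy process, i.e. a real Lévy process with drift $a\in\mathbb R$, Gaussian coefficient $\sigma\ge 0$ and finite Lévy measure $$\nu(dx)=\mathbb I(x<0)\sum_{\ell=1}^{\hat N}\hat a_\ell\hat\rho_\ell e^{\hat\rho_\ell x}dx+\mathbb I(x>0)\sum_{\ell=1}^{N}a_\ell\rho_\ell e^{-\rho_\ell x}dx,$$ where $N,\hat N\ge 0$, $a_\ell,\hat a_\ell>0$, $0<\rho_1<\dots<\rho_N$, $0<\hat\rho_1<\dots<\hat\rho_{\hat N}$; that is, $\mathbb E[e^{iuX_t}]=\exp\big(t\,(iau-\tfrac{\sigma^2u^2}{2}+\int(e^{iux}-1)\,\nu(dx))\big)$ for $t\ge0$, $u\in\mathbb R$. Let $$\psi(z)=\frac{\sigma^2z^2}{2}+az+z\sum_{\ell=1}^{N}\frac{a_\ell}{\rho_\ell-z}-z\sum_{\ell=1}^{\hat N}\frac{\hat a_\ell}{\hat\rho_\ell+z}$$ be its Laplace exponent, as a rational function. Let $0<S_0<K$, $k:=K/S_0$, and assume the risk-neutral condition $\psi(1)=r>0$ and $\rho_1>1$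 (the latter being void if $N=0$). Let $C(T):=e^{-rT}\,\mathbb E[(S_0e^{X_T}-K)^+]$, $T\ge 0$. *Coefficients $b_n$.* For $1\le\ell\le N$ let $$\zeta_\ell=\rho_\ell+\sum_{n\ge1}\frac{1}{n}\,[z^{n-1}]\big(z\,\psi(z+\rho_\ell)\big)^n\,q^{-n},$$ where $[z^m]$ denotes the coefficient of $z^m$ of the Taylor series at $z=0$; by Lagrange's formula this is the formal solution of $\psi(\zeta)=q$ in powers of $q^{-1}$ with constant term $\rho_\ell$. For $n\ge 0$ let $b_n$ be the coefficient of $q^{-n}$ of $$\sum_{\ell=1}^N \frac{1}{\zeta_\ell}\cdot\frac1{\zeta_\ell-1}\cdot k^{-\zeta_\ell}\cdot\frac{d\zeta_\ell}{dq}.$$ *Coefficients $c_n$.* If $\sigma>0$, put $s=q^{-1/2}$ and $\kappa(v)=(v^2\psi(1/v))^{1/2}$, the square root with $\kappa(0)=\sigma/\sqrt2$; if $\sigma=0$ and $a>0$, put $s=q^{-1}$ and $\kappa(v)=v\,\psi(1/v)$, with $\kappa(0)=a$. Let $\zeta_M$ ($M=N+1$) be the formal solution of $\psi(\zeta)=q$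 given by $$\frac{1}{\zeta_M}=\sum_{n\ge1}\frac1n\,[v^{n-1}]\,\kappa(v)^n\,s^n,$$ so that $\zeta_M=(2q/\sigma^2)^{1/2}+O(1)$, resp. $\zeta_M=q/a+O(1)$. Let $c_n$ be the coefficient of $s^n$ of $$\frac{1}{\zeta_M}\cdot\frac1{\zeta_M-1}\cdot\beta_M\cdot\frac{d\zeta_M}{dq},\qquad \beta_M:=k^{(2q/\sigma^2)^{1/2}-\zeta_M},\ \text{ resp. }\ \beta_M:=k^{q/a-\zeta_M}.$$ *Functions $\varphi_n$.* Let $\mathbb H=\{z\in\mathbb C:\operatorname{Re}z>0\}$. For $n\ge 0$, $c\ge0$ and $z\in\mathbb H$ let $$\varphi_n(z;c)=\frac{z^{-3/2}}{2\sqrt\pi\,(n+1)!}\int_c^\infty e^{-\tau^2/(4z)}\,\tau\,(\tau-c)^{n+1}\,d\tau$$ (principal branch), and $\varphi_n(0;c):=0$. Then $\mathbb E[(S_0e^{X_T}-K)^+]<\infty$ for all $T\ge 0$; the series $\sum_{n\ge1}b_{n+1}T^n/n!$ converges for every $T\in\mathbb C$; and the following hold. 1. If $\sigma>0$, then with $c=\sqrt2\,\log(k)/\sigma$,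 $$C(T)=e^{-rT}K\Big(\sum_{n=1}^\infty b_{n+1}\frac{T^n}{n!}+\sum_{n=1}^\infty c_{n+2}\,\varphi_n(T;c)\Big),\qquad T\ge0.$$ The functions $\varphi_n(\cdot\,;c)$ are analytic on $\mathbb H$. The second series converges for every $T\in\mathbb H$, uniformly on compact subsets of $\mathbb H$; its sum is analytic on $\mathbb H$, and it may be differentiated termwise any number of times, the differentiated series again converging uniformly on compact subsets of $\mathbb H$. 2. If $\sigma=0$ and $a>0$, then with $c=\log(k)/a$, $$C(T)=e^{-rT}K\Big(\sum_{n=1}^\infty b_{n+1}\frac{T^n}{n!}+\mathbb I(T\ge c)\sum_{n=1}^\infty c_{n+1}\frac{(T-c)^n}{n!}\Big),\qquad T\ge0,$$ and the second series converges for every $T\in\mathbb C$. 3. If $\sigma=0$ and $a\le0$, then $$C(T)=e^{-rT}K\sum_{n=1}^\infty b_{n+1}\frac{T^n}{n!},\qquad T\ge0.$$ -/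

import Mathlib

open MeasureTheory ProbabilityTheory Filter Topology Set
open scoped NNReal

noncomputable section

namespace HyperExp

/-! ### The process -/

/-- A (real-valued) Lévy process: it starts at `0`, has independent and stationary increments,
and almost all of its paths are right-continuous with left limits. -/
structure IsLevyProcess {Ω : Type*} [MeasurableSpace Ω] (X : ℝ≥0 → Ω → ℝ) (P : Measure Ω) :
    Prop where
  measurable : ∀ t, Measurable (X t)
  start_zero : ∀ᵐ ω ∂P, X 0 ω = 0
  indep_increments : HasIndepIncrements X P
  stationary_increments : ∀ s t : ℝ≥0,
    IdentDistrib (fun ω => X (s + t) ω - X s ω) (X t) P P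
  cadlag : ∀ᵐ ω ∂P, ∀ t : ℝ≥0,
    ContinuousWithinAt (fun s => X s ω) (Ici t) t ∧
      ∃ l : ℝ, Tendsto (fun s => X s ω) (𝓝[<] t) (𝓝 l)

/-- The parameters of a hyperexponential process: the Gaussian coefficient `σ`, the drift `a`, the
weights `aPos ℓ` and rates `ρ ℓ` of the positive jumps, the weights `aNeg ℓ` and rates `ρNeg ℓ`
of the negative jumps. Either kind of jump may be absent (`N = 0`, `Nhat = 0`). -/
structure Params where
  N : ℕ
  Nhat : ℕ
  σ : ℝ
  a : ℝ
  aPos : Fin N → ℝ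
  ρ : Fin N → ℝ
  aNeg : Fin Nhat → ℝ
  ρNeg : Fin Nhat → ℝ
  σ_nonneg : 0 ≤ σ
  aPos_pos : ∀ i, 0 < aPos i
  ρ_pos : ∀ i, 0 < ρ i
  ρ_strictMono : StrictMono ρ
  aNeg_pos : ∀ i, 0 < aNeg i
  ρNeg_pos : ∀ i, 0 < ρNeg i
  ρNeg_strictMono : StrictMono ρNeg

/-- The density of the Lévy measure. -/
def levyDensity (p : Params) (x : ℝ) : ℝ :=
  if x < 0 then ∑ i, p.aNeg i * p.ρNeg i * Real.exp (p.ρNeg i * x)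
  else if 0 < x then ∑ i, p.aPos i * p.ρ i * Real.exp (-(p.ρ i * x))
  else 0

/-- The (finite) Lévy measure `ν`. -/
def levyMeasure (p : Params) : Measure ℝ :=
  volume.withDensity fun x => ENNReal.ofReal (levyDensity p x)

/-- The characteristic exponent `iau - σ²u²/2 + ∫ (e^{iux} - 1) ν(dx)`. -/
def charExponent (p : Params) (u : ℝ) : ℂ :=
  Complex.I * p.a * u - (p.σ : ℂ) ^ 2 * (u : ℂ) ^ 2 / 2
    + ∫ x : ℝ, (Complex.exp (Complex.I * u * x) - 1) ∂(levyMeasure p)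

/-- `X` is a hyperexponential Lévy process with parameters `p`, i.e. the Lévy process with drift
`a`, Gaussian coefficient `σ` and Lévy measure `ν` in the Lévy–Khintchine representation. -/
structure IsHyperexponential {Ω : Type*} [MeasurableSpace Ω] (X : ℝ≥0 → Ω → ℝ) (P : Measure Ω)
    (p : Params) : Prop where
  levy : IsLevyProcess X P
  charFun_eq : ∀ (t : ℝ≥0) (u : ℝ),
    charFun (P.map (X t)) u = Complex.exp ((t : ℝ) * charExponent p u)

/-- The Laplace exponent `ψ`, as a rational function. -/
def psi (p : Params) (z : ℂ) : ℂ :=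
  (p.σ : ℂ) ^ 2 * z ^ 2 / 2 + p.a * z
    + z * ∑ i, (p.aPos i : ℂ) / (p.ρ i - z)
    - z * ∑ i, (p.aNeg i : ℂ) / (p.ρNeg i + z)

/-- The risk-neutral condition `ψ(1) = r > 0` and `ρ₁ > 1` (`ρ₁` being the smallest of the
`ρ ℓ`; nothing is required of the `ρ ℓ` when there are no positive jumps). -/
structure RiskNeutral (p : Params) (r : ℝ) : Prop where
  psi_one : psi p 1 = r
  r_pos : 0 < r
  one_lt_ρ : ∀ i, 1 < p.ρ i

/-- The payoff `(S_T - K)⁺` of the call, with `S_T = S₀ exp(X_T)`. -/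
def callPayoff {Ω : Type*} (X : ℝ≥0 → Ω → ℝ) (S₀ K : ℝ) (T : ℝ≥0) (ω : Ω) : ℝ :=
  max (S₀ * Real.exp (X T ω) - K) 0

/-- The call price `C(T) = e^{-rT} E[(S_T - K)⁺]`. -/
def callPrice {Ω : Type*} [MeasurableSpace Ω] (X : ℝ≥0 → Ω → ℝ) (P : Measure Ω)
    (r S₀ K : ℝ) (T : ℝ≥0) : ℝ :=
  Real.exp (-(r * T)) * ∫ ω, callPayoff X S₀ K T ω ∂P

/-! ### Operations on formal series -/

/-- Given `κ = κ₀ + κ₁ z + ⋯` with `κ₀ ≠ 0`, the series `∑_{n ≥ 1} lₙ wⁿ` with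
`lₙ = (1 / n!) (d/dz)^{n-1} κ(z)ⁿ |_{z=0} = (1 / n) [z^{n-1}] κ(z)ⁿ`: by Lagrange's formula, the
solution `z` of `z / κ(z) = w`. -/
def lagrangeInv (κ : PowerSeries ℝ) : PowerSeries ℝ :=
  PowerSeries.mk fun n => if n = 0 then 0 else (1 / (n : ℝ)) * PowerSeries.coeff (n - 1) (κ ^ n)

/-- The coefficients of `c ^ f` for `c > 0`: with `f = f₀ + f̃`, the `n`-th coefficient of
`c^{f₀} ∑_m (log c)^m f̃^m / m!`, to which only the `m ≤ n` contribute. -/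
def constPow (c : ℝ) (f : PowerSeries ℝ) : PowerSeries ℝ :=
  PowerSeries.mk fun n => c ^ (PowerSeries.constantCoeff f) *
    ∑ m ∈ Finset.range (n + 1), (Real.log c) ^ m / (m.factorial : ℝ) *
      PowerSeries.coeff n ((f - PowerSeries.C (PowerSeries.constantCoeff f)) ^ m)

/-- The coefficients of the square root with positive constant term (see `sqrtSeries_mul_self`). -/
def sqrtCoeff (f : PowerSeries ℝ) : ℕ → ℝ
  | 0 => √(PowerSeries.coeff 0 f)
  | n + 1 => (PowerSeries.coeff (n + 1) f
      - ∑ i : Fin n, sqrtCoeff f (i + 1) * sqrtCoeff f (n - i)) / (2 * √(PowerSeries.coeff 0 f))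

/-- The square root of `f`, for `f` with positive constant term. -/
def sqrtSeries (f : PowerSeries ℝ) : PowerSeries ℝ := PowerSeries.mk (sqrtCoeff f)

theorem sqrtSeries_mul_self (f : PowerSeries ℝ) (hf : 0 < PowerSeries.coeff 0 f) :
    sqrtSeries f * sqrtSeries f = f := by
  have hs : 0 < √(PowerSeries.coeff 0 f) := Real.sqrt_pos.2 hf
  ext n
  rw [PowerSeries.coeff_mul, Finset.Nat.sum_antidiagonal_eq_sum_range_succ_mk]
  simp only [sqrtSeries, PowerSeries.coeff_mk]
  cases n with
  | zero =>
    have h0 : sqrtCoeff f 0 = √(PowerSeries.coeff 0 f) := by rw [sqrtCoeff]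
    rw [Finset.sum_range_one, Nat.sub_zero, h0, Real.mul_self_sqrt hf.le]
  | succ n =>
    rw [Finset.sum_range_succ, Finset.sum_range_succ']
    have h1 : ∑ i ∈ Finset.range n, sqrtCoeff f (i + 1) * sqrtCoeff f (n + 1 - (i + 1))
        = ∑ i : Fin n, sqrtCoeff f (i + 1) * sqrtCoeff f (n - i) := by
      rw [Finset.sum_range]
      simp
    rw [h1]
    have h2 : sqrtCoeff f (n + 1) = (PowerSeries.coeff (n + 1) f
      - ∑ i : Fin n, sqrtCoeff f (i + 1) * sqrtCoeff f (n - i)) / (2 * √(PowerSeries.coeff 0 f)) := by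
      rw [sqrtCoeff]
    have h0 : sqrtCoeff f 0 = √(PowerSeries.coeff 0 f) := by rw [sqrtCoeff]
    simp only [Nat.sub_zero, Nat.sub_self, h0]
    rw [h2]
    field_simp
    ring

/-- The series with its constant term dropped, divided by the variable. -/
def shift (f : PowerSeries ℝ) : PowerSeries ℝ :=
  PowerSeries.mk fun n => PowerSeries.coeff (n + 1) f

/-! ### The solutions `ζ₁, …, ζ_N` of `ψ(ζ) = q`, as series in `w = 1/q`, and the `bₙ` -/

/-- The coefficients `ωₙ` of the expansion of `ψ(z + ρ_ℓ)` at `z = 0`. -/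
def omega (p : Params) (l : Fin p.N) (n : ℕ) : ℝ :=
  if n = 0 then
    ∑ i ∈ Finset.univ.erase l, p.aPos i * p.ρ l / (p.ρ i - p.ρ l)
      - ∑ i, p.aNeg i * p.ρ l / (p.ρNeg i + p.ρ l) - p.aPos l
  else
    ∑ i ∈ Finset.univ.erase l, p.aPos i * p.ρ i / (p.ρ i - p.ρ l) ^ (n + 1)
      + (-1) ^ n * ∑ i, p.aNeg i * p.ρNeg i / (p.ρNeg i + p.ρ l) ^ (n + 1)

/-- The Taylor series of `z ψ(z + ρ_ℓ)` at `z = 0`. -/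
def zgSeries (p : Params) (l : Fin p.N) : PowerSeries ℝ :=
  PowerSeries.mk fun n => match n with
    | 0 => -(p.aPos l * p.ρ l)
    | 1 => p.σ ^ 2 * p.ρ l ^ 2 / 2 + p.a * p.ρ l + omega p l 0
    | 2 => p.σ ^ 2 * p.ρ l + p.a + omega p l 1
    | 3 => p.σ ^ 2 / 2 + omega p l 2
    | n + 4 => omega p l (n + 3)

/-- `ζ_ℓ`, the solution of `ψ(ζ) = 1/w` equal to `ρ_ℓ` at `w = 0`. Here `z = ζ_ℓ - ρ_ℓ` solves
`1/ψ(z + ρ_ℓ) = w`, that is, `z / κ(z) = w` with `κ(z) = z ψ(z + ρ_ℓ)`. -/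
def zeta (p : Params) (l : Fin p.N) : PowerSeries ℝ :=
  PowerSeries.C (p.ρ l) + lagrangeInv (zgSeries p l)

/-- The derivative `dζ_ℓ/dq`, for `ζ_ℓ = ∑ bₙ q⁻ⁿ`, as a series in `w = 1/q`. -/
def zetaDeriv (p : Params) (l : Fin p.N) : PowerSeries ℝ :=
  PowerSeries.mk fun n => if n = 0 then 0 else
    (1 - (n : ℝ)) * PowerSeries.coeff (n - 1) (zeta p l)

/-- `ξ_ℓ ς_ℓ β_ℓ ζ_ℓ'` with `ξ_ℓ = 1/ζ_ℓ`, `ς_ℓ = 1/(ζ_ℓ - 1)`, `β_ℓ = k^{-ζ_ℓ}`. -/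
def mSeries (p : Params) (k : ℝ) (l : Fin p.N) : PowerSeries ℝ :=
  (zeta p l)⁻¹ * (zeta p l - 1)⁻¹ * constPow k (-zeta p l) * zetaDeriv p l

/-- `bₙ = ∑_{ℓ ≤ N} m_{ℓ,n}`, where `m_{ℓ,n}` is the coefficient of `q⁻ⁿ` of
`ξ_ℓ ς_ℓ β_ℓ ζ_ℓ'`. -/
def bCoeff (p : Params) (k : ℝ) (n : ℕ) : ℝ :=
  ∑ l, PowerSeries.coeff n (mSeries p k l)

/-! ### The additional solution `ζ_M`, `M = N + 1`, and the `cₙ`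

For `σ > 0` series are in `s = q^{-1/2}`, for `σ = 0 < a` they are in `s = q^{-1}`. -/

/-- The coefficients `ηₙ`, `n ≥ 0`, of the expansion of `h(v) = ψ(1/v)` at `v = 0`. -/
def eta (p : Params) (n : ℕ) : ℝ :=
  -(∑ i, p.aPos i * p.ρ i ^ n + (-1) ^ n * ∑ i, p.aNeg i * p.ρNeg i ^ n)

/-- The Taylor series of `v² ψ(1/v)` at `v = 0`. -/
def vvhSeries (p : Params) : PowerSeries ℝ :=
  PowerSeries.mk fun n => match n with
    | 0 => p.σ ^ 2 / 2
    | 1 => p.a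
    | n + 2 => eta p n

/-- The Taylor series of `v ψ(1/v)` at `v = 0` when `σ = 0`. -/
def vhSeries (p : Params) : PowerSeries ℝ :=
  PowerSeries.mk fun n => match n with
    | 0 => p.a
    | n + 1 => eta p n

/-- For `σ > 0`: the series `v = 1/ζ_M` in `s = q^{-1/2}`. It solves `1/ψ(1/v) = s²`, that is,
`v / κ(v) = s` with `κ(v) = (v² ψ(1/v))^{1/2}`. -/
def xiGauss (p : Params) : PowerSeries ℝ := lagrangeInv (sqrtSeries (vvhSeries p))

/-- For `σ = 0 < a`: the series `v = 1/ζ_M` in `s = q^{-1}`. It solves `1/ψ(1/v) = s`, that is,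
`v / κ(v) = s` with `κ(v) = v ψ(1/v)`. -/
def xiDrift (p : Params) : PowerSeries ℝ := lagrangeInv (vhSeries p)

/-- From the series `ξ` of `1/ζ_M`, the power series `s ζ_M = b₋₁ + b₀ s + b₁ s² + ⋯`. -/
def sZeta (ξ : PowerSeries ℝ) : PowerSeries ℝ := (shift ξ)⁻¹

/-- `ς_M = 1/(ζ_M - 1) = s / (s ζ_M - s)`. -/
def varsigmaM (ξ : PowerSeries ℝ) : PowerSeries ℝ :=
  PowerSeries.X * (sZeta ξ - PowerSeries.X)⁻¹

/-- `β_M = k^{b₋₁/s} k^{-ζ_M} = k^{-(b₀ + b₁ s + ⋯)}`; here `b₋₁/s` is `(2q/σ²)^{1/2}` for `σ > 0`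
and `q/a` for `σ = 0 < a`. -/
def betaM (k : ℝ) (ξ : PowerSeries ℝ) : PowerSeries ℝ := constPow k (-shift (sZeta ξ))

/-- For `σ > 0`: `ζ_M' = ∑_{n ≥ 1} ((2 - n)/2) b_{n-2} s^n` with `s = q^{-1/2}`. -/
def zetaDerivGauss (p : Params) : PowerSeries ℝ :=
  PowerSeries.mk fun n => if n = 0 then 0 else
    (2 - (n : ℝ)) / 2 * PowerSeries.coeff (n - 1) (sZeta (xiGauss p))

/-- For `σ = 0 < a`: `ζ_M' = ∑_{n ≥ 0} (1 - n) b_{n-1} s^n` with `s = q^{-1}`. -/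
def zetaDerivDrift (p : Params) : PowerSeries ℝ :=
  PowerSeries.mk fun n => (1 - (n : ℝ)) * PowerSeries.coeff n (sZeta (xiDrift p))

/-- For `σ > 0`: `cₙ = m_{M,n}`, the coefficient of `q^{-n/2}` of `ξ_M ς_M β_M ζ_M'`. -/
def cGauss (p : Params) (k : ℝ) (n : ℕ) : ℝ :=
  PowerSeries.coeff n
    (xiGauss p * varsigmaM (xiGauss p) * betaM k (xiGauss p) * zetaDerivGauss p)

/-- For `σ = 0 < a`: `cₙ = m_{M,n}`, the coefficient of `q^{-n}` of `ξ_M ς_M β_M ζ_M'`. -/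
def cDrift (p : Params) (k : ℝ) (n : ℕ) : ℝ :=
  PowerSeries.coeff n
    (xiDrift p * varsigmaM (xiDrift p) * betaM k (xiDrift p) * zetaDerivDrift p)

/-! ### The functions `φₙ` -/

/-- `φₙ(z; c) = z^{-3/2} / (2 √π (n+1)!) ∫_c^∞ e^{-τ²/(4z)} τ (τ - c)^{n+1} dτ` for `Re z > 0`, and
`φₙ(0; c) = 0`, the limit at `0+` (see `phi_zero`). -/
def phi (n : ℕ) (c : ℝ) (z : ℂ) : ℂ :=
  z ^ (-(3 / 2) : ℂ) / (2 * (√Real.pi : ℂ) * ((n + 1).factorial : ℂ)) *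
    ∫ τ in Ioi c, Complex.exp (-((τ : ℂ) ^ 2 / (4 * z))) * (τ : ℂ) * ((τ : ℂ) - c) ^ (n + 1)

theorem phi_zero (n : ℕ) (c : ℝ) : phi n c 0 = 0 := by
  have h : (0 : ℂ) ^ (-(3 / 2) : ℂ) = 0 := Complex.zero_cpow (by norm_num)
  simp [phi, h]

/-! ### The terms of the series in the price formulas (all three are summed over `n ≥ 1`) -/

/-- `b_{n+1} zⁿ / n!`. -/
def bTerm (p : Params) (k : ℝ) (n : ℕ) (z : ℂ) : ℂ :=
  (bCoeff p k (n + 1) : ℂ) * z ^ n / (n.factorial : ℂ)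

/-- For `σ > 0`: `c_{n+2} φₙ(z; c)`. -/
def gaussTerm (p : Params) (k c : ℝ) (n : ℕ) (z : ℂ) : ℂ :=
  (cGauss p k (n + 2) : ℂ) * phi n c z

/-- For `σ = 0 < a`: `c_{n+1} (z - c)ⁿ / n!`. -/
def driftTerm (p : Params) (k c : ℝ) (n : ℕ) (z : ℂ) : ℂ :=
  (cDrift p k (n + 1) : ℂ) * (z - c) ^ n / (n.factorial : ℂ)

end HyperExp

end

/-! The price is a contour integral. A Gaussian law convolved with a compound Poisson law has the
prescribed characteristic function, so it is the law of `X_T`, and its transform `exp(T ψ(z))` is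
available for `0 ≤ Re z < ρ₁` (`map_eq_marginal`, `hasMGF_marginal`). Mellin inversion of `(1 - t)⁺`
writes the payoff as an integral of `e^{zw} k^{-z} / (z (z - 1))` over `Re z = c`, with `c > 1`
below all `ρ_ℓ`. By Fubini, `e^{rT} C(T)` is `K / (2πi)` times the integral of `e^{Tψ(z)} k^{-z} /
(z (z - 1))` over that line (`integral_payoff_eq`).

The line is then moved to `Re z = R`, to the right of all `ρ_ℓ`. Each `ρ_ℓ` is an essential
singularity of the integrand, but on a contour around it `e^{Tψ} = ∑ Tⁿ ψⁿ / n!` converges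
uniformly, and `ψⁿ` has only a pole of order `n` there. With `κ(v) = v ψ(ρ_ℓ + v)` and `g` the
payoff transform, the residue of `ψ^{m+1} g` is `[v^m] g(ρ_ℓ + v) κ(v)^{m+1}`. Lagrange's formula
(`coeff_tay_comp_mul_deriv`) turns this into a coefficient of `g(ζ_ℓ) dζ_ℓ/dq`, and the residues sum
to the first series (`coeff_mSeries`, `hasSum_bTerm`).

What remains is the integral over `Re z = R`. If `σ = 0` and `aT ≤ log k`, the integrand decays to
the right and the integral is zero (`integral_priceKernel_eq_zero`). Otherwise `u = ψ(z)^{1/2}` (`σ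
> 0`) or `u = ψ(z)` (`σ = 0 < a`) becomes the new variable. Since `u - κ₀ z` is bounded near
infinity for a constant `κ₀ > 0`, the image of the line can be straightened to a vertical line
(`integral_comp_mul_deriv_eq_integral_vertical`). The integrand becomes `e^{Tu² - cu}` or `e^{(T -
c)u}` times `u⁻² N(1/u)`, where `N` is analytic at `0` and its Taylor coefficients are, up to a
factor and a shift, the `cₙ`. Termwise integration leaves inverse Laplace transforms of powers of
`1/u`, namely the `φₙ` and `(T - c)ⁿ / n!`.

Convergence holds because the `cₙ` grow at most geometrically, while `φₙ` decays faster than every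
geometric sequence, uniformly on compact subsets of the half-plane (`norm_phi_le`). Weierstrass'
theorem then covers the derivatives. -/

namespace HyperExp

/-! ### Taylor series at the origin -/

/-- The Taylor series of `F` at `0`. -/
noncomputable def tay (F : ℂ → ℂ) : PowerSeries ℂ :=
  PowerSeries.mk fun n => iteratedDeriv n F 0 / (n.factorial : ℂ)

theorem coeff_tay (F : ℂ → ℂ) (n : ℕ) :
    PowerSeries.coeff n (tay F) = iteratedDeriv n F 0 / (n.factorial : ℂ) := by
  simp [tay]

theorem tay_congr {F G : ℂ → ℂ} (h : F =ᶠ[𝓝 0] G) : tay F = tay G := by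
  ext n
  rw [coeff_tay, coeff_tay, h.iteratedDeriv_eq]

theorem tay_add {F G : ℂ → ℂ} (hF : AnalyticAt ℂ F 0) (hG : AnalyticAt ℂ G 0) :
    tay (fun z => F z + G z) = tay F + tay G := by
  ext n
  have := iteratedDeriv_add (n := n) hF.contDiffAt hG.contDiffAt
  simp only [map_add, coeff_tay, ← add_div]
  rw [← this]; rfl

theorem tay_mul {F G : ℂ → ℂ} (hF : AnalyticAt ℂ F 0) (hG : AnalyticAt ℂ G 0) :
    tay (fun z => F z * G z) = tay F * tay G := by
  ext n
  have := iteratedDeriv_mul (n := n) hF.contDiffAt hG.contDiffAt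
  rw [coeff_tay, show (fun z => F z * G z) = F * G from rfl, this, PowerSeries.coeff_mul,
    Finset.Nat.sum_antidiagonal_eq_sum_range_succ_mk, Finset.sum_div]
  refine Finset.sum_congr rfl fun i hi => ?_
  rw [coeff_tay, coeff_tay, Nat.cast_choose _ (by grind)]
  field_simp [Nat.factorial_ne_zero]

theorem tay_const (c : ℂ) : tay (fun _ => c) = PowerSeries.C c := by
  ext n
  rw [coeff_tay, iteratedDeriv_const, PowerSeries.coeff_C]
  split_ifs with h <;> simp [h]

theorem analyticAt_fun_id0 : AnalyticAt ℂ (fun z : ℂ => z) 0 := analyticAt_id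

theorem tay_id : tay (fun z => z) = PowerSeries.X := by
  ext n
  rw [coeff_tay, PowerSeries.coeff_X]
  rcases n with _ | _ | n
  · simp
  · simp [iteratedDeriv_succ]
  · have : deriv (fun z : ℂ => z) = fun _ => 1 := by ext; simp
    rw [iteratedDeriv_succ', this, iteratedDeriv_const]; simp

theorem tay_neg {F : ℂ → ℂ} (hF : AnalyticAt ℂ F 0) : tay (fun z => -F z) = -tay F := by
  have := tay_mul (analyticAt_const (v := (-1 : ℂ))) hF
  simpa [tay_const] using this

theorem tay_sub {F G : ℂ → ℂ} (hF : AnalyticAt ℂ F 0) (hG : AnalyticAt ℂ G 0) :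
    tay (fun z => F z - G z) = tay F - tay G := by
  simpa [sub_eq_add_neg, tay_neg hG] using tay_add hF hG.fun_neg

theorem tay_pow {F : ℂ → ℂ} (hF : AnalyticAt ℂ F 0) (n : ℕ) :
    tay (fun z => F z ^ n) = tay F ^ n := by
  induction n with
  | zero => simpa using tay_const 1
  | succ n ih => simp only [pow_succ, ← ih]; exact tay_mul (hF.pow n) hF

theorem tay_deriv (F : ℂ → ℂ) : tay (deriv F) = PowerSeries.derivative ℂ (tay F) := by
  ext n
  rw [PowerSeries.coeff_derivative, coeff_tay, coeff_tay, iteratedDeriv_succ', Nat.factorial_succ]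
  have : ((n : ℂ) + 1) ≠ 0 := by exact_mod_cast Nat.succ_ne_zero n
  have h2 : ((n.factorial : ℕ) : ℂ) ≠ 0 := by exact_mod_cast Nat.factorial_ne_zero n
  push_cast
  field_simp

theorem coeff_zero_tay (F : ℂ → ℂ) : PowerSeries.coeff 0 (tay F) = F 0 := by
  simp [coeff_tay]

theorem constantCoeff_tay (F : ℂ → ℂ) : PowerSeries.constantCoeff (tay F) = F 0 := by
  rw [← PowerSeries.coeff_zero_eq_constantCoeff_apply, coeff_zero_tay]

theorem tay_finset_sum {ι : Type*} (s : Finset ι) (F : ι → ℂ → ℂ)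
    (hF : ∀ i ∈ s, AnalyticAt ℂ (F i) 0) :
    tay (fun z => ∑ i ∈ s, F i z) = ∑ i ∈ s, tay (F i) := by
  classical
  induction s using Finset.induction_on with
  | empty => simpa using tay_const 0
  | insert a s ha ih =>
    simp only [Finset.sum_insert ha]
    rw [tay_add (hF a (by simp)) (Finset.analyticAt_fun_sum s fun i hi => hF i (by simp [hi])),
      ih fun i hi => hF i (by simp [hi])]

theorem analyticAt_dslope {F : ℂ → ℂ} {a : ℂ} (hF : AnalyticAt ℂ F a) :
    AnalyticAt ℂ (dslope F a) a := by
  rw [Complex.analyticAt_iff_eventually_differentiableAt] at hF ⊢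
  obtain ⟨U, hU, hUo, ha⟩ := eventually_nhds_iff.1 hF
  have : DifferentiableOn ℂ F U := fun z hz => (hU z hz).differentiableWithinAt
  have h2 := (Complex.differentiableOn_dslope (hUo.mem_nhds ha)).2 this
  filter_upwards [hUo.mem_nhds ha] with z hz
  exact (h2 z hz).differentiableAt (hUo.mem_nhds hz)

theorem eq_add_mul_dslope (F : ℂ → ℂ) (z : ℂ) : F z = F 0 + z * dslope F 0 z := by
  have := sub_smul_dslope F 0 z
  simp only [sub_zero, smul_eq_mul] at this
  rw [this]; ring

/-- As `F z = F 0 + z * dslope F 0 z` holds for every `z`, `dslope` acts as removal of the constant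
term followed by division by the variable. Iteration gives Taylor's formula with an exact analytic
remainder. -/
theorem coeff_tay_dslope {F : ℂ → ℂ} (hF : AnalyticAt ℂ F 0) (n : ℕ) :
    PowerSeries.coeff n (tay (dslope F 0)) = PowerSeries.coeff (n + 1) (tay F) := by
  have h : tay F = PowerSeries.C (F 0) + PowerSeries.X * tay (dslope F 0) := by
    conv_lhs => rw [show F = fun z => F 0 + z * dslope F 0 z from funext (eq_add_mul_dslope F)]
    rw [tay_add analyticAt_const (analyticAt_fun_id0.fun_mul (analyticAt_dslope hF)), tay_const,
      ← tay_id]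
    congr 1
    exact tay_mul analyticAt_fun_id0 (analyticAt_dslope hF)
  rw [h]
  simp [PowerSeries.coeff_succ_X_mul]

/-- Taylor's formula with an analytic remainder. -/
theorem exists_taylor_remainder {F : ℂ → ℂ} (hF : AnalyticAt ℂ F 0) (n : ℕ) :
    ∃ R : ℂ → ℂ, AnalyticAt ℂ R 0 ∧ ∀ z, F z =
      ∑ j ∈ Finset.range n, PowerSeries.coeff j (tay F) * z ^ j + z ^ n * R z := by
  induction n generalizing F with
  | zero => exact ⟨F, hF, fun z => by simp⟩
  | succ n ih =>
    obtain ⟨R, hR, h⟩ := ih (analyticAt_dslope hF)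
    refine ⟨R, hR, fun z => ?_⟩
    rw [eq_add_mul_dslope F z, h z, Finset.sum_range_succ', coeff_zero_tay, mul_add,
      Finset.mul_sum]
    simp only [coeff_tay_dslope hF, pow_zero, mul_one]
    have : ∀ j ∈ Finset.range n, z * (PowerSeries.coeff (j + 1) (tay F) * z ^ j)
        = PowerSeries.coeff (j + 1) (tay F) * z ^ (j + 1) := fun j _ => by ring
    rw [Finset.sum_congr rfl this]
    ring

/-! ### Calculus of analytic functions with a given real Taylor series -/

/-- The function `F` is analytic at `0` with Taylor series `f`. -/
def Rep (f : PowerSeries ℝ) (F : ℂ → ℂ) : Prop :=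
  AnalyticAt ℂ F 0 ∧ tay F = PowerSeries.map (algebraMap ℝ ℂ) f

variable {f g : PowerSeries ℝ} {F G : ℂ → ℂ}

theorem Rep.congr (h : Rep f F) (h2 : F =ᶠ[𝓝 0] G) : Rep f G :=
  ⟨h.1.congr h2, by rw [← tay_congr h2, h.2]⟩

theorem Rep.mul (hf : Rep f F) (hg : Rep g G) : Rep (f * g) (fun z => F z * G z) :=
  ⟨hf.1.mul hg.1, by rw [tay_mul hf.1 hg.1, hf.2, hg.2, map_mul]⟩

theorem Rep.add (hf : Rep f F) (hg : Rep g G) : Rep (f + g) (fun z => F z + G z) :=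
  ⟨hf.1.add hg.1, by rw [tay_add hf.1 hg.1, hf.2, hg.2, map_add]⟩

theorem Rep.neg (hf : Rep f F) : Rep (-f) (fun z => -F z) :=
  ⟨hf.1.neg, by rw [tay_neg hf.1, hf.2, map_neg]⟩

theorem Rep.sub (hf : Rep f F) (hg : Rep g G) : Rep (f - g) (fun z => F z - G z) :=
  ⟨hf.1.sub hg.1, by rw [tay_sub hf.1 hg.1, hf.2, hg.2, map_sub]⟩

theorem Rep.pow (hf : Rep f F) (n : ℕ) : Rep (f ^ n) (fun z => F z ^ n) :=
  ⟨hf.1.pow n, by rw [tay_pow hf.1, hf.2, map_pow]⟩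

theorem Rep.const (c : ℝ) : Rep (PowerSeries.C c) (fun _ => (c : ℂ)) :=
  ⟨analyticAt_const, by rw [tay_const, PowerSeries.map_C]; rfl⟩

theorem Rep.id : Rep PowerSeries.X (fun z => z) :=
  ⟨analyticAt_fun_id0, by rw [tay_id, PowerSeries.map_X]⟩

theorem Rep.derivative (hf : Rep f F) : Rep (PowerSeries.derivative ℝ f) (deriv F) := by
  refine ⟨hf.1.deriv, ?_⟩
  rw [tay_deriv, hf.2]
  ext n
  simp [PowerSeries.coeff_derivative]

theorem Rep.coeff (hf : Rep f F) (n : ℕ) :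
    PowerSeries.coeff n (tay F) = ((PowerSeries.coeff n f : ℝ) : ℂ) := by
  rw [hf.2]; simp

theorem Rep.eval_zero (hf : Rep f F) : F 0 = ((PowerSeries.constantCoeff f : ℝ) : ℂ) := by
  rw [← coeff_zero_tay F, hf.coeff, PowerSeries.coeff_zero_eq_constantCoeff_apply]

theorem Rep.inv (hf : Rep f F) (h0 : PowerSeries.constantCoeff f ≠ 0) :
    Rep f⁻¹ (fun z => (F z)⁻¹) := by
  have hF0 : F 0 ≠ 0 := by rw [hf.eval_zero]; exact_mod_cast h0
  refine ⟨hf.1.inv hF0, ?_⟩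
  have h1 : tay F * tay (fun z => (F z)⁻¹) = 1 := by
    rw [← tay_mul hf.1 (hf.1.fun_inv hF0)]
    have : (fun z => F z * (F z)⁻¹) =ᶠ[𝓝 0] fun _ => 1 := by
      filter_upwards [hf.1.continuousAt.eventually_ne hF0] with z hz
      exact mul_inv_cancel₀ hz
    rw [tay_congr this, tay_const, map_one]
  have h2 : tay F * PowerSeries.map (algebraMap ℝ ℂ) f⁻¹ = 1 := by
    rw [hf.2, ← map_mul, PowerSeries.mul_inv_cancel _ h0, map_one]
  have h3 : tay F ≠ 0 := fun h => by simp [h] at h1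
  exact mul_left_cancel₀ h3 (h1.trans h2.symm)

theorem Rep.shift (hf : Rep f F) : Rep (shift f) (dslope F 0) := by
  refine ⟨analyticAt_dslope hf.1, ?_⟩
  ext n
  rw [coeff_tay_dslope hf.1, hf.coeff]
  simp [HyperExp.shift]

/-- A branch `F` of the square root has Taylor series `sqrtSeries f`. -/
theorem Rep.sqrtSeries (hf : Rep f F) (h0 : 0 < PowerSeries.coeff 0 f)
    (hG : AnalyticAt ℂ G 0) (hGF : ∀ᶠ z in 𝓝 0, G z * G z = F z)
    (hG0 : G 0 = (√(PowerSeries.coeff 0 f) : ℝ)) : Rep (sqrtSeries f) G := by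
  refine ⟨hG, ?_⟩
  set s := PowerSeries.map (algebraMap ℝ ℂ) (HyperExp.sqrtSeries f)
  have h1 : tay G * tay G = s * s := by
    rw [← tay_mul hG hG, tay_congr hGF, hf.2, ← map_mul, sqrtSeries_mul_self f h0]
  have h2 : (tay G - s) * (tay G + s) = 0 := by linear_combination h1
  have hs : PowerSeries.coeff 0 s = (√(PowerSeries.coeff 0 f) : ℝ) := by
    simp [s, HyperExp.sqrtSeries, sqrtCoeff]
  -- Power series over `ℂ` form a domain, so `tay G = ± s`; the sign is decided by the constant
  -- terms, both equal to the positive root.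
  have h3 : tay G + s ≠ 0 := by
    intro h
    have := congrArg (PowerSeries.coeff 0) h
    rw [map_add, coeff_zero_tay, hs, hG0, map_zero] at this
    have h4 := Real.sqrt_pos.2 h0
    norm_cast at this
    linarith
  exact sub_eq_zero.1 ((mul_eq_zero.1 h2).resolve_right h3)

/-- The truncation at `m ≤ n` in `constPow` is exact: `f - f₀` is divisible by the variable, so the
Taylor remainder of `exp` of order `n + 1`, composed with it, is divisible by the power `n + 1` and
does not reach coefficient `n`. -/
theorem Rep.constPow (hf : Rep f F) {c : ℝ} (hc : 0 < c) :
    Rep (constPow c f) (fun z => Complex.exp (Real.log c * F z)) := by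
  set L : ℂ := (Real.log c : ℂ)
  set f₀ := PowerSeries.constantCoeff f
  refine ⟨(analyticAt_const.mul hf.1).cexp, ?_⟩
  ext n
  have hft : Rep (f - PowerSeries.C f₀) (fun z => F z - f₀) := hf.sub (Rep.const _)
  obtain ⟨R, hR, hE⟩ := exists_taylor_remainder (F := Complex.exp) (by fun_prop) (n + 1)
  have hexp : ∀ j, PowerSeries.coeff j (tay Complex.exp) = 1 / (j.factorial : ℂ) := by
    intro j; rw [coeff_tay, iteratedDeriv_eq_iterate, Complex.iter_deriv_exp]; simp
  have h0 : F 0 - (f₀ : ℂ) = 0 := by rw [hf.eval_zero]; simp [f₀]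
  have hlin : AnalyticAt ℂ (fun z => L * (F z - f₀)) 0 := analyticAt_const.mul hft.1
  have hRF : AnalyticAt ℂ (fun z => L ^ (n + 1) * R (L * (F z - f₀))) 0 := by
    refine analyticAt_const.mul (AnalyticAt.fun_comp ?_ hlin)
    simpa [h0] using hR
  have hdec : (fun z => Complex.exp (L * F z)) = fun z => Complex.exp (L * f₀) *
      (∑ j ∈ Finset.range (n + 1), (L ^ j / (j.factorial : ℂ)) * (F z - f₀) ^ j
        + (F z - f₀) ^ (n + 1) * (L ^ (n + 1) * R (L * (F z - f₀)))) := by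
    funext z
    have h1 : Complex.exp (L * F z)
        = Complex.exp (L * f₀) * Complex.exp (L * (F z - f₀)) := by
      rw [← Complex.exp_add]; ring_nf
    rw [h1, hE (L * (F z - f₀))]
    have h2 : ∀ a b c d e : ℂ, b = c → d = e → a * (b + d) = a * (c + e) := by
      rintro a b c d e rfl rfl; rfl
    apply h2
    · refine Finset.sum_congr rfl fun j _ => ?_
      rw [hexp, mul_pow]; ring
    · rw [mul_pow]; ring
  have hterm : ∀ j ∈ Finset.range (n + 1),
      AnalyticAt ℂ (fun z => (L ^ j / (j.factorial : ℂ)) * (F z - f₀) ^ j) 0 :=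
    fun j _ => analyticAt_const.mul (hft.1.pow j)
  rw [hdec, tay_mul analyticAt_const ((Finset.analyticAt_fun_sum _ hterm).fun_add
      ((hft.1.fun_pow _).fun_mul hRF)), tay_const, PowerSeries.coeff_C_mul,
    tay_add (Finset.analyticAt_fun_sum _ hterm) ((hft.1.fun_pow _).fun_mul hRF), map_add,
    tay_mul (hft.1.fun_pow _) hRF, tay_pow hft.1, tay_finset_sum _ _ hterm, map_sum]
  have hz : PowerSeries.coeff n (tay (fun z => F z - f₀) ^ (n + 1)
      * tay fun z => L ^ (n + 1) * R (L * (F z - f₀))) = 0 := by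
    have hX : PowerSeries.X ∣ tay (fun z => F z - f₀) := by
      rw [PowerSeries.X_dvd_iff, constantCoeff_tay, h0]
    exact PowerSeries.X_pow_dvd_iff.1 ((pow_dvd_pow_of_dvd hX (n + 1)).mul_right _) n (by omega)
  rw [hz, add_zero]
  have he : Complex.exp (L * f₀) = ((c ^ f₀ : ℝ) : ℂ) := by
    rw [Real.rpow_def_of_pos hc]; push_cast; rfl
  rw [he, PowerSeries.coeff_map]
  simp only [HyperExp.constPow, PowerSeries.coeff_mk]
  simp only [Complex.coe_algebraMap, Complex.ofReal_mul, Complex.ofReal_sum]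
  congr 1
  refine Finset.sum_congr rfl fun j _ => ?_
  rw [tay_mul analyticAt_const (hft.1.fun_pow j), tay_const, PowerSeries.coeff_C_mul,
    (hft.pow j).coeff]
  simp only [L, f₀]
  push_cast
  ring

/-! ### Lagrange inversion -/

/-- The coefficient is the formal residue of `t' / t^{m+1}`: for `m ≥ 1` this is the derivative of a
Laurent series and has no residue, for `m = 0` it is a logarithmic derivative. Laurent series are
avoided: `t k = X` gives `k^{m+1} t' = k^m - X k^{m-1} k'`, and the two coefficients cancel because
`(k^m)' = m k^{m-1} k'`. -/
theorem coeff_pow_mul_derivative {k t : PowerSeries ℂ} (h : t * k = PowerSeries.X)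
    (h0 : PowerSeries.constantCoeff k ≠ 0) (m : ℕ) :
    PowerSeries.coeff m (k ^ (m + 1) * PowerSeries.derivative ℂ t) = if m = 0 then 1 else 0 := by
  have hd : PowerSeries.derivative ℂ t * k + t * PowerSeries.derivative ℂ k = 1 := by
    have := congrArg (PowerSeries.derivative ℂ) h
    rw [Derivation.leibniz, PowerSeries.derivative_X, smul_eq_mul, smul_eq_mul] at this
    rw [← this]; ring
  have ht0 : PowerSeries.constantCoeff t = 0 := by
    have := congrArg PowerSeries.constantCoeff h
    rw [map_mul, PowerSeries.constantCoeff_X] at this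
    exact (mul_eq_zero.1 this).resolve_right h0
  rcases m with _ | m
  · have : k ^ 1 * PowerSeries.derivative ℂ t = 1 - t * PowerSeries.derivative ℂ k := by
      linear_combination hd
    rw [zero_add, this]
    simp [ht0]
  · have h1 : k ^ (m + 2) * PowerSeries.derivative ℂ t
        = k ^ (m + 1) - PowerSeries.X * (k ^ m * PowerSeries.derivative ℂ k) := by
      linear_combination k ^ (m + 1) * hd - k ^ m * PowerSeries.derivative ℂ k * h
    have h2 : PowerSeries.derivative ℂ (k ^ (m + 1))
        = PowerSeries.C ((m : ℂ) + 1) * (k ^ m * PowerSeries.derivative ℂ k) := by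
      rw [Derivation.leibniz_pow]
      simp [← Nat.cast_smul_eq_nsmul ℂ, PowerSeries.smul_eq_C_mul]
    have h3 := congrArg (PowerSeries.coeff m) h2
    rw [PowerSeries.coeff_derivative, PowerSeries.coeff_C_mul] at h3
    have h4 : ((m : ℂ) + 1) ≠ 0 := by exact_mod_cast Nat.succ_ne_zero m
    have h5 : PowerSeries.coeff (m + 1) (k ^ (m + 1))
        = PowerSeries.coeff m (k ^ m * PowerSeries.derivative ℂ k) := by
      apply mul_left_cancel₀ h4
      rw [← h3]; ring
    rw [h1, map_sub, PowerSeries.coeff_succ_X_mul, h5]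
    simp

variable {κ h H : ℂ → ℂ}

/-- Lagrange's formula for `h` the inverse of `v ↦ v / κ v`. -/
theorem coeff_tay_comp_mul_deriv (hκ : AnalyticAt ℂ κ 0) (hκ0 : κ 0 ≠ 0)
    (hh : AnalyticAt ℂ h 0) (hh0 : h 0 = 0) (hinv : ∀ᶠ v in 𝓝 0, h (v / κ v) = v)
    (hH : AnalyticAt ℂ H 0) (n : ℕ) :
    PowerSeries.coeff n (tay fun s => H (h s) * deriv h s)
      = PowerSeries.coeff n (tay fun v => H v * κ v ^ (n + 1)) := by
  set θ : ℂ → ℂ := fun v => v / κ v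
  have hθ : AnalyticAt ℂ θ 0 := analyticAt_fun_id0.div hκ hκ0
  have hθ0 : θ 0 = 0 := by simp [θ]
  have hE : AnalyticAt ℂ (fun s => H (h s) * deriv h s) 0 :=
    (AnalyticAt.fun_comp (by rwa [hh0]) hh).mul hh.deriv
  obtain ⟨R, hR, hER⟩ := exists_taylor_remainder hE (n + 1)
  set e := fun j => PowerSeries.coeff j (tay fun s => H (h s) * deriv h s)
  have hRθ : AnalyticAt ℂ (fun v => R (θ v) * deriv θ v) 0 :=
    (AnalyticAt.fun_comp (by rwa [hθ0]) hθ).mul hθ.deriv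
  have hchain : ∀ᶠ v in 𝓝 0, deriv h (θ v) * deriv θ v = 1 := by
    have h1 : ∀ᶠ v in 𝓝 (0 : ℂ), AnalyticAt ℂ h (θ v) :=
      hθ.continuousAt.eventually (by rw [hθ0]; exact hh.eventually_analyticAt)
    filter_upwards [hinv.eventually_nhds, h1, hθ.eventually_analyticAt] with v hv h1 h2
    have h3 := (h1.differentiableAt.hasDerivAt.comp v h2.differentiableAt.hasDerivAt).deriv
    rw [← h3]
    have : (h ∘ θ) =ᶠ[𝓝 v] fun z => z := hv
    rw [this.deriv_eq]; simp
  have hne : ∀ᶠ v in 𝓝 (0 : ℂ), κ v ≠ 0 := hκ.continuousAt.eventually_ne hκ0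
  -- Taylor's formula for `(H ∘ h) h'` at `s = θ v`, multiplied by `θ'`, gives `H` by the chain
  -- rule. As `κ θ = v`, the `j`-th term becomes `v^j κ^{n-j+1} θ'`, and by the residue computation
  -- only `j = n` contributes to coefficient `n`.
  have hkey : (fun v => H v * κ v ^ (n + 1)) =ᶠ[𝓝 0] fun v =>
      ∑ j ∈ Finset.range (n + 1), e j * (v ^ j * (κ v ^ (n - j + 1) * deriv θ v))
        + v ^ (n + 1) * (R (θ v) * deriv θ v) := by
    filter_upwards [hinv, hchain, hne] with v h1 h2 h3
    have h4 := hER (θ v)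
    have hκθ : κ v * θ v = v := by simp only [θ]; field_simp
    have h5 : H v = (H (h (θ v)) * deriv h (θ v)) * deriv θ v := by
      rw [mul_assoc, h2, mul_one, show h (θ v) = v from h1]
    rw [h5, h4, add_mul, add_mul, Finset.sum_mul, Finset.sum_mul]
    congr 1
    · refine Finset.sum_congr rfl fun j hj => ?_
      have : n + 1 = j + (n - j + 1) := by have := Finset.mem_range.1 hj; omega
      have h6 : κ v ^ (n + 1) = κ v ^ j * κ v ^ (n - j + 1) := by rw [← pow_add, ← this]
      rw [h6]
      calc _ = e j * ((κ v * θ v) ^ j * (κ v ^ (n - j + 1) * deriv θ v)) := by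
            rw [mul_pow]; simp only [e]; ring
        _ = _ := by rw [hκθ]
    · calc _ = (κ v * θ v) ^ (n + 1) * (R (θ v) * deriv θ v) := by rw [mul_pow]; ring
        _ = _ := by rw [hκθ]
  have hin : ∀ j, AnalyticAt ℂ (fun v => κ v ^ (n - j + 1) * deriv θ v) 0 :=
    fun j => (hκ.pow _).mul hθ.deriv
  have hterm : ∀ j ∈ Finset.range (n + 1),
      AnalyticAt ℂ (fun v => e j * (v ^ j * (κ v ^ (n - j + 1) * deriv θ v))) 0 :=
    fun j _ => analyticAt_const.mul ((analyticAt_fun_id0.pow j).mul (hin j))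
  have hX : tay θ * tay κ = PowerSeries.X := by
    rw [← tay_mul hθ hκ, ← tay_id]
    refine tay_congr ?_
    filter_upwards [hne] with v hv
    simp only [θ]; field_simp
  have hrest : PowerSeries.coeff n (tay fun v => v ^ (n + 1) * (R (θ v) * deriv θ v)) = 0 := by
    rw [tay_mul (analyticAt_fun_id0.fun_pow _) hRθ, show (tay fun v => v ^ (n + 1)) =
      PowerSeries.X ^ (n + 1) by rw [← tay_id]; exact tay_pow analyticAt_fun_id0 _]
    exact PowerSeries.X_pow_dvd_iff.1 (dvd_mul_right _ _) n (by omega)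
  rw [tay_congr hkey, tay_add (Finset.analyticAt_fun_sum _ hterm)
    ((analyticAt_fun_id0.fun_pow _).fun_mul hRθ), map_add, hrest, add_zero, tay_finset_sum _ _ hterm, map_sum,
    Finset.sum_eq_single_of_mem n (by simp)]
  · rw [tay_mul analyticAt_const ((analyticAt_fun_id0.fun_pow _).fun_mul (hin n)), tay_const,
      PowerSeries.coeff_C_mul, tay_mul (analyticAt_fun_id0.fun_pow _) (hin n),
      show (tay fun v => v ^ n) = PowerSeries.X ^ n by
        rw [← tay_id]; exact tay_pow analyticAt_fun_id0 _, PowerSeries.coeff_X_pow_mul']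
    simp [coeff_zero_tay]
    have := coeff_pow_mul_derivative hX (by rwa [constantCoeff_tay]) 0
    simp only [zero_add, pow_one, if_true] at this
    rw [PowerSeries.coeff_mul] at this
    simp [← tay_deriv, constantCoeff_tay] at this
    rw [this, mul_one]
  · intro j hj hjn
    have hj' : j ≤ n := by have := Finset.mem_range.1 hj; omega
    rw [tay_mul analyticAt_const ((analyticAt_fun_id0.fun_pow _).fun_mul (hin j)), tay_const,
      PowerSeries.coeff_C_mul, tay_mul (analyticAt_fun_id0.fun_pow _) (hin j),
      show (tay fun v => v ^ j) = PowerSeries.X ^ j by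
        rw [← tay_id]; exact tay_pow analyticAt_fun_id0 _, PowerSeries.coeff_X_pow_mul', if_pos hj',
      tay_mul (hκ.fun_pow _) hθ.deriv, tay_pow hκ, tay_deriv,
      coeff_pow_mul_derivative hX (by rwa [constantCoeff_tay]), if_neg (by omega), mul_zero]

/-- The derivative of `v / κ v` at `0` is `1 / κ 0 ≠ 0`, so the analytic inverse function theorem
applies. -/
theorem exists_analytic_inverse (hκ : AnalyticAt ℂ κ 0) (hκ0 : κ 0 ≠ 0) :
    ∃ h : ℂ → ℂ, AnalyticAt ℂ h 0 ∧ h 0 = 0 ∧ (∀ᶠ v in 𝓝 0, h (v / κ v) = v) ∧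
      ∀ᶠ s in 𝓝 0, h s / κ (h s) = s := by
  set θ : ℂ → ℂ := fun v => v / κ v with hθd
  have hθ : AnalyticAt ℂ θ 0 := analyticAt_fun_id0.div hκ hκ0
  have hθ0 : θ 0 = 0 := by simp [θ]
  have hd : deriv θ 0 ≠ 0 := by
    have := ((hasDerivAt_id (0 : ℂ)).div hκ.differentiableAt.hasDerivAt hκ0).deriv
    rw [show (id / κ : ℂ → ℂ) = θ from rfl] at this
    rw [this]
    simp [hκ0]
  have hs := hθ.hasStrictDerivAt
  have h1 := hθ.analyticAt_localInverse hd
  rw [hθ0] at h1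
  refine ⟨_, h1, ?_, ?_, ?_⟩
  · have := (hs.hasStrictFDerivAt_equiv hd).localInverse_apply_image
    rw [hθ0] at this
    exact this
  · exact (hs.hasStrictFDerivAt_equiv hd).eventually_left_inverse
  · have := (hs.hasStrictFDerivAt_equiv hd).eventually_right_inverse
    rw [hθ0] at this
    exact this

/-- Lagrange's formula with `H = 1` gives the coefficients of `h'`; integration supplies the factor
`1 / n`, and `h 0 = 0` the constant term. -/
theorem Rep.lagrangeInv (hκ : Rep f κ) (hκ0 : κ 0 ≠ 0)
    (hh : AnalyticAt ℂ h 0) (hh0 : h 0 = 0) (hinv : ∀ᶠ v in 𝓝 0, h (v / κ v) = v) :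
    Rep (lagrangeInv f) h := by
  refine ⟨hh, ?_⟩
  ext n
  rcases n with _ | n
  · rw [coeff_zero_tay, hh0]; simp [HyperExp.lagrangeInv]
  · have h1 := coeff_tay_comp_mul_deriv hκ.1 hκ0 hh hh0 hinv (analyticAt_const (v := (1 : ℂ))) n
    simp only [one_mul] at h1
    rw [show (fun s => deriv h s) = deriv h from rfl, tay_deriv, PowerSeries.coeff_derivative,
      (hκ.pow _).coeff] at h1
    have h4 : ((n : ℂ) + 1) ≠ 0 := by exact_mod_cast Nat.succ_ne_zero n
    simp only [HyperExp.lagrangeInv, PowerSeries.coeff_map, PowerSeries.coeff_mk]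
    simp only [Nat.add_one_ne_zero, if_false, Nat.add_sub_cancel, Complex.coe_algebraMap,
      Complex.ofReal_mul]
    rw [← h1]
    push_cast
    field_simp

end HyperExp

namespace HyperExp

/-! ### Contour integrals over rectangles and vertical lines -/

/-- The integral of `f` over the boundary of `[a, b] × [-Y, Y]`, counterclockwise. -/
noncomputable def rectInt (f : ℂ → ℂ) (a b Y : ℝ) : ℂ :=
  (∫ x in a..b, f (x + (-Y : ℝ) * Complex.I)) - (∫ x in a..b, f (x + Y * Complex.I))
    + Complex.I * (∫ y in (-Y)..Y, f (b + y * Complex.I))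
    - Complex.I * ∫ y in (-Y)..Y, f (a + y * Complex.I)

/-- The boundary of `[a, b] × [-Y, Y]`. -/
def rectBdry (a b Y : ℝ) : Set ℂ :=
  {z | a ≤ z.re ∧ z.re ≤ b ∧ |z.im| ≤ Y ∧ (z.re = a ∨ z.re = b ∨ |z.im| = Y)}

variable {f g : ℂ → ℂ} {a b c Y : ℝ}

theorem isCompact_rectBdry (a b Y : ℝ) : IsCompact (rectBdry a b Y) := by
  refine IsCompact.of_isClosed_subset (isCompact_Icc.reProdIm isCompact_Icc :
    IsCompact (Icc a b ×ℂ Icc (-Y) Y)) ?_ ?_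
  · refine (isClosed_le continuous_const Complex.continuous_re).inter
      ((isClosed_le Complex.continuous_re continuous_const).inter
      ((isClosed_le Complex.continuous_im.abs continuous_const).inter
      ((isClosed_eq Complex.continuous_re continuous_const).union
      ((isClosed_eq Complex.continuous_re continuous_const).union
      (isClosed_eq Complex.continuous_im.abs continuous_const)))))
  · rintro z ⟨h1, h2, h3, -⟩
    exact ⟨⟨h1, h2⟩, abs_le.1 h3⟩

theorem bot_mem_rectBdry (hY : 0 ≤ Y) {x : ℝ} (hx : x ∈ Icc a b) :
    (x + (-Y : ℝ) * Complex.I : ℂ) ∈ rectBdry a b Y := by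
  simp [rectBdry, hx.1, hx.2, abs_of_nonneg hY]

theorem top_mem_rectBdry (hY : 0 ≤ Y) {x : ℝ} (hx : x ∈ Icc a b) :
    (x + Y * Complex.I : ℂ) ∈ rectBdry a b Y := by
  simp [rectBdry, hx.1, hx.2, abs_of_nonneg hY]

theorem left_mem_rectBdry (hab : a ≤ b) {y : ℝ} (hy : y ∈ Icc (-Y) Y) :
    (a + y * Complex.I : ℂ) ∈ rectBdry a b Y := by
  simp [rectBdry, hab, abs_le.2 hy]

theorem right_mem_rectBdry (hab : a ≤ b) {y : ℝ} (hy : y ∈ Icc (-Y) Y) :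
    (b + y * Complex.I : ℂ) ∈ rectBdry a b Y := by
  simp [rectBdry, hab, abs_le.2 hy]

theorem rectInt_hasSum (hab : a ≤ b) (hY : 0 ≤ Y) {F : ℕ → ℂ → ℂ} {u : ℕ → ℝ}
    (hu : Summable u) (hF : ∀ n, ContinuousOn (F n) (rectBdry a b Y))
    (hb : ∀ n, ∀ z ∈ rectBdry a b Y, ‖F n z‖ ≤ u n)
    (hs : ∀ z ∈ rectBdry a b Y, HasSum (fun n => F n z) (f z)) :
    HasSum (fun n => rectInt (F n) a b Y) (rectInt f a b Y) := by
  have key : ∀ (s t : ℝ) (γ : ℝ → ℂ), Continuous γ → s ≤ t →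
      (∀ x ∈ Icc s t, γ x ∈ rectBdry a b Y) →
      HasSum (fun n => ∫ x in s..t, F n (γ x)) (∫ x in s..t, f (γ x)) := by
    intro s t γ hγ hst hm
    have hm' : ∀ x ∈ Set.uIoc s t, γ x ∈ rectBdry a b Y := fun x hx => by
      rw [uIoc_of_le hst] at hx
      exact hm x ⟨hx.1.le, hx.2⟩
    refine intervalIntegral.hasSum_integral_of_dominated_convergence (fun n _ => u n)
      (fun n => ?_) (fun n => ae_of_all _ fun x hx => hb n _ (hm' x hx))
      (ae_of_all _ fun _ _ => hu) (by simp) (ae_of_all _ fun x hx => hs _ (hm' x hx))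
    exact ((hF n).comp hγ.continuousOn hm').aestronglyMeasurable measurableSet_uIoc
  have hY' : -Y ≤ Y := by linarith
  exact (((key a b (fun x => x + (-Y : ℝ) * Complex.I) (by fun_prop) hab
      fun x hx => bot_mem_rectBdry hY hx).sub
    (key a b (fun x => x + Y * Complex.I) (by fun_prop) hab
      fun x hx => top_mem_rectBdry hY hx)).add
    ((key (-Y) Y (fun y => b + y * Complex.I) (by fun_prop) hY'
      fun x hx => right_mem_rectBdry hab hx).mul_left Complex.I)).sub
    ((key (-Y) Y (fun y => a + y * Complex.I) (by fun_prop) hY'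
      fun x hx => left_mem_rectBdry hab hx).mul_left Complex.I)

theorem rectInt_congr (hab : a ≤ b) (hY : 0 ≤ Y) (h : ∀ z ∈ rectBdry a b Y, f z = g z) :
    rectInt f a b Y = rectInt g a b Y := by
  have hY' : -Y ≤ Y := by linarith
  simp only [rectInt]
  congr 1
  · congr 1
    · congr 1 <;> refine intervalIntegral.integral_congr fun x hx => ?_ <;>
        rw [uIcc_of_le hab] at hx
      · exact h _ (bot_mem_rectBdry hY hx)
      · exact h _ (top_mem_rectBdry hY hx)
    · congr 1; refine intervalIntegral.integral_congr fun x hx => ?_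
      rw [uIcc_of_le hY'] at hx
      exact h _ (right_mem_rectBdry hab hx)
  · congr 1; refine intervalIntegral.integral_congr fun x hx => ?_
    rw [uIcc_of_le hY'] at hx
    exact h _ (left_mem_rectBdry hab hx)

theorem rectInt_const_mul (c : ℂ) (f : ℂ → ℂ) (a b Y : ℝ) :
    rectInt (fun z => c * f z) a b Y = c * rectInt f a b Y := by
  simp only [rectInt, intervalIntegral.integral_const_mul]
  ring

theorem rectInt_add (hab : a ≤ b) (hY : 0 ≤ Y) (hf : ContinuousOn f (rectBdry a b Y))
    (hg : ContinuousOn g (rectBdry a b Y)) :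
    rectInt (fun z => f z + g z) a b Y = rectInt f a b Y + rectInt g a b Y := by
  have hY' : -Y ≤ Y := by linarith
  have key : ∀ (s t : ℝ) (γ : ℝ → ℂ), Continuous γ → s ≤ t →
      (∀ x ∈ Icc s t, γ x ∈ rectBdry a b Y) →
      ∫ x in s..t, (f (γ x) + g (γ x)) = (∫ x in s..t, f (γ x)) + ∫ x in s..t, g (γ x) := by
    intro s t γ hγ hst hm
    rw [← uIcc_of_le hst] at hm
    exact intervalIntegral.integral_add
      (hf.comp hγ.continuousOn hm).intervalIntegrable
      (hg.comp hγ.continuousOn hm).intervalIntegrable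
  simp only [rectInt]
  rw [key a b (fun x => x + (-Y : ℝ) * Complex.I) (by fun_prop) hab
      fun x hx => bot_mem_rectBdry hY hx,
    key a b (fun x => x + Y * Complex.I) (by fun_prop) hab
      fun x hx => top_mem_rectBdry hY hx,
    key (-Y) Y (fun y => b + y * Complex.I) (by fun_prop) hY'
      fun x hx => right_mem_rectBdry hab hx,
    key (-Y) Y (fun y => a + y * Complex.I) (by fun_prop) hY'
      fun x hx => left_mem_rectBdry hab hx]
  ring

theorem rectInt_eq_zero (hab : a ≤ b) (Y : ℝ)
    (hf : ∀ z : ℂ, a ≤ z.re → z.re ≤ b → DifferentiableAt ℂ f z) : rectInt f a b Y = 0 := by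
  have := Complex.integral_boundary_rect_eq_zero_of_differentiableOn f ⟨a, -Y⟩ ⟨b, Y⟩ (by
    rintro z ⟨hz, -⟩
    rw [uIcc_of_le hab] at hz
    exact (hf z hz.1 hz.2).differentiableWithinAt)
  simpa [rectInt] using this

/-- The common vertical side cancels as an expression, whatever its value. Only the horizontal sides
have to be integrable, so singularities on the real axis do no harm. -/
theorem rectInt_add_adjacent (hY : 0 < Y) (hf : ∀ z : ℂ, z.im ≠ 0 → ContinuousAt f z)
    (a b c : ℝ) : rectInt f a b Y + rectInt f b c Y = rectInt f a c Y := by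
  have key : ∀ y : ℝ, y ≠ 0 → ∀ s t : ℝ,
      IntervalIntegrable (fun x : ℝ => f (x + y * Complex.I)) volume s t := by
    intro y hy s t
    refine Continuous.intervalIntegrable (continuous_iff_continuousAt.2 fun x => ?_) _ _
    exact ContinuousAt.comp (f := fun x : ℝ => (x + y * Complex.I : ℂ)) (hf _ (by simpa))
      (by fun_prop)
  simp only [rectInt]
  rw [← intervalIntegral.integral_add_adjacent_intervals (key _ hY.ne' a b) (key _ hY.ne' b c),
    ← intervalIntegral.integral_add_adjacent_intervals (key _ (neg_ne_zero.2 hY.ne') a b)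
      (key _ (neg_ne_zero.2 hY.ne') b c)]
  ring

theorem sum_rectInt_adjacent (hY : 0 < Y) (hf : ∀ z : ℂ, z.im ≠ 0 → ContinuousAt f z)
    (d : ℕ → ℝ) (n : ℕ) :
    ∑ l ∈ Finset.range n, rectInt f (d l) (d (l + 1)) Y = rectInt f (d 0) (d n) Y := by
  induction n with
  | zero => simp [rectInt]
  | succ n ih => rw [Finset.sum_range_succ, ih, rectInt_add_adjacent hY hf]

theorem integral_horizontal {Φ : ℂ → ℂ} (hab : a ≤ b) (y : ℝ)
    (h : ∀ x ∈ Icc a b, HasDerivAt Φ (f (x + y * Complex.I)) (x + y * Complex.I))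
    (hc : ContinuousOn (fun x : ℝ => f (x + y * Complex.I)) (Icc a b)) :
    ∫ x in a..b, f (x + y * Complex.I) = Φ (b + y * Complex.I) - Φ (a + y * Complex.I) := by
  rw [← uIcc_of_le hab] at h hc
  refine intervalIntegral.integral_eq_sub_of_hasDerivAt (f := fun x : ℝ => Φ (x + y * Complex.I))
    (fun x hx => ?_) hc.intervalIntegrable
  have h1 : HasDerivAt (fun x : ℝ => (x + y * Complex.I : ℂ)) 1 x :=
    (Complex.ofRealCLM.hasDerivAt (x := x)).add_const _
  exact ((h x hx).comp x h1).congr_deriv (mul_one _)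

theorem integral_vertical {Φ : ℂ → ℂ} (hab : a ≤ b) (x : ℝ)
    (h : ∀ y ∈ Icc a b, HasDerivAt Φ (f (x + y * Complex.I)) (x + y * Complex.I))
    (hc : ContinuousOn (fun y : ℝ => f (x + y * Complex.I)) (Icc a b)) :
    Complex.I * ∫ y in a..b, f (x + y * Complex.I)
      = Φ (x + b * Complex.I) - Φ (x + a * Complex.I) := by
  rw [← uIcc_of_le hab] at h hc
  rw [← intervalIntegral.integral_const_mul]
  refine intervalIntegral.integral_eq_sub_of_hasDerivAt (f := fun y : ℝ => Φ (x + y * Complex.I))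
    (fun y hy => ?_) (continuousOn_const.mul hc).intervalIntegrable
  have h1 : HasDerivAt (fun y : ℝ => (x + y * Complex.I : ℂ)) Complex.I y := by
    simpa using ((Complex.ofRealCLM.hasDerivAt (x := y)).mul_const Complex.I).const_add (x : ℂ)
  exact ((h y hy).comp y h1).congr_deriv (mul_comm _ _)

/-- The integral of a derivative over the boundary of a rectangle vanishes. -/
theorem rectInt_of_hasDerivAt {Φ : ℂ → ℂ} (hab : a ≤ b) (hY : 0 ≤ Y)
    (h : ∀ z ∈ rectBdry a b Y, HasDerivAt Φ (f z) z) (hc : ContinuousOn f (rectBdry a b Y)) :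
    rectInt f a b Y = 0 := by
  have hY' : -Y ≤ Y := by linarith
  rw [rectInt, integral_horizontal (Φ := Φ) hab (-Y) (fun x hx => h _ (bot_mem_rectBdry hY hx))
      (hc.comp (by fun_prop) fun x hx => bot_mem_rectBdry hY hx),
    integral_horizontal (Φ := Φ) hab Y (fun x hx => h _ (top_mem_rectBdry hY hx))
      (hc.comp (by fun_prop) fun x hx => top_mem_rectBdry hY hx),
    integral_vertical (Φ := Φ) hY' a (fun x hx => h _ (left_mem_rectBdry hab hx))
      (hc.comp (by fun_prop) fun x hx => left_mem_rectBdry hab hx),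
    integral_vertical (Φ := Φ) hY' b (fun x hx => h _ (right_mem_rectBdry hab hx))
      (hc.comp (by fun_prop) fun x hx => right_mem_rectBdry hab hx)]
  ring

variable {ρ : ℝ}

theorem sub_ne_zero_of_mem_rectBdry (ha : a < ρ) (hb : ρ < b) (hY : 0 < Y) {z : ℂ}
    (hz : z ∈ rectBdry a b Y) : z - ρ ≠ 0 := by
  intro h
  have h1 : z = ρ := sub_eq_zero.1 h
  rcases hz with ⟨-, -, -, h2 | h2 | h2⟩ <;> simp [h1] at h2 <;> linarith

theorem continuousOn_inv_pow_rectBdry (ha : a < ρ) (hb : ρ < b) (hY : 0 < Y) (n : ℕ) :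
    ContinuousOn (fun z : ℂ => ((z - ρ) ^ n)⁻¹) (rectBdry a b Y) :=
  ContinuousOn.inv₀ (by fun_prop) fun _ hz =>
    pow_ne_zero _ (sub_ne_zero_of_mem_rectBdry ha hb hY hz)

/-- The primitive `log (z - ρ)` serves on the bottom, top and right sides. The left side crosses its
branch cut, so `log (-(z - ρ))` is used there; the mismatch of the two branches is `π i` at each of
the two left corners. -/
theorem rectInt_inv (ha : a < ρ) (hb : ρ < b) (hY : 0 < Y) :
    rectInt (fun z => (z - ρ)⁻¹) a b Y = 2 * Real.pi * Complex.I := by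
  have hab : a ≤ b := (ha.trans hb).le
  have hY' : -Y ≤ Y := by linarith
  have hc : ContinuousOn (fun z : ℂ => (z - ρ)⁻¹) (rectBdry a b Y) := by
    simpa using continuousOn_inv_pow_rectBdry ha hb hY 1
  have hlog : ∀ z : ℂ, (z - ρ) ∈ Complex.slitPlane →
      HasDerivAt (fun z : ℂ => Complex.log (z - ρ)) ((z - ρ)⁻¹) z := fun z hz => by
    simpa using ((hasDerivAt_id z).sub_const (ρ : ℂ)).clog hz
  have hlog' : ∀ z : ℂ, -(z - ρ) ∈ Complex.slitPlane →
      HasDerivAt (fun z : ℂ => Complex.log (-(z - ρ))) ((z - ρ)⁻¹) z := fun z hz => by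
    have := ((hasDerivAt_id z).sub_const (ρ : ℂ)).fun_neg.clog hz
    exact this.congr_deriv (by rw [neg_div_neg_eq, one_div]; rfl)
  rw [rectInt, integral_horizontal (f := fun z => (z - ρ)⁻¹) hab (-Y) (fun x hx => hlog _ (Or.inr (by simpa using hY.ne')))
      (hc.comp (by fun_prop) fun x hx => bot_mem_rectBdry hY.le hx),
    integral_horizontal (f := fun z => (z - ρ)⁻¹) hab Y (fun x hx => hlog _ (Or.inr (by simpa using hY.ne')))
      (hc.comp (by fun_prop) fun x hx => top_mem_rectBdry hY.le hx),
    integral_vertical (f := fun z => (z - ρ)⁻¹) hY' b (fun x hx => hlog _ (Or.inl (by simpa using hb)))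
      (hc.comp (by fun_prop) fun x hx => right_mem_rectBdry hab hx),
    integral_vertical (f := fun z => (z - ρ)⁻¹) hY' a (fun x hx => hlog' _ (Or.inl (by simpa using ha)))
      (hc.comp (by fun_prop) fun x hx => left_mem_rectBdry hab hx)]
  have hneg : ∀ w : ℂ, 0 < w.im → Complex.log w - Complex.log (-w) = Real.pi * Complex.I := by
    intro w hw
    rw [Complex.log, Complex.log, Complex.arg_neg_eq_arg_sub_pi_of_im_pos hw, norm_neg]
    push_cast; ring
  have h1 := hneg (a + Y * Complex.I - ρ) (by simpa using hY)
  have h2 := hneg (-(a + (-Y : ℝ) * Complex.I - ρ)) (by simpa using hY)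
  rw [neg_neg] at h2
  linear_combination h1 + h2

theorem rectInt_inv_pow (ha : a < ρ) (hb : ρ < b) (hY : 0 < Y) (n : ℕ) :
    rectInt (fun z => ((z - ρ) ^ (n + 1))⁻¹) a b Y = if n = 0 then 2 * Real.pi * Complex.I else 0 := by
  rcases n with _ | n
  · simpa using rectInt_inv ha hb hY
  · simp only [Nat.add_one_ne_zero, if_false]
    have hn : ((n : ℂ) + 1) ≠ 0 := by exact_mod_cast Nat.succ_ne_zero n
    refine rectInt_of_hasDerivAt (Φ := fun z => -((z - ρ) ^ (n + 1))⁻¹ / ((n : ℂ) + 1))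
      (ha.trans hb).le hY.le (fun z hz => ?_) (continuousOn_inv_pow_rectBdry ha hb hY _)
    have h0 := sub_ne_zero_of_mem_rectBdry ha hb hY hz
    have := (((((hasDerivAt_id z).sub_const (ρ : ℂ)).fun_pow (n + 1)).fun_inv
      (pow_ne_zero _ h0)).fun_neg).div_const ((n : ℂ) + 1)
    refine this.congr_deriv ?_
    simp only [id]
    push_cast
    field_simp
    ring_nf

/-- The residue theorem for a rectangle and one pole. -/
theorem rectInt_pole (ha : a < ρ) (hb : ρ < b) (hY : 0 < Y) {H : ℂ → ℂ}
    (hH : ∀ z : ℂ, a ≤ z.re → z.re ≤ b → DifferentiableAt ℂ H z)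
    (hHρ : AnalyticAt ℂ H ρ) (n : ℕ) :
    rectInt (fun z => ((z - ρ) ^ (n + 1))⁻¹ * H z) a b Y
      = 2 * Real.pi * Complex.I * PowerSeries.coeff n (tay fun v => H (ρ + v)) := by
  have hab := (ha.trans hb).le
  have hdH : ∀ H : ℂ → ℂ, (∀ z : ℂ, a ≤ z.re → z.re ≤ b → DifferentiableAt ℂ H z) →
      AnalyticAt ℂ H ρ →
      ∀ z : ℂ, a ≤ z.re → z.re ≤ b → DifferentiableAt ℂ (dslope H ρ) z := by
    intro H hH hHρ z h1 h2
    by_cases hz : z = ρ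
    · rw [hz]; exact (analyticAt_dslope hHρ).differentiableAt
    · exact (differentiableAt_dslope_of_ne hz).2 (hH z h1 h2)
  have hcont : ∀ H : ℂ → ℂ, (∀ z : ℂ, a ≤ z.re → z.re ≤ b → DifferentiableAt ℂ H z) →
      ContinuousOn H (rectBdry a b Y) := fun H hH z hz =>
    (hH z hz.1 hz.2.1).continuousAt.continuousWithinAt
  have hsplit : ∀ (H : ℂ → ℂ) (z : ℂ), H z = H ρ + (z - ρ) * dslope H ρ z := fun H z => by
    have := sub_smul_dslope H (ρ : ℂ) z
    simp only [smul_eq_mul] at this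
    rw [this]; ring
  have hds : ∀ H : ℂ → ℂ, AnalyticAt ℂ H ρ →
      (fun v => dslope H ρ (ρ + v)) = dslope (fun v => H (ρ + v)) 0 := by
    intro H hHρ
    funext v
    by_cases hv : v = 0
    · subst hv
      simp only [add_zero, dslope_same]
      rw [deriv_comp_const_add, add_zero]
    · rw [dslope_of_ne _ hv, dslope_of_ne _ (by simpa using hv)]
      simp [slope_def_field]
  -- Writing `H z = H ρ + (z - ρ) * dslope H ρ z` splits off a pure power of `(z - ρ)⁻¹`, which
  -- contributes only if it is the first power. Passing to `dslope` lowers the order of the pole and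
  -- shifts the Taylor coefficients by one.
  induction n generalizing H with
  | zero =>
    have e : ∀ z ∈ rectBdry a b Y, ((z - ρ) ^ (0 + 1))⁻¹ * H z
        = H ρ * ((z - ρ) ^ (0 + 1))⁻¹ + dslope H ρ z := fun z hz => by
      have h0 := sub_ne_zero_of_mem_rectBdry ha hb hY hz
      rw [hsplit H z]
      field_simp
      try ring
    rw [rectInt_congr hab hY.le e, rectInt_add hab hY.le
      (continuousOn_const.fun_mul (continuousOn_inv_pow_rectBdry ha hb hY _))
      (hcont _ (hdH H hH hHρ)), rectInt_const_mul, rectInt_inv_pow ha hb hY,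
      rectInt_eq_zero hab Y (hdH H hH hHρ), coeff_zero_tay]
    simp [mul_comm]
  | succ n ih =>
    have e : ∀ z ∈ rectBdry a b Y, ((z - ρ) ^ (n + 1 + 1))⁻¹ * H z
        = H ρ * ((z - ρ) ^ (n + 1 + 1))⁻¹ + ((z - ρ) ^ (n + 1))⁻¹ * dslope H ρ z := fun z hz => by
      have h0 := sub_ne_zero_of_mem_rectBdry ha hb hY hz
      rw [hsplit H z]
      field_simp
      try ring
    have hsh : AnalyticAt ℂ (fun v => H (ρ + v)) 0 :=
      AnalyticAt.fun_comp (by simpa using hHρ) (by fun_prop)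
    rw [rectInt_congr hab hY.le e, rectInt_add hab hY.le
      (continuousOn_const.fun_mul (continuousOn_inv_pow_rectBdry ha hb hY _))
      ((continuousOn_inv_pow_rectBdry ha hb hY _).fun_mul (hcont _ (hdH H hH hHρ))),
      rectInt_const_mul, rectInt_inv_pow ha hb hY, ih (hdH H hH hHρ) (analyticAt_dslope hHρ),
      hds H hHρ, coeff_tay_dslope hsh]
    simp

theorem integrable_of_norm_le_inv_one_add_sq {φ : ℝ → ℂ} (hφ : Continuous φ) {C : ℝ}
    (h : ∀ y, ‖φ y‖ ≤ C / (1 + y ^ 2)) : Integrable φ := by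
  refine (integrable_inv_one_add_sq.const_mul C).mono' hφ.aestronglyMeasurable
    (ae_of_all _ fun y => ?_)
  simpa [div_eq_mul_inv] using h y

/-- Shift of a vertical line of integration. -/
theorem vertical_shift (hab : a ≤ b) {C : ℝ} {J : ℂ}
    (hJ : ∀ Y, 0 < Y → rectInt f a b Y = J)
    (hca : Continuous fun y : ℝ => f (a + y * Complex.I))
    (hcb : Continuous fun y : ℝ => f (b + y * Complex.I))
    (hb : ∀ z : ℂ, a ≤ z.re → z.re ≤ b → (z.re = a ∨ z.re = b ∨ 1 ≤ |z.im|) →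
      ‖f z‖ ≤ C / (1 + z.im ^ 2)) :
    Complex.I * (∫ y : ℝ, f (b + y * Complex.I)) - Complex.I * ∫ y : ℝ, f (a + y * Complex.I)
      = J := by
  have hia : Integrable fun y : ℝ => f (a + y * Complex.I) :=
    integrable_of_norm_le_inv_one_add_sq (C := C) hca fun y => by
      simpa using hb (a + y * Complex.I) (by simp) (by simpa) (by simp)
  have hib : Integrable fun y : ℝ => f (b + y * Complex.I) :=
    integrable_of_norm_le_inv_one_add_sq (C := C) hcb fun y => by
      simpa using hb (b + y * Complex.I) (by simpa) (by simp) (by simp)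
  have hbot : Tendsto (fun Y : ℝ => (-Y)) atTop atBot := tendsto_neg_atTop_atBot
  have t1 := intervalIntegral_tendsto_integral hia hbot tendsto_id
  have t2 := intervalIntegral_tendsto_integral hib hbot tendsto_id
  have hC : Tendsto (fun Y : ℝ => C / (1 + Y ^ 2) * |b - a|) atTop (𝓝 0) := by
    have : Tendsto (fun Y : ℝ => 1 + Y ^ 2) atTop atTop :=
      tendsto_atTop_add_const_left _ _ (tendsto_pow_atTop two_ne_zero)
    simpa using ((tendsto_const_nhds (x := C)).div_atTop this).mul_const |b - a|
  -- The values `s = 1` and `s = -1` are the top and bottom sides. From height `1` on the bound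
  -- holds along them, so they contribute `O(Y⁻²)`.
  have hor : ∀ s : ℝ, |s| = 1 →
      Tendsto (fun Y : ℝ => ∫ x in a..b, f (x + (s * Y : ℝ) * Complex.I)) atTop (𝓝 0) := by
    intro s hs
    refine squeeze_zero_norm' ?_ hC
    filter_upwards [eventually_ge_atTop 1] with Y hY
    refine intervalIntegral.norm_integral_le_of_norm_le_const fun x hx => ?_
    rw [uIoc_of_le hab] at hx
    have h1 : |s * Y| = Y := by rw [abs_mul, hs, one_mul, abs_of_nonneg (by linarith)]
    have h2 := hb (x + (s * Y : ℝ) * Complex.I) (by simpa using hx.1.le) (by simpa using hx.2)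
      (by right; right; simp only [Complex.add_im, Complex.ofReal_im, Complex.mul_im,
            Complex.ofReal_re, Complex.I_im, Complex.I_re, mul_one, mul_zero, zero_add, add_zero]
          rw [h1]; exact hY)
    have h3 : (s * Y) ^ 2 = Y ^ 2 := by rw [← sq_abs, h1]
    simpa [-Complex.ofReal_mul, h3] using h2
  have t3 := hor (-1) (by simp)
  have t4 := hor 1 (by simp)
  simp only [neg_one_mul, one_mul] at t3 t4
  have key := ((t3.sub t4).add (t2.const_mul Complex.I)).sub (t1.const_mul Complex.I)
  have key2 : Tendsto (fun Y => rectInt f a b Y) atTop (𝓝 J) := by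
    refine tendsto_const_nhds.congr' ?_
    filter_upwards [eventually_gt_atTop 0] with Y hY
    exact (hJ Y hY).symm
  have := tendsto_nhds_unique key2 key
  rw [this]; ring

/-- A vertical integral of a function that decays to the right vanishes. -/
theorem integral_vertical_eq_zero (ha : 0 < a) {C : ℝ}
    (hf : ∀ z : ℂ, a ≤ z.re → DifferentiableAt ℂ f z)
    (hb : ∀ z : ℂ, a ≤ z.re → ‖f z‖ ≤ C / (z.re ^ 2 + z.im ^ 2)) :
    ∫ y : ℝ, f (a + y * Complex.I) = 0 := by
  have hC : 0 ≤ C := by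
    have h := (norm_nonneg _).trans (hb a (by simp))
    have : 0 < a ^ 2 := by positivity
    simp only [Complex.ofReal_re, Complex.ofReal_im] at h
    by_contra hC
    have := div_neg_of_neg_of_pos (not_le.1 hC) (show 0 < a ^ 2 + 0 ^ 2 by positivity)
    linarith
  have hcont : ∀ x : ℝ, a ≤ x → Continuous fun y : ℝ => f (x + y * Complex.I) := fun x hx =>
    continuous_iff_continuousAt.2 fun y => ContinuousAt.comp
      (f := fun y : ℝ => (x + y * Complex.I : ℂ)) (hf _ (by simpa)).continuousAt (by fun_prop)
  -- Chosen so that `m (1 + y²) ≤ x² + y²` for `x ≥ a`. This uniform bound allows the shift of the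
  -- line and the dominated convergence; the decay in `x` is needed only for the pointwise limit.
  set m := min (a ^ 2) 1
  have hm : 0 < m := by positivity
  have hb' : ∀ z : ℂ, a ≤ z.re → ‖f z‖ ≤ C / m / (1 + z.im ^ 2) := fun z hz => by
    refine (hb z hz).trans ?_
    rw [div_div]
    gcongr
    have h1 : m ≤ a ^ 2 := min_le_left _ _
    have h2 : m ≤ 1 := min_le_right _ _
    nlinarith [sq_nonneg z.im]
  have hconst : ∀ b : ℝ, a ≤ b →
      ∫ y : ℝ, f (b + y * Complex.I) = ∫ y : ℝ, f (a + y * Complex.I) := by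
    intro b hab
    have := vertical_shift (J := 0) hab
      (fun Y hY => rectInt_eq_zero hab Y fun z h1 _ => hf z h1)
      (hcont a le_rfl) (hcont b hab) fun z h1 _ _ => hb' z h1
    rw [← mul_sub] at this
    exact sub_eq_zero.1 ((mul_eq_zero.1 this).resolve_left Complex.I_ne_zero)
  have hlim : Tendsto (fun b : ℝ => ∫ y : ℝ, f (b + y * Complex.I)) atTop
      (𝓝 (∫ _ : ℝ, (0 : ℂ))) := by
    refine tendsto_integral_filter_of_dominated_convergence (fun y => C / m * (1 + y ^ 2)⁻¹)
      ?_ ?_ (integrable_inv_one_add_sq.const_mul _) (ae_of_all _ fun y => ?_)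
    · filter_upwards [eventually_ge_atTop a] with b hab
      exact (hcont b hab).aestronglyMeasurable
    · filter_upwards [eventually_ge_atTop a] with b hab
      refine ae_of_all _ fun y => ?_
      simpa [div_eq_mul_inv] using hb' (b + y * Complex.I) (by simpa)
    · have h1 : Tendsto (fun b : ℝ => C / (b ^ 2 + y ^ 2)) atTop (𝓝 0) :=
        tendsto_const_nhds.div_atTop
          (tendsto_atTop_add_const_right _ _ (tendsto_pow_atTop two_ne_zero))
      refine squeeze_zero_norm' ?_ h1
      filter_upwards [eventually_ge_atTop a] with b hab
      simpa using hb (b + y * Complex.I) (by simpa)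
  have h0 : Tendsto (fun b : ℝ => ∫ y : ℝ, f (b + y * Complex.I)) atTop
      (𝓝 (∫ y : ℝ, f (a + y * Complex.I))) := by
    refine tendsto_const_nhds.congr' ?_
    filter_upwards [eventually_ge_atTop a] with b hab
    exact (hconst b hab).symm
  simpa using tendsto_nhds_unique h0 hlim

end HyperExp

namespace HyperExp

/-! ### The law of the process and its exponential moments -/

/-- The complex exponential moment `∫ e^{zx} μ(dx)` exists and equals `v`. -/
def HasMGF (μ : Measure ℝ) (z v : ℂ) : Prop :=
  Integrable (fun x : ℝ => Complex.exp (z * x)) μ ∧ ∫ x : ℝ, Complex.exp (z * x) ∂μ = v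

variable {μ ν : Measure ℝ} {z v w : ℂ}

theorem HasMGF.conv [IsFiniteMeasure μ] [IsFiniteMeasure ν] (hμ : HasMGF μ z v)
    (hν : HasMGF ν z w) : HasMGF (μ ∗ ν) z (v * w) := by
  have hm : Measurable fun p : ℝ × ℝ => p.1 + p.2 := by fun_prop
  have hs : AEStronglyMeasurable (fun x : ℝ => Complex.exp (z * x)) (μ ∗ ν) :=
    Continuous.aestronglyMeasurable (by fun_prop)
  have he : (fun p : ℝ × ℝ => Complex.exp (z * (p.1 + p.2 : ℝ)))
      = fun p : ℝ × ℝ => Complex.exp (z * p.1) * Complex.exp (z * p.2) := by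
    funext p; rw [← Complex.exp_add]; push_cast; ring_nf
  constructor
  · rw [Measure.conv, integrable_map_measure hs hm.aemeasurable]
    exact (hμ.1.mul_prod hν.1).congr (ae_of_all _ fun q => (congrFun he q).symm)
  · rw [Measure.conv, integral_map hm.aemeasurable hs, he, integral_prod_mul
      (fun x : ℝ => Complex.exp (z * x)) (fun x : ℝ => Complex.exp (z * x)), hμ.2, hν.2]

theorem hasMGF_dirac_zero (z : ℂ) : HasMGF (Measure.dirac 0) z 1 :=
  ⟨integrable_dirac (by simp), by simp⟩

/-- `|e^{zx}|` is the exponential at `Re z`, so its integral is itself a moment. Applied to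
convolution powers this gives a geometric bound, which makes the compound Poisson sum integrable. -/
theorem HasMGF.integral_norm (h : HasMGF μ (z.re : ℂ) v) :
    ∫ x : ℝ, ‖Complex.exp (z * x)‖ ∂μ = ‖v‖ := by
  have h1 : (fun x : ℝ => Complex.exp ((z.re : ℂ) * x))
      = fun x : ℝ => ((‖Complex.exp (z * x)‖ : ℝ) : ℂ) := by
    funext x
    rw [Complex.norm_exp]
    simp
  have h2 := h.2
  rw [h1, integral_complex_ofReal] at h2
  rw [← h2, Complex.norm_real]
  exact (Real.norm_of_nonneg (integral_nonneg fun _ => norm_nonneg _)).symm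

/-- The convolution powers of a measure. -/
noncomputable def convPow (ν : Measure ℝ) : ℕ → Measure ℝ
  | 0 => Measure.dirac 0
  | n + 1 => convPow ν n ∗ ν

instance isFiniteMeasure_convPow [IsFiniteMeasure ν] (n : ℕ) : IsFiniteMeasure (convPow ν n) := by
  induction n with
  | zero => rw [convPow]; infer_instance
  | succ n ih => rw [convPow]; infer_instance

theorem HasMGF.convPow [IsFiniteMeasure ν] (h : HasMGF ν z v) (n : ℕ) :
    HasMGF (convPow ν n) z (v ^ n) := by
  induction n with
  | zero => simpa [HyperExp.convPow] using hasMGF_dirac_zero z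
  | succ n ih => rw [HyperExp.convPow, pow_succ]; exact ih.conv h

theorem HasMGF.smul (h : HasMGF μ z v) {c : ℝ} (hc : 0 ≤ c) :
    HasMGF (ENNReal.ofReal c • μ) z (c * v) :=
  ⟨h.1.smul_measure ENNReal.ofReal_ne_top, by
    rw [integral_smul_measure, h.2, ENNReal.toReal_ofReal hc]; simp⟩

/-- The unnormalized compound Poisson measure `∑ tⁿ ν^{*n} / n!`. -/
noncomputable def expMeasure (ν : Measure ℝ) (t : ℝ) : Measure ℝ :=
  Measure.sum fun n : ℕ => ENNReal.ofReal (t ^ n / n.factorial) • convPow ν n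

theorem HasMGF.expMeasure [IsFiniteMeasure ν] (h : HasMGF ν z v)
    (h' : HasMGF ν (z.re : ℂ) w) {t : ℝ} (ht : 0 ≤ t) :
    HasMGF (expMeasure ν t) z (Complex.exp (t * v)) := by
  have h0 : ∀ n : ℕ, 0 ≤ t ^ n / n.factorial := fun n => by positivity
  have hi : Integrable (fun x : ℝ => Complex.exp (z * x)) (HyperExp.expMeasure ν t) := by
    refine integrable_sum_measure (fun n => ((h.convPow n).smul (h0 n)).1) ?_
    have : ∀ n : ℕ, ∫ x : ℝ, ‖Complex.exp (z * x)‖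
        ∂(ENNReal.ofReal (t ^ n / n.factorial) • HyperExp.convPow ν n)
        = (t * ‖w‖) ^ n / n.factorial := by
      intro n
      rw [((h'.convPow n).smul (h0 n)).integral_norm, norm_mul, norm_pow, Complex.norm_real,
        Real.norm_of_nonneg (h0 n), mul_pow]
      ring
    simp only [this]
    exact Real.summable_pow_div_factorial _
  refine ⟨hi, ?_⟩
  have h1 := hasSum_integral_measure hi
  have h2 : ∀ n : ℕ, ∫ x : ℝ, Complex.exp (z * x)
      ∂(ENNReal.ofReal (t ^ n / n.factorial) • HyperExp.convPow ν n)
      = (t * v) ^ n / n.factorial := by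
    intro n
    rw [((h.convPow n).smul (h0 n)).2, mul_pow]
    push_cast; ring
  simp only [h2] at h1
  refine h1.unique ?_
  rw [Complex.exp_eq_exp_ℂ]
  exact NormedSpace.expSeries_div_hasSum_exp (t * v)

theorem hasMGF_gaussianReal (m : ℝ) (s : ℝ≥0) (z : ℂ) :
    HasMGF (gaussianReal m s) z (Complex.exp (z * m + s * z ^ 2 / 2)) := by
  constructor
  · exact integrable_cexp_mul_of_re_mem_integrableExpSet (X := id) aemeasurable_id
      (integrable_exp_mul_gaussianReal z.re)
  · exact complexMGF_id_gaussianReal z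

theorem isFiniteMeasure_of_hasMGF_zero (h : HasMGF μ 0 v) : IsFiniteMeasure μ := by
  have := h.1
  simp only [zero_mul, Complex.exp_zero] at this
  exact (integrable_const_iff.1 this).resolve_left one_ne_zero

variable (p : Params)

/-- The domain of the exponential moments that are needed. -/
def Params.strip : Set ℂ := {z | 0 ≤ z.re ∧ ∀ i, z.re < p.ρ i}

/-- The transform `∫ e^{zx} ν(dx)` of the Lévy measure. -/
noncomputable def jumpMGF (z : ℂ) : ℂ :=
  ∑ i, (p.aNeg i * p.ρNeg i : ℂ) / (p.ρNeg i + z) + ∑ i, (p.aPos i * p.ρ i : ℂ) / (p.ρ i - z)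

variable {p}

theorem ρNeg_add_ne_zero (h : 0 ≤ z.re) (i : Fin p.Nhat) : (p.ρNeg i : ℂ) + z ≠ 0 := fun h0 => by
  have := congrArg Complex.re h0
  have h2 := p.ρNeg_pos i
  simp at this
  linarith

/-- Partial fractions such as `z a / (ρ - z) = aρ / (ρ - z) - a` restore the Lévy–Khintchine form:
the last bracket is `∫ (e^{zx} - 1) ν(dx)`. -/
theorem psi_eq (h : 0 ≤ z.re) (h' : ∀ i, (p.ρ i : ℂ) - z ≠ 0) :
    psi p z = (p.σ : ℂ) ^ 2 * z ^ 2 / 2 + p.a * z + (jumpMGF p z - jumpMGF p 0) := by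
  have h1 : ∀ i, z * ((p.aPos i : ℂ) / (p.ρ i - z))
      = (p.aPos i * p.ρ i : ℂ) / (p.ρ i - z) - (p.aPos i * p.ρ i : ℂ) / (p.ρ i - 0) := by
    intro i
    have h2 : (p.ρ i : ℂ) ≠ 0 := by exact_mod_cast (p.ρ_pos i).ne'
    have := h' i
    rw [sub_zero]
    field_simp
    ring
  have h3 : ∀ i, z * ((p.aNeg i : ℂ) / (p.ρNeg i + z))
      = (p.aNeg i * p.ρNeg i : ℂ) / (p.ρNeg i + 0) - (p.aNeg i * p.ρNeg i : ℂ) / (p.ρNeg i + z) := by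
    intro i
    have h2 : (p.ρNeg i : ℂ) ≠ 0 := by exact_mod_cast (p.ρNeg_pos i).ne'
    have := ρNeg_add_ne_zero h i
    rw [add_zero]
    field_simp
    ring
  rw [psi, jumpMGF, jumpMGF, Finset.mul_sum, Finset.mul_sum, Finset.sum_congr rfl fun i _ => h1 i,
    Finset.sum_congr rfl fun i _ => h3 i, Finset.sum_sub_distrib, Finset.sum_sub_distrib]
  ring

theorem levyDensity_nonneg (x : ℝ) : 0 ≤ levyDensity p x := by
  rw [levyDensity]
  split_ifs
  · exact Finset.sum_nonneg fun i _ => by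
      have := p.aNeg_pos i; have := p.ρNeg_pos i; positivity
  · exact Finset.sum_nonneg fun i _ => by
      have := p.aPos_pos i; have := p.ρ_pos i; positivity
  · exact le_rfl

theorem measurable_levyDensity : Measurable (levyDensity p) := by
  unfold levyDensity
  refine Measurable.ite measurableSet_Iio (by fun_prop)
    (Measurable.ite measurableSet_Ioi (by fun_prop) measurable_const)

theorem hasMGF_levyMeasure (hz : z ∈ p.strip) : HasMGF (levyMeasure p) z (jumpMGF p z) := by
  have hm : Measurable fun x => ENNReal.ofReal (levyDensity p x) :=
    measurable_levyDensity.ennreal_ofReal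
  have hfin : ∀ᵐ x : ℝ, ENNReal.ofReal (levyDensity p x) < ⊤ :=
    ae_of_all _ fun _ => ENNReal.ofReal_lt_top
  set φ : ℝ → ℂ := fun x =>
    (ENNReal.ofReal (levyDensity p x)).toReal • Complex.exp (z * x) with hφ
  have hneg : ∀ i, 0 < ((p.ρNeg i : ℂ) + z).re := fun i => by
    have := p.ρNeg_pos i; have := hz.1; simp; linarith
  have hpos : ∀ i, (z - (p.ρ i : ℂ)).re < 0 := fun i => by
    have := hz.2 i; simp; linarith
  have e1 : EqOn φ (fun x => ∑ i, (p.aNeg i * p.ρNeg i : ℂ) *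
      Complex.exp (((p.ρNeg i : ℂ) + z) * x)) (Iio 0) := by
    intro x hx
    have hx' : x < 0 := hx
    simp only [hφ, ENNReal.toReal_ofReal (levyDensity_nonneg x)]
    rw [levyDensity, if_pos hx', Complex.real_smul, Complex.ofReal_sum, Finset.sum_mul]
    refine Finset.sum_congr rfl fun i _ => ?_
    rw [add_mul, Complex.exp_add]
    push_cast; ring
  have e2 : EqOn φ (fun x => ∑ i, (p.aPos i * p.ρ i : ℂ) *
      Complex.exp ((z - (p.ρ i : ℂ)) * x)) (Ioi 0) := by
    intro x hx
    have hx' : 0 < x := hx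
    simp only [hφ, ENNReal.toReal_ofReal (levyDensity_nonneg x)]
    rw [levyDensity, if_neg hx'.not_gt, if_pos hx', Complex.real_smul, Complex.ofReal_sum,
      Finset.sum_mul]
    refine Finset.sum_congr rfl fun i _ => ?_
    rw [sub_mul, sub_eq_add_neg, Complex.exp_add]
    push_cast; ring
  have j1 : ∀ i, IntegrableOn (fun x : ℝ => (p.aNeg i * p.ρNeg i : ℂ) *
      Complex.exp (((p.ρNeg i : ℂ) + z) * x)) (Iic 0) := fun i =>
    (integrableOn_exp_mul_complex_Iic (hneg i) 0).const_mul _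
  have j2 : ∀ i, IntegrableOn (fun x : ℝ => (p.aPos i * p.ρ i : ℂ) *
      Complex.exp ((z - (p.ρ i : ℂ)) * x)) (Ioi 0) := fun i =>
    (integrableOn_exp_mul_complex_Ioi (hpos i) 0).const_mul _
  have i1 : IntegrableOn φ (Iic 0) := by
    rw [integrableOn_Iic_iff_integrableOn_Iio]
    refine IntegrableOn.congr_fun ?_ e1.symm measurableSet_Iio
    exact integrable_finsetSum _ fun i _ => (j1 i).mono_set Iio_subset_Iic_self
  have i2 : IntegrableOn φ (Ioi 0) := by
    refine IntegrableOn.congr_fun ?_ e2.symm measurableSet_Ioi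
    exact integrable_finsetSum _ fun i _ => j2 i
  have hint : Integrable φ := by
    rw [← integrableOn_univ, ← Iic_union_Ioi (a := (0 : ℝ))]
    exact i1.union i2
  refine ⟨(integrable_withDensity_iff_integrable_smul' hm hfin).2 hint, ?_⟩
  rw [levyMeasure, integral_withDensity_eq_integral_toReal_smul hm hfin]
  rw [← intervalIntegral.integral_Iic_add_Ioi i1 i2, integral_Iic_eq_integral_Iio,
    setIntegral_congr_fun measurableSet_Iio e1, setIntegral_congr_fun measurableSet_Ioi e2,
    ← integral_Iic_eq_integral_Iio, integral_finsetSum _ fun i _ => j1 i,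
    integral_finsetSum _ fun i _ => j2 i, jumpMGF]
  congr 1
  · refine Finset.sum_congr rfl fun i _ => ?_
    rw [integral_const_mul, integral_exp_mul_complex_Iic (hneg i)]
    simp [div_eq_mul_inv]
  · refine Finset.sum_congr rfl fun i _ => ?_
    rw [integral_const_mul, integral_exp_mul_complex_Ioi (hpos i),
      show (p.ρ i : ℂ) - z = -(z - p.ρ i) by ring, div_neg]
    simp [div_eq_mul_inv]

theorem zero_mem_strip : (0 : ℂ) ∈ p.strip := ⟨by simp, fun i => by simpa using p.ρ_pos i⟩

instance : IsFiniteMeasure (levyMeasure p) :=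
  isFiniteMeasure_of_hasMGF_zero (hasMGF_levyMeasure zero_mem_strip)

theorem ρ_sub_ne_zero_of_mem_strip (hz : z ∈ p.strip) (i : Fin p.N) : (p.ρ i : ℂ) - z ≠ 0 := by
  intro h0
  have := congrArg Complex.re h0
  have h2 := hz.2 i
  simp at this
  linarith

theorem I_mul_mem_strip (u : ℝ) : Complex.I * u ∈ p.strip :=
  ⟨by simp, fun i => by simpa using p.ρ_pos i⟩

theorem charExponent_eq_psi (u : ℝ) : charExponent p u = psi p (Complex.I * u) := by
  have h := hasMGF_levyMeasure (I_mul_mem_strip (p := p) u)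
  have h0 := hasMGF_levyMeasure (zero_mem_strip (p := p))
  rw [charExponent, integral_sub h.1 (by simp), h.2,
    psi_eq (by simp) (ρ_sub_ne_zero_of_mem_strip (I_mul_mem_strip u))]
  have h1 := h0.2
  simp only [zero_mul, Complex.exp_zero] at h1
  rw [h1, mul_pow, Complex.I_sq]
  ring

/-- The law at time `t` of a hyperexponential process. -/
noncomputable def marginal (p : Params) (t : ℝ≥0) : Measure ℝ :=
  gaussianReal (p.a * t) (Real.toNNReal (p.σ ^ 2) * t) ∗
    (ENNReal.ofReal (Real.exp (-(t * (jumpMGF p 0).re))) • expMeasure (levyMeasure p) t)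

theorem re_mem_strip (hz : z ∈ p.strip) : (z.re : ℂ) ∈ p.strip :=
  ⟨by simpa using hz.1, by simpa using hz.2⟩

theorem jumpMGF_zero_im : ((jumpMGF p 0).re : ℂ) = jumpMGF p 0 := by
  apply Complex.conj_eq_iff_re.1
  simp [jumpMGF]

theorem hasMGF_compound (t : ℝ≥0) (hz : z ∈ p.strip) :
    HasMGF (ENNReal.ofReal (Real.exp (-(t * (jumpMGF p 0).re))) • expMeasure (levyMeasure p) t) z
      (Complex.exp (t * (jumpMGF p z - jumpMGF p 0))) := by
  have := ((hasMGF_levyMeasure hz).expMeasure (hasMGF_levyMeasure (re_mem_strip hz))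
    t.coe_nonneg).smul (Real.exp_pos (-(t * (jumpMGF p 0).re))).le
  convert this using 1
  rw [Complex.ofReal_exp, ← Complex.exp_add]
  push_cast
  rw [jumpMGF_zero_im]
  ring_nf

instance isFiniteMeasure_compound (t : ℝ≥0) : IsFiniteMeasure
    (ENNReal.ofReal (Real.exp (-(t * (jumpMGF p 0).re))) • expMeasure (levyMeasure p) t) :=
  isFiniteMeasure_of_hasMGF_zero (hasMGF_compound t zero_mem_strip)

theorem hasMGF_marginal (t : ℝ≥0) (hz : z ∈ p.strip) :
    HasMGF (marginal p t) z (Complex.exp (t * psi p z)) := by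
  have := (hasMGF_gaussianReal (p.a * t) (Real.toNNReal (p.σ ^ 2) * t) z).conv
    (hasMGF_compound t hz)
  rw [marginal]
  convert this using 1
  rw [← Complex.exp_add, psi_eq hz.1 (ρ_sub_ne_zero_of_mem_strip hz)]
  have h : ((Real.toNNReal (p.σ ^ 2) : ℝ) : ℂ) = (p.σ : ℂ) ^ 2 := by
    rw [Real.coe_toNNReal _ (sq_nonneg _)]; push_cast; rfl
  congr 1
  push_cast
  rw [h]
  ring

instance isFiniteMeasure_marginal (t : ℝ≥0) : IsFiniteMeasure (marginal p t) :=
  isFiniteMeasure_of_hasMGF_zero (hasMGF_marginal t zero_mem_strip)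

/-- The hypothesis concerns only the imaginary axis. The characteristic function determines the law,
so the exponential moments of the explicit measure `marginal`, known on all of `p.strip` by
construction, pass to the law of `X t`. -/
theorem map_eq_marginal {Ω : Type*} [MeasurableSpace Ω] {P : Measure Ω} [IsProbabilityMeasure P]
    {X : ℝ≥0 → Ω → ℝ} (hX : IsHyperexponential X P p) (t : ℝ≥0) :
    P.map (X t) = marginal p t := by
  refine Measure.ext_of_charFun ?_
  funext u
  rw [hX.charFun_eq, charExponent_eq_psi, ← (hasMGF_marginal t (I_mul_mem_strip u)).2,
    charFun_apply_real]
  refine integral_congr_ae (ae_of_all _ fun x => ?_)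
  simp only
  ring_nf

/-! ### The price as a contour integral -/

/-- The transform `k^{-z} / (z (z - 1))` of the payoff. -/
noncomputable def payoffTransform (k : ℝ) (z : ℂ) : ℂ :=
  Complex.exp (-(Real.log k * z)) / (z * (z - 1))

theorem norm_inv_mul_sub_one_le (hz : 1 < z.re) :
    ‖(z * (z - 1))⁻¹‖ ≤ ((z.re - 1) ^ 2 + z.im ^ 2)⁻¹ := by
  have h0 : 0 < (z.re - 1) ^ 2 + z.im ^ 2 := by
    have : 0 < z.re - 1 := by linarith
    positivity
  rw [norm_inv]
  refine inv_anti₀ h0 ?_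
  have h1 : ‖z - 1‖ ^ 2 = (z.re - 1) ^ 2 + z.im ^ 2 := by
    rw [Complex.sq_norm, Complex.normSq_apply]; simp; ring
  have h2 : ‖z‖ ^ 2 = z.re ^ 2 + z.im ^ 2 := by
    rw [Complex.sq_norm, Complex.normSq_apply]; ring
  have h3 : ‖z - 1‖ ≤ ‖z‖ := by
    refine le_of_sq_le_sq ?_ (norm_nonneg _)
    nlinarith
  rw [norm_mul, ← h1, sq]
  gcongr

theorem norm_payoffTransform_le {k : ℝ} (hz : 1 < z.re) :
    ‖payoffTransform k z‖
      ≤ Real.exp (-(Real.log k * z.re)) * ((z.re - 1) ^ 2 + z.im ^ 2)⁻¹ := by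
  rw [payoffTransform, div_eq_mul_inv, norm_mul, Complex.norm_exp]
  gcongr
  · simp
  · exact norm_inv_mul_sub_one_le hz

theorem differentiableAt_payoffTransform {k : ℝ} (h0 : z ≠ 0) (h1 : z ≠ 1) :
    DifferentiableAt ℂ (payoffTransform k) z := by
  unfold payoffTransform
  exact DifferentiableAt.fun_div (by fun_prop) (by fun_prop) (mul_ne_zero h0 (sub_ne_zero.2 h1))

theorem continuous_payoffTransform_line {k c : ℝ} (hc : 1 < c) :
    Continuous fun y : ℝ => payoffTransform k (c + y * Complex.I) := by
  refine continuous_iff_continuousAt.2 fun y => ContinuousAt.comp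
    (f := fun y : ℝ => (c + y * Complex.I : ℂ))
    (differentiableAt_payoffTransform ?_ ?_).continuousAt (by fun_prop) <;>
  · intro h
    have := congrArg Complex.re h
    simp at this
    linarith

theorem norm_payoffTransform_line_le {k c : ℝ} (hc : 1 < c) :
    ∃ C, ∀ y : ℝ, ‖payoffTransform k (c + y * Complex.I)‖ ≤ C / (1 + y ^ 2) := by
  set m := min ((c - 1) ^ 2) 1
  have hm : 0 < m := lt_min (by have : 0 < c - 1 := by linarith
                                positivity) one_pos
  refine ⟨Real.exp (-(Real.log k * c)) / m, fun y => ?_⟩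
  refine (norm_payoffTransform_le (by simpa)).trans ?_
  have h1 : m ≤ (c - 1) ^ 2 := min_le_left _ _
  have h2 : m ≤ 1 := min_le_right _ _
  rw [div_div, div_eq_mul_inv]
  have e1 : (c + y * Complex.I : ℂ).re = c := by simp
  have e2 : (c + y * Complex.I : ℂ).im = y := by simp
  rw [e1, e2]
  gcongr
  nlinarith [sq_nonneg y]

theorem integrable_payoffTransform_line {k c : ℝ} (hc : 1 < c) :
    Integrable fun y : ℝ => payoffTransform k (c + y * Complex.I) := by
  obtain ⟨C, hC⟩ := norm_payoffTransform_line_le (k := k) hc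
  exact integrable_of_norm_le_inv_one_add_sq (continuous_payoffTransform_line hc) hC

/-- The Mellin transform of `t ↦ (1 - t)⁺`. -/
theorem hasMellin_max_one_sub {s : ℂ} (hs : 0 < s.re) :
    HasMellin (fun t : ℝ => ((max (1 - t) 0 : ℝ) : ℂ)) s (1 / (s * (s + 1))) := by
  have h1 := hasMellin_one_Ioc hs
  have h2 := hasMellin_cpow_Ioc 1 (s := s) (by simp; linarith)
  have h3 := hasMellin_sub h1.1 h2.1
  rw [h1.2, h2.2] at h3
  have he : EqOn (fun t : ℝ => (Ioc (0 : ℝ) 1).indicator (fun _ => (1 : ℂ)) t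
      - (Ioc (0 : ℝ) 1).indicator (fun t : ℝ => (t : ℂ) ^ (1 : ℂ)) t)
      (fun t : ℝ => ((max (1 - t) 0 : ℝ) : ℂ)) (Ioi 0) := by
    intro t ht
    have ht' : 0 < t := ht
    by_cases h : t ≤ 1
    · simp [indicator, ht', h]
    · simp [indicator, h, max_eq_right (show 1 - t ≤ 0 by linarith)]
  have hs0 : s ≠ 0 := fun h => by simp [h] at hs
  have hs1 : s + 1 ≠ 0 := fun h => by
    have := congrArg Complex.re h
    simp at this; linarith
  constructor
  · refine h3.1.congr_fun (fun t ht => ?_) measurableSet_Ioi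
    have := he ht
    simp only at this ⊢
    rw [this]
  · rw [show 1 / (s * (s + 1)) = 1 / s - 1 / (s + 1) by field_simp; ring, ← h3.2]
    refine setIntegral_congr_fun measurableSet_Ioi fun t ht => ?_
    have := he ht
    simp only at this ⊢
    rw [this]

/-- Since `(e^w - k)⁺ = e^w (1 - k e^{-w})⁺`, this is Mellin inversion of `(1 - t)⁺` at `t = k
e^{-w}` on `Re s = c - 1`; with `z = s + 1`, the transform `1 / (s (s + 1))` becomes `1 / (z (z -
1))`. -/
theorem payoff_eq_integral {k c : ℝ} (hk : 0 < k) (hc : 1 < c) (w : ℝ) :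
    ((max (Real.exp w - k) 0 : ℝ) : ℂ) = k / (2 * Real.pi) *
      ∫ y : ℝ, Complex.exp ((c + y * Complex.I) * w) * payoffTransform k (c + y * Complex.I) := by
  set x := k * Real.exp (-w) with hx
  have hx0 : 0 < x := by positivity
  have hs : ∀ y : ℝ, 0 < (((c - 1 : ℝ) : ℂ) + y * Complex.I).re := fun y => by simpa using hc
  have hm : ∀ y : ℝ, mellin (fun t : ℝ => ((max (1 - t) 0 : ℝ) : ℂ)) (((c - 1 : ℝ) : ℂ) + y * Complex.I)
      = ((c + y * Complex.I : ℂ) * (c + y * Complex.I - 1))⁻¹ := by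
    intro y
    rw [(hasMellin_max_one_sub (hs y)).2, one_div]
    congr 1
    push_cast; ring
  have hv : Complex.VerticalIntegrable
      (mellin (fun t : ℝ => ((max (1 - t) 0 : ℝ) : ℂ))) (c - 1) := by
    -- For `k = 1` the exponential factor of the payoff transform disappears and exactly the Mellin
    -- transform is left.
    have := integrable_payoffTransform_line (k := 1) hc
    simp only [payoffTransform, Real.log_one, Complex.ofReal_zero, zero_mul, neg_zero,
      Complex.exp_zero, one_div] at this
    simpa only [Complex.VerticalIntegrable, hm] using this
  have h := mellinInv_mellin_eq (c - 1) (fun t : ℝ => ((max (1 - t) 0 : ℝ) : ℂ)) hx0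
    (by simpa using (hasMellin_max_one_sub (hs 0)).1) hv
    (Continuous.continuousAt (by fun_prop))
  have h1 : max (Real.exp w - k) 0 = Real.exp w * max (1 - x) 0 := by
    rw [mul_max_of_nonneg _ _ (Real.exp_pos w).le, mul_zero, mul_sub, mul_one, hx,
      mul_left_comm, ← Real.exp_add]
    simp
  rw [h1, Complex.ofReal_mul, ← h, mellinInv]
  simp only [hm]
  rw [Complex.real_smul, ← mul_assoc, ← integral_const_mul, ← integral_const_mul]
  refine integral_congr_ae (ae_of_all _ fun y => ?_)
  simp only [payoffTransform, smul_eq_mul]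
  have hxp : (x : ℂ) ^ (-(((c - 1 : ℝ) : ℂ) + y * Complex.I))
      = Complex.exp (-(((c - 1 : ℝ) : ℂ) + y * Complex.I) * (Real.log k - w)) := by
    rw [Complex.cpow_def_of_ne_zero (by exact_mod_cast hx0.ne'), ← Complex.ofReal_log hx0.le, hx,
      Real.log_mul hk.ne' (Real.exp_pos _).ne', Real.log_exp]
    congr 1
    push_cast; ring
  have hk' : (k : ℂ) = Complex.exp (Real.log k) := by
    rw [← Complex.ofReal_exp, Real.exp_log hk]
  rw [hxp, div_eq_mul_inv (Complex.exp (-_))]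
  have : ((Real.exp w : ℝ) : ℂ) * Complex.exp (-(((c - 1 : ℝ) : ℂ) + y * Complex.I) * (Real.log k - w))
      = k * (Complex.exp ((c + y * Complex.I) * w)
        * Complex.exp (-(Real.log k * (c + y * Complex.I)))) := by
    rw [Complex.ofReal_exp]
    nth_rewrite 1 [hk']
    rw [← Complex.exp_add, ← Complex.exp_add, ← Complex.exp_add]
    congr 1
    push_cast; ring
  push_cast at this ⊢
  linear_combination (1 / (2 * (Real.pi : ℂ)) *
    ((c + y * Complex.I : ℂ) * (c + y * Complex.I - 1))⁻¹) * this

/-- The integrand of the price. -/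
noncomputable def priceKernel (p : Params) (k T : ℝ) (z : ℂ) : ℂ :=
  Complex.exp (T * psi p z) * payoffTransform k z

/-- Fubini's theorem: on the line, `|e^{zw}| = e^{cw}` has finite expectation and the payoff
transform is `O(|y|⁻²)`. Both `1` and `c` are admissible exponents because they lie below every
`ρ_ℓ`. -/
theorem integral_payoff_eq {k c : ℝ} (hk : 0 < k) (hc : 1 < c) (hcρ : ∀ i, c < p.ρ i) (t : ℝ≥0) :
    Integrable (fun w => max (Real.exp w - k) 0) (marginal p t) ∧
    ((∫ w, max (Real.exp w - k) 0 ∂(marginal p t) : ℝ) : ℂ) = k / (2 * Real.pi) *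
      ∫ y : ℝ, priceKernel p k t (c + y * Complex.I) := by
  have hmem : ∀ y : ℝ, (c + y * Complex.I : ℂ) ∈ p.strip := fun y =>
    ⟨by simp; linarith, fun i => by simpa using hcρ i⟩
  have hmem1 : (1 : ℂ) ∈ p.strip := ⟨by simp, fun i => by simpa using hc.trans (hcρ i)⟩
  have hint1 : Integrable (fun w => Real.exp w) (marginal p t) := by
    have := (hasMGF_marginal t hmem1).1.re
    refine this.congr (ae_of_all _ fun w => ?_)
    simp [Complex.exp_ofReal_re]
  constructor
  · refine hint1.mono' (Continuous.aestronglyMeasurable (by fun_prop)) (ae_of_all _ fun w => ?_)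
    have := Real.exp_pos w
    rw [Real.norm_of_nonneg (le_max_right _ _)]
    exact max_le (by linarith) this.le
  · rw [← integral_complex_ofReal]
    simp only [payoff_eq_integral hk hc]
    rw [integral_const_mul]
    congr 1
    rw [integral_integral_swap]
    · refine integral_congr_ae (ae_of_all _ fun y => ?_)
      simp only [priceKernel]
      rw [integral_mul_const, (hasMGF_marginal t (hmem y)).2]
    · have hg := (hasMGF_marginal t (re_mem_strip (hmem 0))).1.norm.mul_prod
        (integrable_payoffTransform_line (k := k) hc).norm
      refine hg.mono' ?_ (ae_of_all _ fun q => ?_)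
      · refine Continuous.aestronglyMeasurable (Continuous.mul (by fun_prop) ?_)
        exact (continuous_payoffTransform_line hc).comp continuous_snd
      · simp [Function.uncurry, Complex.norm_exp]

end HyperExp

namespace HyperExp

/-! ### The expansion at the poles `ρ ℓ` and the coefficients `bₙ` -/

theorem rep_geom {d : ℝ} (hd : d ≠ 0) :
    Rep (PowerSeries.mk fun n => 1 / d ^ (n + 1)) (fun v => (d - v : ℂ)⁻¹) := by
  have h := ((Rep.const d).sub Rep.id).inv (by simpa)
  convert h using 1
  rw [PowerSeries.eq_inv_iff_mul_eq_one (by simpa)]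
  ext n
  rw [mul_sub, map_sub, PowerSeries.coeff_mul_C]
  rcases n with _ | n
  · simp [hd]
  · rw [PowerSeries.coeff_succ_mul_X, PowerSeries.coeff_mk, PowerSeries.coeff_mk,
      PowerSeries.coeff_one, if_neg (Nat.succ_ne_zero n)]
    field_simp
    ring

theorem Rep.finset_sum {ι : Type*} (s : Finset ι) {f : ι → PowerSeries ℝ} {F : ι → ℂ → ℂ}
    (h : ∀ i ∈ s, Rep (f i) (F i)) : Rep (∑ i ∈ s, f i) (fun z => ∑ i ∈ s, F i z) :=
  ⟨Finset.analyticAt_fun_sum s fun i hi => (h i hi).1, by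
    rw [tay_finset_sum s F fun i hi => (h i hi).1, map_sum]
    exact Finset.sum_congr rfl fun i hi => (h i hi).2⟩

variable (p : Params)

/-- `v ψ(ρ_ℓ + v)`, continued to `v = 0`. -/
noncomputable def kappaPole (l : Fin p.N) (v : ℂ) : ℂ :=
  v * ((p.σ : ℂ) ^ 2 * (p.ρ l + v) ^ 2 / 2 + p.a * (p.ρ l + v)
    + (p.ρ l + v) * ∑ i ∈ Finset.univ.erase l, (p.aPos i : ℂ) / (p.ρ i - (p.ρ l + v))
    - (p.ρ l + v) * ∑ i, (p.aNeg i : ℂ) / (p.ρNeg i + (p.ρ l + v))) - p.aPos l * (p.ρ l + v)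

variable {p}

theorem kappaPole_eq (l : Fin p.N) {v : ℂ} (hv : v ≠ 0) :
    kappaPole p l v = v * psi p (p.ρ l + v) := by
  rw [kappaPole, psi, ← Finset.add_sum_erase _ _ (Finset.mem_univ l)]
  have : (p.ρ l : ℂ) - (p.ρ l + v) = -v := by ring
  rw [this]
  field_simp
  ring

theorem differentiableAt_kappaPole (l : Fin p.N) {v : ℂ} (h0 : 0 ≤ (p.ρ l + v).re)
    (h : ∀ i, i ≠ l → (p.ρ i : ℂ) - (p.ρ l + v) ≠ 0) : DifferentiableAt ℂ (kappaPole p l) v := by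
  unfold kappaPole
  have h1 : DifferentiableAt ℂ (fun v : ℂ =>
      ∑ i ∈ Finset.univ.erase l, (p.aPos i : ℂ) / (p.ρ i - (p.ρ l + v))) v :=
    DifferentiableAt.fun_sum fun i hi =>
      DifferentiableAt.fun_div (by fun_prop) (by fun_prop) (h i (Finset.ne_of_mem_erase hi))
  have h2 : DifferentiableAt ℂ (fun v : ℂ =>
      ∑ i, (p.aNeg i : ℂ) / (p.ρNeg i + (p.ρ l + v))) v :=
    DifferentiableAt.fun_sum fun i _ =>
      DifferentiableAt.fun_div (by fun_prop) (by fun_prop) (ρNeg_add_ne_zero h0 i)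
  fun_prop

theorem kappaPole_zero (l : Fin p.N) : kappaPole p l 0 = -(p.aPos l * p.ρ l : ℝ) := by
  simp [kappaPole]

/-- Each jump term of `ψ` other than the singular one is a geometric series in `v` minus a constant,
by `z a / (ρ - z) = aρ / (ρ - z) - a`. The constants enter only `ω₀`, which explains its special
form; the singular term contributes `-a_ℓ (ρ_ℓ + v)` after multiplication by `v`. -/
theorem rep_zgSeries (l : Fin p.N) : Rep (zgSeries p l) (kappaPole p l) := by
  have hd : ∀ i ∈ Finset.univ.erase l, p.ρ i - p.ρ l ≠ 0 := fun i hi h =>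
    Finset.ne_of_mem_erase hi (p.ρ_strictMono.injective (sub_eq_zero.1 h))
  have he : ∀ i, p.ρNeg i + p.ρ l ≠ 0 := fun i => (add_pos (p.ρNeg_pos i) (p.ρ_pos l)).ne'
  have r1 := Rep.finset_sum (Finset.univ.erase l) fun i hi =>
    ((Rep.const (p.aPos i * p.ρ i)).mul (rep_geom (hd i hi))).sub (Rep.const (p.aPos i))
  have r2 := Rep.finset_sum (Finset.univ : Finset (Fin p.Nhat)) fun i _ =>
    ((Rep.const (-(p.aNeg i * p.ρNeg i))).mul (rep_geom (neg_ne_zero.2 (he i)))).sub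
      (Rep.const (p.aNeg i))
  have r3 := (Rep.id.mul ((((((Rep.const (p.σ ^ 2 * p.ρ l ^ 2 / 2 + p.a * p.ρ l)).add
    ((Rep.const (p.σ ^ 2 * p.ρ l + p.a)).mul Rep.id)).add
    ((Rep.const (p.σ ^ 2 / 2)).mul (Rep.id.pow 2))).add r1).add r2))).sub
    (((Rep.const (p.aPos l * p.ρ l)).add ((Rep.const (p.aPos l)).mul Rep.id)))
  have hev : ∀ᶠ v in 𝓝 (0 : ℂ), (∀ i ∈ Finset.univ.erase l, (p.ρ i : ℂ) - (p.ρ l + v) ≠ 0) ∧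
      ∀ i, (p.ρNeg i : ℂ) + (p.ρ l + v) ≠ 0 := by
    refine Eventually.and ?_ ?_
    · rw [Filter.eventually_all_finset]
      intro i hi
      refine ContinuousAt.eventually_ne (by fun_prop) ?_
      have := hd i hi
      rw [add_zero, ← Complex.ofReal_sub]; exact_mod_cast this
    · rw [Filter.eventually_all]
      intro i
      refine ContinuousAt.eventually_ne (by fun_prop) ?_
      rw [add_zero, ← Complex.ofReal_add]; exact_mod_cast he i
  have r4 : Rep _ (kappaPole p l) := r3.congr (by
    filter_upwards [hev] with v hv
    rw [kappaPole]
    have e1 : (p.ρ l + v) * ∑ i ∈ Finset.univ.erase l, (p.aPos i : ℂ) / (p.ρ i - (p.ρ l + v))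
        = ∑ i ∈ Finset.univ.erase l, (((p.aPos i * p.ρ i : ℝ) : ℂ)
          * (((p.ρ i - p.ρ l : ℝ) : ℂ) - v)⁻¹ - p.aPos i) := by
      rw [Finset.mul_sum]
      refine Finset.sum_congr rfl fun i hi => ?_
      have h1 := hv.1 i hi
      have h2 : ((p.ρ i - p.ρ l : ℝ) : ℂ) - v ≠ 0 := by
        push_cast; rwa [sub_sub]
      rw [div_eq_mul_inv, show (p.ρ i : ℂ) - (p.ρ l + v) = ((p.ρ i - p.ρ l : ℝ) : ℂ) - v by
        push_cast; ring]
      field_simp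
      push_cast; ring
    have e2 : -((p.ρ l + v) * ∑ i, (p.aNeg i : ℂ) / (p.ρNeg i + (p.ρ l + v)))
        = ∑ i, (((-(p.aNeg i * p.ρNeg i) : ℝ) : ℂ)
          * (((-(p.ρNeg i + p.ρ l) : ℝ) : ℂ) - v)⁻¹ - p.aNeg i) := by
      rw [Finset.mul_sum, ← Finset.sum_neg_distrib]
      refine Finset.sum_congr rfl fun i _ => ?_
      have h1 := hv.2 i
      rw [show ((-(p.ρNeg i + p.ρ l) : ℝ) : ℂ) - v = -((p.ρNeg i : ℂ) + (p.ρ l + v)) by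
        push_cast; ring]
      field_simp
      push_cast; ring
    rw [sub_eq_add_neg (_ + _ + _), e1, e2]
    push_cast
    ring)
  convert r4 using 1
  have s1 : ∀ n, (∑ i ∈ Finset.univ.erase l, (p.aPos i * p.ρ i * (1 / (p.ρ i - p.ρ l) ^ (n + 2))))
      + ∑ i, (-(p.aNeg i * p.ρNeg i) * (1 / (-(p.ρNeg i + p.ρ l)) ^ (n + 2)))
      = omega p l (n + 1) := by
    intro n
    rw [omega, if_neg (Nat.succ_ne_zero n), Finset.mul_sum]
    congr 1
    · exact Finset.sum_congr rfl fun i _ => by ring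
    · refine Finset.sum_congr rfl fun i _ => ?_
      rw [neg_pow (p.ρNeg i + p.ρ l)]
      rcases neg_one_pow_eq_or ℝ n with h | h <;>
        rw [pow_succ (-1 : ℝ) (n + 1), pow_succ (-1 : ℝ) n, h] <;> norm_num <;> ring
  have s0 : (∑ i ∈ Finset.univ.erase l,
        (p.aPos i * p.ρ i * (1 / (p.ρ i - p.ρ l)) - p.aPos i))
      + ∑ i, (-(p.aNeg i * p.ρNeg i) * (1 / (-(p.ρNeg i + p.ρ l))) - p.aNeg i) - p.aPos l
      = omega p l 0 := by
    rw [omega, if_pos rfl]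
    congr 1
    rw [sub_eq_add_neg, ← Finset.sum_neg_distrib]
    congr 1
    · refine Finset.sum_congr rfl fun i hi => ?_
      have := hd i hi
      field_simp; ring
    · refine Finset.sum_congr rfl fun i _ => ?_
      have := he i
      field_simp; ring
  ext n
  rw [map_sub]
  rcases n with _ | _ | _ | _ | n
  · simp [zgSeries]
  all_goals
    simp only [zgSeries, PowerSeries.coeff_mk, PowerSeries.coeff_succ_X_mul, LinearMap.map_add, LinearMap.map_sub,
      map_sum, PowerSeries.coeff_C_mul, PowerSeries.coeff_X_pow, PowerSeries.coeff_X,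
      PowerSeries.coeff_C]
  · rw [← s0]; simp; ring
  · rw [← s1]; simp; ring
  · rw [← s1]; simp; ring
  · rw [← s1]; simp

end HyperExp

namespace HyperExp

variable {p : Params} {k : ℝ}

/-- For `w = 1/q` one has `d/dq = -w² d/dw`. -/
theorem zetaDeriv_eq (l : Fin p.N) :
    zetaDeriv p l = -(PowerSeries.X ^ 2 * PowerSeries.derivative ℝ (zeta p l)) := by
  ext n
  rw [map_neg, zetaDeriv, PowerSeries.coeff_mk]
  rcases n with _ | _ | n
  · simp
  · rw [PowerSeries.coeff_X_pow_mul']; simp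
  · rw [show n + 1 + 1 = n + 2 from rfl, PowerSeries.coeff_X_pow_mul,
      PowerSeries.coeff_derivative, if_neg (by omega)]
    push_cast
    ring

theorem analyticAt_payoffTransform {z : ℂ} (h0 : z ≠ 0) (h1 : z ≠ 1) :
    AnalyticAt ℂ (payoffTransform k) z := by
  unfold payoffTransform
  exact AnalyticAt.div (by fun_prop) (by fun_prop) (mul_ne_zero h0 (sub_ne_zero.2 h1))

/-- Lagrange's formula for `H v = payoffTransform k (ρ_ℓ + v)`: with `ζ_ℓ = ρ_ℓ + h`, the product of
the first three factors of `mSeries` is `H ∘ h`, and the factor `-w²` in `dζ_ℓ/dq` causes the sign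
and the shift by two. -/
theorem coeff_mSeries (hk : 0 < k) (l : Fin p.N) (hl : 1 < p.ρ l) (m : ℕ) :
    ((PowerSeries.coeff (m + 2) (mSeries p k l) : ℝ) : ℂ) = -PowerSeries.coeff m
      (tay fun v => payoffTransform k (p.ρ l + v) * kappaPole p l v ^ (m + 1)) := by
  have hκ := rep_zgSeries l
  have hρ0 : (p.ρ l : ℂ) ≠ 0 := by exact_mod_cast (p.ρ_pos l).ne'
  have hρ1 : (p.ρ l : ℂ) ≠ 1 := by exact_mod_cast hl.ne'
  have hκ0 : kappaPole p l 0 ≠ 0 := by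
    rw [kappaPole_zero]
    exact_mod_cast (neg_ne_zero.2 (mul_pos (p.aPos_pos l) (p.ρ_pos l)).ne')
  obtain ⟨h, hh, hh0, hinv, -⟩ := exists_analytic_inverse hκ.1 hκ0
  have rh := Rep.lagrangeInv hκ hκ0 hh hh0 hinv
  have rζ : Rep (zeta p l) (fun s => p.ρ l + h s) := (Rep.const _).add rh
  have hc : PowerSeries.constantCoeff (zeta p l) = p.ρ l := by
    simp [zeta, lagrangeInv]
  have r := (((rζ.inv (by rw [hc]; exact (p.ρ_pos l).ne')).mul
    ((rζ.sub (Rep.const 1)).inv (by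
      rw [map_sub, hc]; simpa using (sub_pos.2 hl).ne'))).mul (rζ.neg.constPow hk)).mul
    rζ.derivative
  have hH : AnalyticAt ℂ (fun v => payoffTransform k (p.ρ l + v)) 0 :=
    AnalyticAt.fun_comp (f := fun v : ℂ => (p.ρ l : ℂ) + v)
      (by simpa using analyticAt_payoffTransform hρ0 hρ1) (by fun_prop)
  rw [← coeff_tay_comp_mul_deriv hκ.1 hκ0 hh hh0 hinv hH m, mSeries, zetaDeriv_eq,
    mul_neg, map_neg, mul_left_comm, PowerSeries.coeff_X_pow_mul]
  rw [map_one] at r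
  rw [Complex.ofReal_neg, ← r.coeff]
  congr 3
  funext s
  rw [payoffTransform, deriv_const_add]
  push_cast
  rw [mul_neg, div_eq_mul_inv, mul_inv]
  ring

theorem differentiableAt_psi {z : ℂ} (h0 : 0 ≤ z.re) (h : ∀ i, (p.ρ i : ℂ) - z ≠ 0) :
    DifferentiableAt ℂ (psi p) z := by
  unfold psi
  have h1 : DifferentiableAt ℂ (fun z : ℂ => ∑ i, (p.aPos i : ℂ) / (p.ρ i - z)) z :=
    DifferentiableAt.fun_sum fun i _ =>
      DifferentiableAt.fun_div (by fun_prop) (by fun_prop) (h i)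
  have h2 : DifferentiableAt ℂ (fun z : ℂ => ∑ i, (p.aNeg i : ℂ) / (p.ρNeg i + z)) z :=
    DifferentiableAt.fun_sum fun i _ =>
      DifferentiableAt.fun_div (by fun_prop) (by fun_prop) (ρNeg_add_ne_zero h0 i)
  fun_prop

/-- Off the pole, `ψ^{m+1}` is `κ(z - ρ_ℓ)^{m+1} / (z - ρ_ℓ)^{m+1}` with a regular numerator, so the
residue is the Taylor coefficient evaluated in `coeff_mSeries`. -/
theorem rectInt_psi_pow_of_single_pole (hk : 0 < k) {a b Y : ℝ} (ha : 1 < a) (hY : 0 < Y)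
    (l : Fin p.N) (hal : a < p.ρ l) (hlb : p.ρ l < b)
    (hs : ∀ i, i ≠ l → p.ρ i < a ∨ b < p.ρ i) (m : ℕ) :
    rectInt (fun z => psi p z ^ (m + 1) * payoffTransform k z) a b Y
      = -(2 * Real.pi * Complex.I) * ((PowerSeries.coeff (m + 2) (mSeries p k l) : ℝ) : ℂ) := by
  rw [coeff_mSeries hk l (ha.trans hal), neg_mul_neg]
  have hne : ∀ i, i ≠ l → ∀ z : ℂ, a ≤ z.re → z.re ≤ b → (p.ρ i : ℂ) - z ≠ 0 := by
    intro i hi z hza hzb h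
    have : z.re = p.ρ i := by rw [← sub_eq_zero.1 h]; simp
    rcases hs i hi with h | h <;> linarith
  set H : ℂ → ℂ := fun z => payoffTransform k z * kappaPole p l (z - p.ρ l) ^ (m + 1) with hHd
  have hH : ∀ z : ℂ, a ≤ z.re → z.re ≤ b → DifferentiableAt ℂ H z := by
    intro z hza hzb
    have h0 : z ≠ 0 := by rintro rfl; simp at hza; linarith
    have h1 : z ≠ 1 := by rintro rfl; simp at hza; linarith
    refine (differentiableAt_payoffTransform h0 h1).fun_mul (DifferentiableAt.fun_pow ?_ _)
    refine DifferentiableAt.comp (f := fun z : ℂ => z - (p.ρ l : ℂ)) z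
      (g := kappaPole p l) (differentiableAt_kappaPole l ?_ ?_) (by fun_prop)
    · simpa using (by linarith : 0 ≤ z.re)
    · intro i hi; rw [add_sub_cancel]; exact hne i hi z hza hzb
  have hHρ : AnalyticAt ℂ H (p.ρ l) := by
    have h0 : (p.ρ l : ℂ) ≠ 0 := by exact_mod_cast (p.ρ_pos l).ne'
    have h1 : (p.ρ l : ℂ) ≠ 1 := by exact_mod_cast (ha.trans hal).ne'
    refine (analyticAt_payoffTransform h0 h1).fun_mul (AnalyticAt.fun_pow ?_ _)
    exact AnalyticAt.fun_comp (f := fun z : ℂ => z - (p.ρ l : ℂ))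
      (by simpa using (rep_zgSeries l).1) (by fun_prop)
  have := rectInt_pole hal hlb hY hH hHρ m
  simp only [hHd, add_sub_cancel_left] at this
  rw [← this]
  refine rectInt_congr (hal.trans hlb).le hY.le fun z hz => ?_
  have hzρ := sub_ne_zero_of_mem_rectBdry hal hlb hY hz
  rw [kappaPole_eq l hzρ, add_sub_cancel, mul_pow]
  field_simp

theorem psi_continuousAt_of_im_ne_zero {z : ℂ} (hz : z.im ≠ 0) :
    ContinuousAt (psi p) z := by
  have h1 : ∀ i, (p.ρ i : ℂ) - z ≠ 0 := fun i h => hz (by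
    rw [← sub_eq_zero.1 h]; simp)
  have h2 : ∀ i, (p.ρNeg i : ℂ) + z ≠ 0 := fun i h => hz (by
    rw [eq_neg_of_add_eq_zero_right h]; simp)
  unfold psi
  have h1 : ContinuousAt (fun z : ℂ => ∑ i, (p.aPos i : ℂ) / (p.ρ i - z)) z :=
    tendsto_finsetSum _ fun i _ => ContinuousAt.div (by fun_prop) (by fun_prop) (h1 i)
  have h2 : ContinuousAt (fun z : ℂ => ∑ i, (p.aNeg i : ℂ) / (p.ρNeg i + z)) z :=
    tendsto_finsetSum _ fun i _ => ContinuousAt.div (by fun_prop) (by fun_prop) (h2 i)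
  fun_prop

theorem rectInt_psi_pow (hk : 0 < k) {c R Y : ℝ} (hc : 1 < c) (hcR : c < R) (hY : 0 < Y)
    (hρc : ∀ i, c < p.ρ i) (hρR : ∀ i, p.ρ i < R) (m : ℕ) :
    rectInt (fun z => psi p z ^ (m + 1) * payoffTransform k z) c R Y
      = -(2 * Real.pi * Complex.I) * (bCoeff p k (m + 2) : ℂ) := by
  rcases Nat.eq_zero_or_pos p.N with hN | hN
  · have he : IsEmpty (Fin p.N) := by rw [hN]; infer_instance
    rw [rectInt_eq_zero hcR.le]
    · simp [bCoeff]
    · intro z hz _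
      have h0 : z ≠ 0 := by rintro rfl; simp at hz; linarith
      have h1 : z ≠ 1 := by rintro rfl; simp at hz; linarith
      exact ((differentiableAt_psi (by linarith) fun i => he.elim i).fun_pow _).fun_mul
        (differentiableAt_payoffTransform h0 h1)
  -- The rectangle is cut at the midpoints between consecutive `ρ_ℓ`, with `d 0 = c` and `d N = R`,
  -- so that each piece contains one pole. For `N = 0` this would give `d N = c`, which is why that
  -- case is separate.
  · set d : ℕ → ℝ := fun j => if j = 0 then c else
      if h : j < p.N then (p.ρ ⟨j - 1, by omega⟩ + p.ρ ⟨j, h⟩) / 2 else R with hd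
    have hlow : ∀ l : Fin p.N, 1 < d l ∧ d l < p.ρ l ∧ ∀ i, i < l → p.ρ i < d l := by
      intro l
      rcases Nat.eq_zero_or_pos (l : ℕ) with h | h
      · simp only [hd, h, if_true]
        exact ⟨hc, hρc l, fun i hi => absurd (Fin.lt_def.1 hi) (by omega)⟩
      · simp only [hd, h.ne', if_false, l.2, dif_pos]
        have h1 : p.ρ ⟨l - 1, by omega⟩ < p.ρ l :=
          p.ρ_strictMono (Fin.lt_def.2 (by simp; omega))
        have h2 := hρc ⟨l - 1, by omega⟩
        refine ⟨by linarith, by linarith, fun i hi => ?_⟩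
        have h3 : p.ρ i ≤ p.ρ ⟨l - 1, by omega⟩ :=
          p.ρ_strictMono.monotone (Fin.le_def.2 (by have := Fin.lt_def.1 hi; simp; omega))
        linarith
    have hup : ∀ l : Fin p.N, p.ρ l < d (l + 1) ∧ ∀ i, l < i → d (l + 1) < p.ρ i := by
      intro l
      by_cases h : (l : ℕ) + 1 < p.N
      · have h1 := hlow ⟨l + 1, h⟩
        refine ⟨h1.2.2 l (Fin.lt_def.2 (by simp)), fun i hi => h1.2.1.trans_le ?_⟩
        exact p.ρ_strictMono.monotone (Fin.le_def.2 (by have := Fin.lt_def.1 hi; simp; omega))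
      · simp only [hd, Nat.succ_ne_zero, if_false, h, dif_neg, not_false_iff]
        exact ⟨hρR l, fun i hi => absurd (Fin.lt_def.1 hi) (by omega)⟩
    have h0 : d 0 = c := by simp [hd]
    have hN' : d p.N = R := by simp [hd, hN.ne']
    rw [← h0, ← hN', ← sum_rectInt_adjacent hY _ d p.N, Finset.sum_range, bCoeff,
      Complex.ofReal_sum, Finset.mul_sum]
    · refine Finset.sum_congr rfl fun l _ => ?_
      refine rectInt_psi_pow_of_single_pole hk (hlow l).1 hY l (hlow l).2.1 (hup l).1 ?_ m
      intro i hi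
      rcases lt_or_gt_of_ne hi with h | h
      · exact Or.inl ((hlow l).2.2 i h)
      · exact Or.inr ((hup l).2 i h)
    · intro z hz
      have h0 : z ≠ 0 := by rintro rfl; simp at hz
      have h1 : z ≠ 1 := by rintro rfl; simp at hz
      exact ((psi_continuousAt_of_im_ne_zero hz).pow _).mul
        (differentiableAt_payoffTransform h0 h1).continuousAt

/-- The integrals of `e^{zψ} g` around rectangles that enclose all poles of `ψ` on the right,
expanded in powers of `z`. -/
theorem hasSum_bTerm (hk : 0 < k) {c R Y : ℝ} (hc : 1 < c) (hcR : c < R) (hY : 0 < Y)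
    (hρc : ∀ i, c < p.ρ i) (hρR : ∀ i, p.ρ i < R) (T : ℂ) :
    HasSum (fun n => -(2 * Real.pi * Complex.I) * bTerm p k (n + 1) T)
      (rectInt (fun z => Complex.exp (T * psi p z) * payoffTransform k z) c R Y) := by
  have hρ : ∀ z ∈ rectBdry c R Y, ∀ i, (p.ρ i : ℂ) - z ≠ 0 := fun z hz i h =>
    sub_ne_zero_of_mem_rectBdry (hρc i) (hρR i) hY hz (by rw [← neg_sub, h, neg_zero])
  have hre : ∀ z ∈ rectBdry c R Y, c ≤ z.re := fun z hz => hz.1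
  have hpsi : ContinuousOn (psi p) (rectBdry c R Y) := fun z hz =>
    (differentiableAt_psi (by linarith [hre z hz]) (hρ z hz)).continuousAt.continuousWithinAt
  have hg0 : ∀ z : ℂ, c ≤ z.re → DifferentiableAt ℂ (payoffTransform k) z := fun z hz =>
    differentiableAt_payoffTransform (by rintro rfl; simp at hz; linarith)
      (by rintro rfl; simp at hz; linarith)
  have hg : ContinuousOn (payoffTransform k) (rectBdry c R Y) := fun z hz =>
    (hg0 z (hre z hz)).continuousAt.continuousWithinAt
  -- The boundary is compact and avoids the poles, so `ψ` is bounded there and the exponential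
  -- series may be integrated termwise.
  obtain ⟨A, hA⟩ := (isCompact_rectBdry c R Y).exists_bound_of_continuousOn hpsi
  obtain ⟨B, hB⟩ := (isCompact_rectBdry c R Y).exists_bound_of_continuousOn hg
  set F : ℕ → ℂ → ℂ := fun n z => T ^ n / n.factorial * (psi p z ^ n * payoffTransform k z)
  have hsum : HasSum (fun n => rectInt (F n) c R Y)
      (rectInt (fun z => Complex.exp (T * psi p z) * payoffTransform k z) c R Y) := by
    refine rectInt_hasSum hcR.le hY.le (u := fun n => (‖T‖ * A) ^ n / n.factorial * B)
      ((Real.summable_pow_div_factorial _).mul_right B) (fun n => ?_) (fun n z hz => ?_)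
      (fun z hz => ?_)
    · exact (hpsi.pow n).mul hg |>.const_mul _
    · have h1 := hA z hz
      have h2 := hB z hz
      simp only [F, norm_mul, norm_div, norm_pow, Complex.norm_natCast, mul_pow]
      rw [mul_div_right_comm, ← mul_assoc]
      have h4 := (norm_nonneg _).trans h1
      gcongr
    · have h1 := (NormedSpace.expSeries_div_hasSum_exp (T * psi p z)).mul_right
        (payoffTransform k z)
      rw [← Complex.exp_eq_exp_ℂ] at h1
      refine h1.congr_fun fun n => ?_
      simp only [F, mul_pow]; ring
  -- The term without `ψ` has no singularity to the right of `1`; hence the series starts with `b₂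
  -- T`.
  have h0 : rectInt (F 0) c R Y = 0 := by
    refine rectInt_eq_zero hcR.le Y fun z hz _ => ?_
    simp only [F, pow_zero]
    exact (differentiableAt_const _).fun_mul ((differentiableAt_const _).fun_mul (hg0 z hz))
  rw [← hasSum_nat_add_iff' 1] at hsum
  rw [Finset.sum_range_one, h0, sub_zero] at hsum
  refine hsum.congr_fun fun n => ?_
  rw [rectInt_const_mul, rectInt_psi_pow hk hc hcR hY hρc hρR, bTerm]
  ring

end HyperExp

/-! ### Growth of the integrand and passage of the contour across the poles -/

namespace HyperExp

variable {p : Params} {k : ℝ}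

theorem norm_jumpMGF_le {z : ℂ} {δ : ℝ} (hδ : 0 < δ) (h0 : 0 ≤ z.re)
    (h : ∀ i, δ ≤ ‖(p.ρ i : ℂ) - z‖) :
    ‖jumpMGF p z‖ ≤ ∑ i, p.aNeg i + ∑ i, p.aPos i * p.ρ i / δ := by
  unfold jumpMGF
  refine (norm_add_le _ _).trans (add_le_add ((norm_sum_le _ _).trans ?_)
    ((norm_sum_le _ _).trans ?_)) <;> refine Finset.sum_le_sum fun i _ => ?_
  · have h1 := p.aNeg_pos i
    have h2 := p.ρNeg_pos i
    have h3 : p.ρNeg i ≤ ‖(p.ρNeg i : ℂ) + z‖ := by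
      refine le_trans ?_ (Complex.re_le_norm _)
      simpa using h0
    rw [norm_div, norm_mul, Complex.norm_real, Complex.norm_real, Real.norm_of_nonneg h1.le,
      Real.norm_of_nonneg h2.le, div_le_iff₀ (h2.trans_le h3)]
    gcongr
  · have h1 := p.aPos_pos i
    have h2 := p.ρ_pos i
    rw [norm_div, norm_mul, Complex.norm_real, Complex.norm_real, Real.norm_of_nonneg h1.le,
      Real.norm_of_nonneg h2.le]
    gcongr
    exact h i

/-- Away from the poles the jump part of `ψ` is bounded. In the real part of the quadratic part the
term `-σ² (Im z)² / 2` is dropped, so the estimate depends on `Re z` alone; integrability along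
lines comes from the payoff transform. -/
theorem exists_norm_cexp_psi_le {δ T : ℝ} (hδ : 0 < δ) (hT : 0 ≤ T) :
    ∃ C, 0 < C ∧ ∀ z : ℂ, 0 ≤ z.re → (∀ i, δ ≤ ‖(p.ρ i : ℂ) - z‖) →
      ‖Complex.exp (T * psi p z)‖ ≤ C * Real.exp (T * (p.σ ^ 2 * z.re ^ 2 / 2 + p.a * z.re)) := by
  refine ⟨Real.exp (T * ((∑ i, p.aNeg i + ∑ i, p.aPos i * p.ρ i / δ) + ‖jumpMGF p 0‖)),
    Real.exp_pos _, fun z h0 h => ?_⟩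
  have hne : ∀ i, (p.ρ i : ℂ) - z ≠ 0 := fun i => norm_pos_iff.1 (hδ.trans_le (h i))
  rw [Complex.norm_exp, ← Real.exp_add, Complex.re_ofReal_mul, ← mul_add]
  refine Real.exp_le_exp.2 (mul_le_mul_of_nonneg_left ?_ hT)
  rw [psi_eq h0 hne, Complex.add_re, add_comm]
  refine add_le_add ?_ ?_
  · refine (Complex.re_le_norm _).trans ((norm_sub_le _ _).trans ?_)
    gcongr
    exact norm_jumpMGF_le hδ h0 h
  · have : ((p.σ : ℂ) ^ 2 * z ^ 2 / 2 + p.a * z).re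
        = p.σ ^ 2 * z.re ^ 2 / 2 + p.a * z.re - p.σ ^ 2 * z.im ^ 2 / 2 := by
      rw [← Complex.ofReal_pow, mul_div_assoc, Complex.add_re, Complex.re_ofReal_mul,
        Complex.re_ofReal_mul, show z ^ 2 / 2 = ((1 / 2 : ℝ) : ℂ) * (z ^ 2) by push_cast; ring,
        Complex.re_ofReal_mul, pow_two z, Complex.mul_re]
      ring
    rw [this]
    have : 0 ≤ p.σ ^ 2 * z.im ^ 2 / 2 := by positivity
    linarith

theorem exists_pos_forall_le {ι : Type*} [Finite ι] (f : ι → ℝ) (hf : ∀ i, 0 < f i) :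
    ∃ δ, 0 < δ ∧ ∀ i, δ ≤ f i := by
  have : ∀ᶠ δ in 𝓝[>] (0 : ℝ), 0 < δ ∧ ∀ i, δ ≤ f i :=
    Filter.Eventually.and self_mem_nhdsWithin (eventually_all.2 fun i =>
      mem_nhdsWithin_of_mem_nhds (Iic_mem_nhds (hf i)))
  exact this.exists

theorem continuous_priceKernel_line {T c : ℝ} (hc : 1 < c) (h : ∀ i, p.ρ i ≠ c) :
    Continuous fun y : ℝ => priceKernel p k T (c + y * Complex.I) := by
  refine Continuous.mul (Continuous.cexp (continuous_const.mul ?_))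
    (continuous_payoffTransform_line hc)
  refine continuous_iff_continuousAt.2 fun y => ContinuousAt.comp
    (f := fun y : ℝ => (c + y * Complex.I : ℂ))
    (differentiableAt_psi ?_ fun i h0 => ?_).continuousAt (by fun_prop)
  · simp; linarith
  · have := congrArg Complex.re h0
    simp [sub_eq_zero, h i] at this

theorem integrable_priceKernel_line {T R : ℝ} (hR : 1 < R) (hρR : ∀ i, p.ρ i < R) (hT : 0 ≤ T) :
    Integrable fun y : ℝ => priceKernel p k T (R + y * Complex.I) := by
  obtain ⟨δ, hδ, h₂⟩ := exists_pos_forall_le (fun i => R - p.ρ i) fun i => sub_pos.2 (hρR i)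
  obtain ⟨C, hC, hexp⟩ := exists_norm_cexp_psi_le (p := p) hδ hT
  obtain ⟨C', hC'⟩ := norm_payoffTransform_line_le (k := k) hR
  refine integrable_of_norm_le_inv_one_add_sq
    (C := C * Real.exp (T * (p.σ ^ 2 * R ^ 2 / 2 + p.a * R)) * C')
    (continuous_priceKernel_line hR fun i => (hρR i).ne) fun y => ?_
  rw [priceKernel, norm_mul, mul_div_assoc]
  refine mul_le_mul ?_ (hC' y) (norm_nonneg _) (by positivity)
  have hre : (R + y * Complex.I : ℂ).re = R := by simp
  have := hexp (R + y * Complex.I) (by rw [hre]; linarith) fun i => ?_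
  · rwa [hre] at this
  · rw [norm_sub_rev]
    refine le_trans ?_ (Complex.re_le_norm _)
    rw [Complex.sub_re, hre, Complex.ofReal_re]
    exact h₂ i

/-- Moving the line of integration across the poles of `ψ`. -/
theorem integral_priceKernel_eq (hk : 1 ≤ k) {c R T : ℝ} (hc : 1 < c) (hcR : c < R)
    (hρc : ∀ i, c < p.ρ i) (hρR : ∀ i, p.ρ i < R) (hT : 0 ≤ T) :
    ∫ y : ℝ, priceKernel p k T (c + y * Complex.I)
      = (∫ y : ℝ, priceKernel p k T (R + y * Complex.I))
        + 2 * Real.pi * ∑' n, bTerm p k (n + 1) T := by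
  have hk0 : 0 < k := one_pos.trans_le hk
  obtain ⟨δ₁, hδ₁, h₁⟩ := exists_pos_forall_le (fun i => p.ρ i - c) fun i => sub_pos.2 (hρc i)
  obtain ⟨δ₂, hδ₂, h₂⟩ := exists_pos_forall_le (fun i => R - p.ρ i) fun i => sub_pos.2 (hρR i)
  -- The poles are real: `1` bounds the distance to them where `|Im z| ≥ 1`, while `δ₁` and `δ₂`
  -- bound it on the two vertical lines.
  set δ := min 1 (min δ₁ δ₂)
  have hδ : 0 < δ := lt_min one_pos (lt_min hδ₁ hδ₂)
  obtain ⟨C, hC, hexp⟩ := exists_norm_cexp_psi_le (p := p) hδ hT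
  set B := C * Real.exp (T * (p.σ ^ 2 * R ^ 2 / 2 + |p.a| * R))
  set m := min ((c - 1) ^ 2) 1
  have hm : 0 < m := lt_min (by have : 0 < c - 1 := by linarith
                                positivity) one_pos
  have hJ : ∀ Y, 0 < Y → rectInt (priceKernel p k T) c R Y
      = -(2 * Real.pi * Complex.I) * ∑' n, bTerm p k (n + 1) T := fun Y hY => by
    rw [← tsum_mul_left, (hasSum_bTerm hk0 hc hcR hY hρc hρR T).tsum_eq]
    rfl
  have key := vertical_shift (C := B / m) hcR.le hJ
    (continuous_priceKernel_line hc fun i => (hρc i).ne')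
    (continuous_priceKernel_line (hc.trans hcR) fun i => (hρR i).ne) ?_
  · have hI : Complex.I ≠ 0 := Complex.I_ne_zero
    refine mul_left_cancel₀ hI ?_
    linear_combination -key
  · intro z hzc hzR hz
    have hz0 : 0 ≤ z.re := by linarith
    have hd : ∀ i, δ ≤ ‖(p.ρ i : ℂ) - z‖ := by
      intro i
      rcases hz with h | h | h
      · refine le_trans ?_ (Complex.re_le_norm _)
        simp only [Complex.sub_re, Complex.ofReal_re, h]
        exact ((min_le_right _ _).trans (min_le_left _ _)).trans (h₁ i)
      · rw [norm_sub_rev]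
        refine le_trans ?_ (Complex.re_le_norm _)
        simp only [Complex.sub_re, Complex.ofReal_re, h]
        exact ((min_le_right _ _).trans (min_le_right _ _)).trans (h₂ i)
      · refine le_trans (min_le_left _ _) (h.trans ?_)
        have := Complex.abs_im_le_norm ((p.ρ i : ℂ) - z)
        simpa using this
    have h1 : ‖Complex.exp (T * psi p z)‖ ≤ B := by
      refine (hexp z hz0 hd).trans ?_
      refine mul_le_mul_of_nonneg_left (Real.exp_le_exp.2 (mul_le_mul_of_nonneg_left ?_ hT)) hC.le
      have : p.a * z.re ≤ |p.a| * R :=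
        (mul_le_mul_of_nonneg_right (le_abs_self _) hz0).trans (by gcongr)
      gcongr
    have h2 : ‖payoffTransform k z‖ ≤ m⁻¹ / (1 + z.im ^ 2) := by
      refine (norm_payoffTransform_le (by linarith)).trans ?_
      have h3 : Real.exp (-(Real.log k * z.re)) ≤ 1 :=
        Real.exp_le_one_iff.2 (neg_nonpos.2 (mul_nonneg (Real.log_nonneg hk) hz0))
      have h4 : m * (1 + z.im ^ 2) ≤ (z.re - 1) ^ 2 + z.im ^ 2 := by
        have h5 : m ≤ (z.re - 1) ^ 2 := (min_le_left _ _).trans (by gcongr)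
        have h6 : m ≤ 1 := min_le_right _ _
        nlinarith [sq_nonneg z.im]
      calc _ ≤ 1 * (m * (1 + z.im ^ 2))⁻¹ := by gcongr
        _ = _ := by rw [one_mul, mul_inv, div_eq_mul_inv]
    rw [priceKernel, norm_mul]
    calc _ ≤ B * (m⁻¹ / (1 + z.im ^ 2)) := by gcongr
      _ = _ := by ring

/-- In the absence of a Gaussian part, and before the time `log k / a`, the integral over a line to
the right of all poles vanishes. -/
theorem integral_priceKernel_eq_zero {R T : ℝ} (hR : 1 < R)
    (hρR : ∀ i, p.ρ i < R) (hT : 0 ≤ T) (hσ : p.σ = 0) (ha : p.a * T ≤ Real.log k) :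
    ∫ y : ℝ, priceKernel p k T (R + y * Complex.I) = 0 := by
  obtain ⟨δ, hδ, h₂⟩ := exists_pos_forall_le (fun i => R - p.ρ i) fun i => sub_pos.2 (hρR i)
  obtain ⟨C, hC, hexp⟩ := exists_norm_cexp_psi_le (p := p) hδ hT
  -- For `x ≥ R` one has `x - 1 ≥ ((R - 1) / R) x`, hence `m (x² + y²) ≤ (x - 1)² + y²`.
  set m := min (((R - 1) / R) ^ 2) 1
  have hm : 0 < m := lt_min (by have : 0 < R - 1 := by linarith
                                positivity) one_pos
  have hd : ∀ z : ℂ, R ≤ z.re → ∀ i, δ ≤ ‖(p.ρ i : ℂ) - z‖ := by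
    intro z hz i
    rw [norm_sub_rev]
    refine le_trans ?_ (Complex.re_le_norm _)
    simp only [Complex.sub_re, Complex.ofReal_re]
    linarith [h₂ i]
  refine integral_vertical_eq_zero (C := C / m) (by linarith) (fun z hz => ?_) fun z hz => ?_
  · unfold priceKernel
    refine DifferentiableAt.fun_mul (DifferentiableAt.cexp ((differentiableAt_const _).fun_mul
      (differentiableAt_psi (by linarith) fun i => norm_pos_iff.1 (hδ.trans_le (hd z hz i)))))
      (differentiableAt_payoffTransform ?_ ?_) <;> (rintro rfl; simp at hz; linarith)
  · have hz0 : 0 < z.re := by linarith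
    have h4 : m * (z.re ^ 2 + z.im ^ 2) ≤ (z.re - 1) ^ 2 + z.im ^ 2 := by
      have h5 : m * z.re ^ 2 ≤ (z.re - 1) ^ 2 := by
        calc _ ≤ ((R - 1) / R) ^ 2 * z.re ^ 2 := by gcongr; exact min_le_left _ _
          _ = ((R - 1) / R * z.re) ^ 2 := by ring
          _ ≤ _ := by
            have h0 : 0 < R - 1 := by linarith
            gcongr
            rw [div_mul_eq_mul_div, div_le_iff₀ (by linarith)]
            nlinarith
      have h6 : m ≤ 1 := min_le_right _ _
      nlinarith [sq_nonneg z.im]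
    have h1 := hexp z hz0.le (hd z hz)
    rw [hσ] at h1
    rw [priceKernel, norm_mul]
    calc _ ≤ (C * Real.exp (T * (0 ^ 2 * z.re ^ 2 / 2 + p.a * z.re))) *
          (Real.exp (-(Real.log k * z.re)) * (m * (z.re ^ 2 + z.im ^ 2))⁻¹) := by
          gcongr
          refine (norm_payoffTransform_le (by linarith)).trans ?_
          gcongr
      _ = C * Real.exp ((p.a * T - Real.log k) * z.re) * (m * (z.re ^ 2 + z.im ^ 2))⁻¹ := by
          rw [mul_mul_mul_comm, ← mul_assoc, mul_assoc C, ← Real.exp_add]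
          ring_nf
      _ ≤ C * 1 * (m * (z.re ^ 2 + z.im ^ 2))⁻¹ := by
          gcongr
          exact Real.exp_le_one_iff.2 (mul_nonpos_of_nonpos_of_nonneg (by linarith) hz0.le)
      _ = _ := by rw [mul_one, mul_inv]; ring

end HyperExp

namespace HyperExp

/-! ### The solution `ζ_M` and the coefficients `cₙ` -/

variable {p : Params} {k : ℝ}

/-- The regular part of `ψ(1/v)` at `v = 0`. -/
noncomputable def etaFun (p : Params) (v : ℂ) : ℂ :=
  -(∑ i, (p.aPos i : ℂ) * (1 - p.ρ i * v)⁻¹ + ∑ i, (p.aNeg i : ℂ) * (1 - (-p.ρNeg i : ℝ) * v)⁻¹)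

theorem psi_inv {v : ℂ} (hv : v ≠ 0) :
    psi p v⁻¹ = (p.σ : ℂ) ^ 2 * (v ^ 2)⁻¹ / 2 + p.a * v⁻¹ + etaFun p v := by
  have h1 : ∀ i, v⁻¹ * ((p.aPos i : ℂ) / (p.ρ i - v⁻¹))
      = -((p.aPos i : ℂ) * (1 - p.ρ i * v)⁻¹) := by
    intro i
    rw [show (p.ρ i : ℂ) - v⁻¹ = -(1 - p.ρ i * v) * v⁻¹ by field_simp; ring, ← mul_div_assoc,
      mul_comm v⁻¹, mul_div_mul_right _ _ (inv_ne_zero hv), div_neg, div_eq_mul_inv]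
  have h2 : ∀ i, v⁻¹ * ((p.aNeg i : ℂ) / (p.ρNeg i + v⁻¹))
      = (p.aNeg i : ℂ) * (1 - (-p.ρNeg i : ℝ) * v)⁻¹ := by
    intro i
    rw [show (p.ρNeg i : ℂ) + v⁻¹ = (1 - (-p.ρNeg i : ℝ) * v) * v⁻¹ by
      push_cast; field_simp; ring, ← mul_div_assoc,
      mul_comm v⁻¹, mul_div_mul_right _ _ (inv_ne_zero hv), div_eq_mul_inv]
  rw [psi, etaFun, Finset.mul_sum, Finset.mul_sum, Finset.sum_congr rfl fun i _ => h1 i,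
    Finset.sum_congr rfl fun i _ => h2 i, Finset.sum_neg_distrib, inv_pow]
  ring

theorem rep_geom_one (d : ℝ) :
    Rep (PowerSeries.mk fun n => d ^ n) (fun v => (1 - d * v : ℂ)⁻¹) := by
  have h := ((Rep.const 1).sub ((Rep.const d).mul Rep.id)).inv (by simp)
  rw [Complex.ofReal_one] at h
  convert h using 1
  rw [PowerSeries.eq_inv_iff_mul_eq_one (by simp)]
  ext n
  rw [mul_sub, map_sub, map_one, mul_one, ← mul_assoc]
  rcases n with _ | n
  · simp
  · rw [PowerSeries.coeff_succ_mul_X, PowerSeries.coeff_mul_C, PowerSeries.coeff_mk,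
      PowerSeries.coeff_mk, PowerSeries.coeff_one, if_neg (Nat.succ_ne_zero n)]
    ring

theorem rep_etaFun : Rep (PowerSeries.mk (eta p)) (etaFun p) := by
  have r := ((Rep.finset_sum Finset.univ fun i _ =>
    (Rep.const (p.aPos i)).mul (rep_geom_one (p.ρ i))).add
    (Rep.finset_sum Finset.univ fun i _ =>
      (Rep.const (p.aNeg i)).mul (rep_geom_one (-p.ρNeg i)))).neg
  convert r using 1
  swap
  · rfl
  ext n
  simp only [PowerSeries.coeff_mk, map_neg, map_add, map_sum, PowerSeries.coeff_C_mul, eta]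
  rw [Finset.mul_sum]
  congr 2
  refine Finset.sum_congr rfl fun i _ => ?_
  rw [neg_pow]; ring

theorem rep_vhSeries : Rep (vhSeries p) (fun v => p.a + v * etaFun p v) := by
  convert (Rep.const p.a).add (Rep.id.mul rep_etaFun) using 1
  ext n
  rcases n with _ | n
  · simp [vhSeries]
  · simp [vhSeries, PowerSeries.coeff_succ_X_mul]

theorem rep_vvhSeries :
    Rep (vvhSeries p) (fun v => (p.σ ^ 2 / 2 : ℝ) + v * (p.a + v * etaFun p v)) := by
  convert (Rep.const (p.σ ^ 2 / 2)).add
    (Rep.id.mul ((Rep.const p.a).add (Rep.id.mul rep_etaFun))) using 1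
  ext n
  rcases n with _ | _ | n
  · simp [vvhSeries]
  · rw [LinearMap.map_add, PowerSeries.coeff_succ_X_mul, PowerSeries.coeff_C]
    simp [vvhSeries]
  · rw [LinearMap.map_add, PowerSeries.coeff_succ_X_mul, PowerSeries.coeff_C, LinearMap.map_add,
      PowerSeries.coeff_succ_X_mul, PowerSeries.coeff_C]
    simp [vvhSeries]

/-- `(v² ψ(1/v))^{1/2}`, continued to `v = 0`. -/
noncomputable def kappaGauss (p : Params) (v : ℂ) : ℂ :=
  Complex.exp (Complex.log ((p.σ ^ 2 / 2 : ℝ) + v * (p.a + v * etaFun p v)) / 2)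

theorem kappaGauss_zero (hσ : 0 < p.σ) : kappaGauss p 0 = (p.σ / √2 : ℝ) := by
  have h : p.σ ^ 2 / 2 = (p.σ / √2) * (p.σ / √2) := by
    rw [div_mul_div_comm, Real.mul_self_sqrt zero_le_two, sq]
  have h1 : 0 < p.σ / √2 := by positivity
  rw [kappaGauss, zero_mul, add_zero, h, ← Complex.ofReal_log (by positivity),
    Real.log_mul h1.ne' h1.ne', ← two_mul, Complex.ofReal_mul, Complex.ofReal_ofNat,
    mul_div_cancel_left₀ _ two_ne_zero, ← Complex.ofReal_exp, Real.exp_log h1]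

theorem kappaGauss_mul_self (hσ : 0 < p.σ) : ∀ᶠ v in 𝓝 0, kappaGauss p v * kappaGauss p v
    = (p.σ ^ 2 / 2 : ℝ) + v * (p.a + v * etaFun p v) := by
  have h0 : (p.σ ^ 2 / 2 : ℝ) + (0 : ℂ) * (p.a + 0 * etaFun p 0) ≠ 0 := by
    rw [zero_mul, add_zero]; exact_mod_cast (by positivity : p.σ ^ 2 / 2 ≠ 0)
  filter_upwards [(rep_vvhSeries (p := p)).1.continuousAt.eventually_ne h0] with v hv
  rw [kappaGauss, ← Complex.exp_add, add_halves, Complex.exp_log hv]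

theorem rep_sqrt_vvhSeries (hσ : 0 < p.σ) : Rep (sqrtSeries (vvhSeries p)) (kappaGauss p) := by
  have hc : PowerSeries.coeff 0 (vvhSeries p) = p.σ ^ 2 / 2 := by simp [vvhSeries]
  refine Rep.sqrtSeries rep_vvhSeries (by rw [hc]; positivity) ?_ (kappaGauss_mul_self hσ) ?_
  · refine AnalyticAt.cexp (AnalyticAt.fun_div (rep_vvhSeries.1.clog ?_) analyticAt_const
      two_ne_zero)
    rw [zero_mul, add_zero]
    exact Complex.ofReal_mem_slitPlane.2 (by positivity)
  · rw [kappaGauss_zero hσ, hc, Real.sqrt_div (sq_nonneg _), Real.sqrt_sq hσ.le]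

/-! ### The generating series of the `cₙ` -/

/-- `ξ' (1 - ξ)⁻¹ β`, where `ξ = 1/ζ_M`. -/
noncomputable def kernelSeries (k : ℝ) (ξ : PowerSeries ℝ) : PowerSeries ℝ :=
  PowerSeries.derivative ℝ ξ * (1 - ξ)⁻¹ * betaM k ξ

theorem X_mul_shift {ξ : PowerSeries ℝ} (h0 : PowerSeries.constantCoeff ξ = 0) :
    PowerSeries.X * shift ξ = ξ := by
  ext n
  rcases n with _ | n
  · simp [h0]
  · rw [PowerSeries.coeff_succ_X_mul, shift, PowerSeries.coeff_mk]

/-- Let `ζ = 1/ξ` and `Z = s ζ`. Then `Z - s Z' = -s² ζ' = s² ξ' / ξ²`, and `ξ ς = 1 / (ζ (ζ - 1)) =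
ξ² / (1 - ξ)`. As `ζ` has a pole at `s = 0`, the proof works with the unit `x = ξ / s` instead. -/
theorem mul_varsigmaM_mul {ξ : PowerSeries ℝ} (h0 : PowerSeries.constantCoeff ξ = 0)
    (h1 : PowerSeries.coeff 1 ξ ≠ 0) :
    ξ * varsigmaM ξ * (sZeta ξ - PowerSeries.X * PowerSeries.derivative ℝ (sZeta ξ))
      = PowerSeries.X ^ 2 * (PowerSeries.derivative ℝ ξ * (1 - ξ)⁻¹) := by
  set x := shift ξ with hx
  have hξ : PowerSeries.X * x = ξ := X_mul_shift h0
  have hx0 : PowerSeries.constantCoeff x ≠ 0 := by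
    rw [← PowerSeries.coeff_zero_eq_constantCoeff_apply, hx, shift, PowerSeries.coeff_mk]
    exact h1
  have hxx : x * x⁻¹ = 1 := PowerSeries.mul_inv_cancel _ hx0
  have h10 : PowerSeries.constantCoeff (1 - ξ) ≠ 0 := by simp [h0]
  have hi : (1 - ξ) * (1 - ξ)⁻¹ = 1 := PowerSeries.mul_inv_cancel _ h10
  have hz : sZeta ξ = x⁻¹ := rfl
  have hinv : (x⁻¹ - PowerSeries.X)⁻¹ = x * (1 - ξ)⁻¹ := by
    rw [eq_comm, PowerSeries.eq_inv_iff_mul_eq_one (by simpa using hx0)]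
    linear_combination hi + (1 - ξ)⁻¹ * hxx - (1 - ξ)⁻¹ * hξ
  have hdξ : PowerSeries.derivative ℝ ξ = x + PowerSeries.X * PowerSeries.derivative ℝ x := by
    rw [← hξ, Derivation.leibniz, PowerSeries.derivative_X]
    simp [add_comm]
  have hdz : PowerSeries.derivative ℝ x⁻¹ = -(x⁻¹ ^ 2 * PowerSeries.derivative ℝ x) := by
    have := congrArg (PowerSeries.derivative ℝ) hxx
    rw [Derivation.leibniz, smul_eq_mul, smul_eq_mul, Derivation.map_one_eq_zero] at this
    linear_combination x⁻¹ * this - PowerSeries.derivative ℝ x⁻¹ * hxx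
  rw [varsigmaM, hz, hinv, hdz, hdξ]
  have e : ξ * (x * x⁻¹ ^ 2) = PowerSeries.X * (x * x⁻¹) ^ 2 := by rw [← hξ]; ring
  have e2 : ξ * (x * x⁻¹) = PowerSeries.X * x * (x * x⁻¹) := by rw [hξ]
  rw [hxx] at e e2
  linear_combination (PowerSeries.X ^ 2 * (1 - ξ)⁻¹ * PowerSeries.derivative ℝ x) * e
    + PowerSeries.X * (1 - ξ)⁻¹ * e2 + ξ * PowerSeries.X * (1 - ξ)⁻¹ * hxx

theorem lagrangeInv_constantCoeff (f : PowerSeries ℝ) :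
    PowerSeries.constantCoeff (lagrangeInv f) = 0 := by
  simp [lagrangeInv]

theorem coeff_one_lagrangeInv (f : PowerSeries ℝ) :
    PowerSeries.coeff 1 (lagrangeInv f) = PowerSeries.coeff 0 f := by
  simp [lagrangeInv]

/-- For `s = 1/q`, `dζ/dq = -s² ζ'(s)`, which is `Z - s Z'` for `Z = s ζ`. -/
theorem zetaDerivDrift_eq : zetaDerivDrift p = sZeta (xiDrift p)
    - PowerSeries.X * PowerSeries.derivative ℝ (sZeta (xiDrift p)) := by
  ext n
  rw [map_sub, zetaDerivDrift, PowerSeries.coeff_mk]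
  rcases n with _ | n
  · simp
  · rw [PowerSeries.coeff_succ_X_mul, PowerSeries.coeff_derivative]
    push_cast; ring

/-- For `s = q^{-1/2}`, `ds/dq = -s³ / 2`, which produces the extra factor `s / 2` compared with the
case `s = 1/q`. -/
theorem zetaDerivGauss_eq : zetaDerivGauss p = PowerSeries.X * (PowerSeries.C (1 / 2 : ℝ)
    * (sZeta (xiGauss p) - PowerSeries.X * PowerSeries.derivative ℝ (sZeta (xiGauss p)))) := by
  ext n
  rw [zetaDerivGauss, PowerSeries.coeff_mk]
  rcases n with _ | n
  · simp
  · rw [PowerSeries.coeff_succ_X_mul, PowerSeries.coeff_C_mul, map_sub, if_neg (by omega)]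
    rcases n with _ | n
    · norm_num
    · rw [PowerSeries.coeff_succ_X_mul, PowerSeries.coeff_derivative, Nat.add_sub_cancel]
      push_cast; ring

theorem cDrift_eq (ha : p.a ≠ 0) (n : ℕ) :
    cDrift p k (n + 2) = PowerSeries.coeff n (kernelSeries k (xiDrift p)) := by
  have h := mul_varsigmaM_mul (lagrangeInv_constantCoeff (vhSeries p)) (by
    rw [coeff_one_lagrangeInv]; simpa [vhSeries])
  rw [cDrift, zetaDerivDrift_eq, mul_right_comm, xiDrift, h, mul_assoc,
    PowerSeries.coeff_X_pow_mul, kernelSeries]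

theorem cGauss_eq (hσ : 0 < p.σ) (n : ℕ) :
    cGauss p k (n + 3) = 1 / 2 * PowerSeries.coeff n (kernelSeries k (xiGauss p)) := by
  have h := mul_varsigmaM_mul (lagrangeInv_constantCoeff (sqrtSeries (vvhSeries p))) (by
    rw [coeff_one_lagrangeInv]
    have h1 : 0 < p.σ ^ 2 / 2 := by positivity
    simpa [sqrtSeries, sqrtCoeff, vvhSeries] using (Real.sqrt_pos.2 h1).ne')
  have : xiGauss p * varsigmaM (xiGauss p) * betaM k (xiGauss p) * zetaDerivGauss p
      = PowerSeries.X ^ 3 * (PowerSeries.C (1 / 2 : ℝ) * kernelSeries k (xiGauss p)) := by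
    rw [zetaDerivGauss_eq, kernelSeries]
    rw [← xiGauss] at h
    linear_combination PowerSeries.X * PowerSeries.C (1 / 2 : ℝ) * betaM k (xiGauss p) * h
  rw [cGauss, this, PowerSeries.coeff_X_pow_mul, PowerSeries.coeff_C_mul]

end HyperExp

namespace HyperExp

/-! ### Deformation of a nearly vertical contour -/

/-- A holomorphic function on a half-plane has a primitive on every bounded set with positive
distance to the boundary. -/
theorem exists_primitive_of_half_plane {A : ℂ → ℂ} {r₁ ε L : ℝ} (hε : 0 < ε)
    (hA : ∀ u : ℂ, r₁ < u.re → DifferentiableAt ℂ A u) :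
    ∃ G : ℂ → ℂ, ∀ u : ℂ, r₁ + ε ≤ u.re → ‖u‖ ≤ L → HasDerivAt G (A u) u := by
  -- Large discs tangent to `Re u = r₁` from the right exhaust the half-plane. The disc of centre
  -- `M` and radius `M - r₁` contains the bounded set as soon as `L² < M ε`, and holomorphic
  -- functions on discs have primitives.
  set M : ℝ := |r₁| + L ^ 2 / ε + 1 with hM
  have hball : ∀ u ∈ Metric.ball (M : ℂ) (M - r₁), r₁ < u.re := by
    intro u hu
    rw [Metric.mem_ball, dist_comm, dist_eq_norm] at hu
    have := (Complex.re_le_norm _).trans_lt hu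
    simp at this
    linarith
  obtain ⟨G, hG⟩ := DifferentiableOn.isExactOn_ball (f := A) (c := (M : ℂ)) (r := M - r₁)
    fun u hu => (hA u (hball u hu)).differentiableWithinAt
  refine ⟨G, fun u hu huL => hG u ?_⟩
  have hM1 : r₁ < M := by
    have := le_abs_self r₁
    have : 0 ≤ L ^ 2 / ε := by positivity
    linarith
  have h1 : L ^ 2 < M * ε := by
    have h2 : L ^ 2 / ε < M := by have := abs_nonneg r₁; linarith
    rwa [div_lt_iff₀ hε] at h2
  have hM0 : 0 < M := by positivity
  rw [Metric.mem_ball, dist_eq_norm]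
  refine lt_of_pow_lt_pow_left₀ 2 (by linarith) ?_
  have h3 : ‖u - M‖ ^ 2 = ‖u‖ ^ 2 - 2 * M * u.re + M ^ 2 := by
    rw [Complex.sq_norm, Complex.sq_norm, Complex.normSq_apply, Complex.normSq_apply]
    simp; ring
  have h4 : ‖u‖ ^ 2 ≤ L ^ 2 := by gcongr
  rw [h3]
  nlinarith [sq_nonneg r₁]

/-- Cut off at height `Y`, both integrals are differences of endpoint values of one primitive of
`A`, which may depend on `Y`. Corresponding endpoints are at distance at most `B`, and between them
`|A| = O(Y⁻²)`, so the two truncations have the same limit. -/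
theorem integral_comp_mul_deriv_eq_integral_vertical {A : ℂ → ℂ} {γ γ' : ℝ → ℂ}
    {r₁ r κ₀ B C : ℝ} (hκ₀ : 0 < κ₀) (hr : r₁ + B < r)
    (hA : ∀ u : ℂ, r₁ < u.re → DifferentiableAt ℂ A u)
    (hAC : ∀ u : ℂ, |u.re - r| ≤ B → ‖A u‖ ≤ C / (1 + u.im ^ 2))
    (hγ : ∀ y, HasDerivAt γ (γ' y) y)
    (hγB : ∀ y : ℝ, ‖γ y - (r + (κ₀ * y : ℝ) * Complex.I)‖ ≤ B)
    (hint : Integrable fun y => A (γ y) * γ' y) :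
    ∫ y, A (γ y) * γ' y = Complex.I * ∫ w : ℝ, A (r + w * Complex.I) := by
  have hB : 0 ≤ B := (norm_nonneg _).trans (hγB 0)
  have hline : ∀ w : ℝ, |(r + w * Complex.I : ℂ).re - r| ≤ B := fun w => by simpa
  have hcont : Continuous fun w : ℝ => A (r + w * Complex.I) :=
    continuous_iff_continuousAt.2 fun w => ContinuousAt.comp
      (f := fun w : ℝ => (r + w * Complex.I : ℂ))
      (hA _ (by simp; linarith)).continuousAt (by fun_prop)
  have hintA : Integrable fun w : ℝ => A (r + w * Complex.I) :=
    integrable_of_norm_le_inv_one_add_sq hcont fun w => by simpa using hAC _ (hline w)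
  have hC : 0 ≤ C := by
    have := (norm_nonneg _).trans (hAC r (by simpa))
    simpa using this
  have hf : Tendsto (fun Y : ℝ => ∫ y in -Y..Y, A (γ y) * γ' y) atTop
      (𝓝 (∫ y, A (γ y) * γ' y)) :=
    intervalIntegral_tendsto_integral hint tendsto_neg_atTop_atBot tendsto_id
  have hg : Tendsto (fun Y : ℝ => Complex.I * ∫ w in -(κ₀ * Y)..(κ₀ * Y), A (r + w * Complex.I))
      atTop (𝓝 (Complex.I * ∫ w : ℝ, A (r + w * Complex.I))) :=
    (intervalIntegral_tendsto_integral hintA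
      (tendsto_neg_atTop_atBot.comp (tendsto_id.const_mul_atTop hκ₀))
      (tendsto_id.const_mul_atTop hκ₀)).const_mul _
  refine tendsto_nhds_unique hf ?_
  have hlim : Tendsto (fun Y : ℝ => 2 * (C / (1 + (κ₀ * Y - B) ^ 2) * B)) atTop (𝓝 0) := by
    have h1 : Tendsto (fun Y : ℝ => 1 + (κ₀ * Y - B) ^ 2) atTop atTop :=
      tendsto_atTop_add_const_left _ _ ((tendsto_pow_atTop two_ne_zero).comp
        (tendsto_atTop_add_const_right _ _ (tendsto_id.const_mul_atTop hκ₀)))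
    simpa using ((h1.const_div_atTop C).mul_const B).const_mul 2
  refine (tendsto_iff_of_dist (squeeze_zero' (Eventually.of_forall fun _ => dist_nonneg) ?_
    hlim)).2 hg
  filter_upwards [eventually_ge_atTop (B / κ₀), eventually_ge_atTop 0] with Y hY hY0
  have hYB : B ≤ κ₀ * Y := by rw [div_le_iff₀ hκ₀] at hY; linarith
  -- Bounds the modulus on the whole `B`-neighbourhood of the truncated line, including the squares
  -- around its endpoints.
  set L : ℝ := |r| + B + (κ₀ * Y + B)
  obtain ⟨G, hG⟩ := exists_primitive_of_half_plane (r₁ := r₁) (ε := r - B - r₁) (L := L)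
    (by linarith) hA
  have hG' : ∀ u : ℂ, |u.re - r| ≤ B → |u.im| ≤ κ₀ * Y + B → HasDerivAt G (A u) u := by
    intro u h1 h2
    refine hG u (by have := (abs_le.1 h1).1; linarith) ((Complex.norm_le_abs_re_add_abs_im u).trans
      (add_le_add ?_ h2))
    calc |u.re| = |r + (u.re - r)| := by ring_nf
      _ ≤ |r| + |u.re - r| := abs_add_le _ _
      _ ≤ _ := by gcongr
  have hre : ∀ y, |(γ y).re - r| ≤ B := fun y => by
    have := (Complex.abs_re_le_norm _).trans (hγB y)
    simpa using this
  have him : ∀ y, |(γ y).im - κ₀ * y| ≤ B := fun y => by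
    have := (Complex.abs_im_le_norm _).trans (hγB y)
    simpa using this
  have e1 : ∫ y in -Y..Y, A (γ y) * γ' y = G (γ Y) - G (γ (-Y)) := by
    refine intervalIntegral.integral_eq_sub_of_hasDerivAt (f := fun y => G (γ y)) (fun y hy => ?_)
      hint.intervalIntegrable
    rw [uIcc_of_le (by linarith)] at hy
    refine (hG' _ (hre y) ?_).comp_of_eq y (hγ y) rfl
    have h1 : |κ₀ * y| ≤ κ₀ * Y := by
      rw [abs_mul, abs_of_pos hκ₀]; gcongr; exact abs_le.2 hy
    calc |(γ y).im| = |κ₀ * y + ((γ y).im - κ₀ * y)| := by ring_nf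
      _ ≤ _ := (abs_add_le _ _).trans (add_le_add h1 (him y))
  have e2 : Complex.I * ∫ w in -(κ₀ * Y)..(κ₀ * Y), A (r + w * Complex.I)
      = G (r + (κ₀ * Y : ℝ) * Complex.I) - G (r + (-(κ₀ * Y) : ℝ) * Complex.I) := by
    rw [mul_comm, ← intervalIntegral.integral_mul_const]
    refine intervalIntegral.integral_eq_sub_of_hasDerivAt
      (f := fun w : ℝ => G (r + w * Complex.I)) (fun w hw => ?_)
      ((hcont.mul continuous_const).intervalIntegrable _ _)
    rw [uIcc_of_le (by nlinarith)] at hw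
    have h1 : HasDerivAt (fun w : ℝ => (r + w * Complex.I : ℂ)) Complex.I w := by
      simpa using ((Complex.ofRealCLM.hasDerivAt (x := w)).mul_const Complex.I).const_add (r : ℂ)
    refine (hG' _ (hline w) ?_).comp_of_eq w h1 rfl
    have := abs_le.2 hw
    simpa using this.trans (by linarith)
  have e3 : ∀ y : ℝ, |y| = Y → ‖G (γ y) - G (r + (κ₀ * y : ℝ) * Complex.I)‖
      ≤ C / (1 + (κ₀ * Y - B) ^ 2) * B := by
    intro y hy
    have hy' : |κ₀ * y| = κ₀ * Y := by rw [abs_mul, abs_of_pos hκ₀, hy]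
    set S : Set ℂ := Icc (r - B) (r + B) ×ℂ Icc (κ₀ * y - B) (κ₀ * y + B)
    have hS : ∀ u ∈ S, |u.re - r| ≤ B ∧ |u.im - κ₀ * y| ≤ B := by
      rintro u ⟨h1, h2⟩
      exact ⟨abs_sub_le_iff.2 ⟨by linarith [h1.2], by linarith [h1.1]⟩,
        abs_sub_le_iff.2 ⟨by linarith [h2.2], by linarith [h2.1]⟩⟩
    have hmem : ∀ u : ℂ, |u.re - r| ≤ B → |u.im - κ₀ * y| ≤ B → u ∈ S := fun u h1 h2 =>
      ⟨⟨by linarith [(abs_le.1 h1).1], by linarith [(abs_le.1 h1).2]⟩,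
        ⟨by linarith [(abs_le.1 h2).1], by linarith [(abs_le.1 h2).2]⟩⟩
    have hconv : Convex ℝ S :=
      ((convex_Icc _ _).linear_preimage Complex.reLm).inter
        ((convex_Icc _ _).linear_preimage Complex.imLm)
    refine (hconv.norm_image_sub_le_of_norm_hasDerivWithin_le (f := G) (f' := A)
      (C := C / (1 + (κ₀ * Y - B) ^ 2)) (fun u hu => ?_) (fun u hu => ?_)
      (hmem _ (by simpa) (by simpa)) (hmem _ (hre y) (him y))).trans ?_
    · refine (hG' u (hS u hu).1 ?_).hasDerivWithinAt
      calc |u.im| = |κ₀ * y + (u.im - κ₀ * y)| := by ring_nf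
        _ ≤ _ := (abs_add_le _ _).trans (add_le_add hy'.le (hS u hu).2)
    · refine (hAC u (hS u hu).1).trans ?_
      have h1 : κ₀ * Y - B ≤ |u.im| := by
        have h2 : |κ₀ * y| ≤ |u.im| + |u.im - κ₀ * y| := by
          calc |κ₀ * y| = |u.im + -(u.im - κ₀ * y)| := by ring_nf
            _ ≤ _ := (abs_add_le _ _).trans (by rw [abs_neg])
        linarith [(hS u hu).2]
      rw [← sq_abs u.im]
      have h0 : 0 ≤ κ₀ * Y - B := by linarith
      gcongr
    · exact mul_le_mul_of_nonneg_left (hγB y) (by positivity)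
  rw [e1, e2, dist_eq_norm]
  have h1 := e3 Y (abs_of_nonneg hY0)
  have h2 := e3 (-Y) (by rw [abs_neg, abs_of_nonneg hY0])
  rw [mul_neg] at h2
  calc _ = ‖(G (γ Y) - G (r + (κ₀ * Y : ℝ) * Complex.I))
        - (G (γ (-Y)) - G (r + (-(κ₀ * Y) : ℝ) * Complex.I))‖ := by congr 1; ring
    _ ≤ _ := (norm_sub_le _ _).trans (by linarith)

end HyperExp

namespace HyperExp

/-! ### Gaussian and exponential integrals -/

theorem integrableOn_pow_mul_exp_neg {r : ℝ} (hr : 0 < r) (m : ℕ) :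
    IntegrableOn (fun t : ℝ => t ^ m * Real.exp (-(r * t))) (Ioi 0) := by
  have := integrableOn_rpow_mul_exp_neg_mul_rpow (p := 1) (s := m) (b := r)
    (by have : (0 : ℝ) ≤ m := m.cast_nonneg
        linarith) one_pos hr
  simpa using this

theorem integrableOn_pow_mul_cexp_neg {u : ℂ} (hu : 0 < u.re) (m : ℕ) :
    IntegrableOn (fun t : ℝ => (t : ℂ) ^ m * Complex.exp (-(u * t))) (Ioi 0) := by
  refine (integrableOn_pow_mul_exp_neg hu m).mono' (Continuous.aestronglyMeasurable (by fun_prop))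
    ((ae_restrict_iff' measurableSet_Ioi).2 (ae_of_all _ fun t ht => ?_))
  have ht' : 0 < t := ht
  rw [norm_mul, norm_pow, Complex.norm_exp, Complex.norm_real, Real.norm_of_nonneg ht'.le]
  simp

theorem integral_pow_mul_cexp_neg {u : ℂ} (hu : 0 < u.re) (m : ℕ) :
    ∫ t in Ioi (0 : ℝ), (t : ℂ) ^ m * Complex.exp (-(u * t)) = m.factorial / u ^ (m + 1) := by
  have hu0 : u ≠ 0 := fun h => by simp [h] at hu
  induction m with
  | zero =>
    have := integral_exp_mul_complex_Ioi (a := -u) (by simpa) 0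
    simpa [div_eq_mul_inv] using this
  | succ m ih =>
    have hd : ∀ t : ℝ, HasDerivAt (fun t : ℝ => (t : ℂ) ^ (m + 1) * Complex.exp (-(u * t)))
        ((m + 1) * ((t : ℂ) ^ m * Complex.exp (-(u * t)))
          - u * ((t : ℂ) ^ (m + 1) * Complex.exp (-(u * t)))) t := by
      intro t
      have h1 : HasDerivAt (fun t : ℝ => (t : ℂ)) 1 t := Complex.ofRealCLM.hasDerivAt
      have h2 := (h1.fun_pow (m + 1)).fun_mul (((h1.const_mul u).fun_neg).cexp)
      refine h2.congr_deriv ?_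
      push_cast
      simp
      ring
    have hi := (integrableOn_pow_mul_cexp_neg hu m).const_mul ((m : ℂ) + 1)
    have hi2 := (integrableOn_pow_mul_cexp_neg hu (m + 1)).const_mul u
    have hlim := tendsto_zero_of_hasDerivAt_of_integrableOn_Ioi (a := (0 : ℝ)) (fun t _ => hd t)
      (hi.sub hi2) (integrableOn_pow_mul_cexp_neg hu (m + 1))
    have := integral_Ioi_of_hasDerivAt_of_tendsto' (a := (0 : ℝ)) (fun t _ => hd t)
      (hi.sub hi2) hlim
    rw [integral_sub hi hi2, integral_const_mul, integral_const_mul, ih] at this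
    simp only [Complex.ofReal_zero, zero_pow (Nat.succ_ne_zero m), zero_mul, sub_zero] at this
    have h3 : ∫ t in Ioi (0 : ℝ), (t : ℂ) ^ (m + 1) * Complex.exp (-(u * t))
        = (m + 1) * (m.factorial / u ^ (m + 1)) / u := by
      field_simp
      linear_combination (-1 : ℂ) * u ^ (m + 1) * this + (m + 1) * m.factorial * (by field_simp : u ^ (m+1) / u ^ (m+1) = (1:ℂ))
    rw [h3, Nat.factorial_succ]
    push_cast
    field_simp
    ring

theorem integral_Ioi_eq_integral_comp_add (f : ℝ → ℂ) (c : ℝ) :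
    ∫ t in Ioi c, f t = ∫ t in Ioi (0 : ℝ), f (t + c) := by
  have h := (measurePreserving_add_right volume c).setIntegral_preimage_emb
    (measurableEmbedding_addRight c) f (Ioi c)
  rw [preimage_add_const_Ioi, sub_self] at h
  exact h.symm

theorem integrableOn_Ioi_of_comp_add {f : ℝ → ℝ} {c : ℝ}
    (h : IntegrableOn (fun t => f (t + c)) (Ioi 0)) : IntegrableOn f (Ioi c) := by
  refine ((measurePreserving_add_right volume c).integrableOn_comp_preimage
    (measurableEmbedding_addRight c)).1 ?_
  rw [preimage_add_const_Ioi, sub_self]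
  exact h

theorem integral_sub_pow_mul_cexp_neg {u : ℂ} (hu : 0 < u.re) (c : ℝ) (m : ℕ) :
    ∫ t in Ioi c, ((t : ℂ) - c) ^ m * Complex.exp (-(u * t))
      = Complex.exp (-(u * c)) * (m.factorial / u ^ (m + 1)) := by
  rw [integral_Ioi_eq_integral_comp_add, ← integral_pow_mul_cexp_neg hu m, ← integral_const_mul]
  refine setIntegral_congr_fun measurableSet_Ioi fun t _ => ?_
  push_cast
  rw [mul_left_comm, ← Complex.exp_add]
  ring_nf

theorem integrable_mul_cexp_line {T : ℝ} (hT : 0 < T) (r τ : ℝ) :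
    Integrable (fun y : ℝ => ‖(r + y * Complex.I : ℂ)‖ *
      Real.exp (T * (r ^ 2 - y ^ 2) - τ * r)) := by
  have h1 := ((integrable_exp_neg_mul_sq hT).const_mul |r|).add
    (integrable_mul_exp_neg_mul_sq hT).norm
  refine (h1.mul_const (Real.exp (T * r ^ 2 - τ * r))).mono'
    (Continuous.aestronglyMeasurable (by fun_prop)) (ae_of_all _ fun y => ?_)
  have h2 : ‖(r + y * Complex.I : ℂ)‖ ≤ |r| + |y| := by
    refine (norm_add_le _ _).trans ?_
    simp
  have h3 : Real.exp (T * (r ^ 2 - y ^ 2) - τ * r)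
      = Real.exp (-T * y ^ 2) * Real.exp (T * r ^ 2 - τ * r) := by
    rw [← Real.exp_add]; ring_nf
  rw [norm_mul, norm_norm, Real.norm_of_nonneg (Real.exp_pos _).le, h3]
  simp only [Pi.add_apply, norm_mul, Real.norm_eq_abs, Real.abs_exp]
  have h4 := mul_le_mul_of_nonneg_right h2
    (mul_pos (Real.exp_pos (-T * y ^ 2)) (Real.exp_pos (T * r ^ 2 - τ * r))).le
  linarith

theorem norm_cexp_line (T r τ y : ℝ) :
    ‖Complex.exp (T * (r + y * Complex.I) ^ 2 - τ * (r + y * Complex.I))‖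
      = Real.exp (T * (r ^ 2 - y ^ 2) - τ * r) := by
  rw [Complex.norm_exp]
  congr 1
  simp [sq]

/-- A Gaussian integral over a vertical line. -/
theorem integral_mul_cexp_line {T : ℝ} (hT : 0 < T) (r τ : ℝ) :
    ∫ y : ℝ, (r + y * Complex.I : ℂ) *
        Complex.exp (T * (r + y * Complex.I) ^ 2 - τ * (r + y * Complex.I))
      = τ / (2 * T) * ((Real.pi / T : ℂ) ^ (1 / 2 : ℂ) * Complex.exp (-(τ ^ 2 / (4 * T)))) := by
  have hT' : (T : ℂ) ≠ 0 := by exact_mod_cast hT.ne'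
  set e : ℝ → ℂ := fun y =>
    Complex.exp (T * (r + y * Complex.I) ^ 2 - τ * (r + y * Complex.I)) with he
  have he1 : e = fun y : ℝ => Complex.exp ((-T : ℂ) * y ^ 2 + (Complex.I * (2 * T * r - τ)) * y
      + (T * r ^ 2 - τ * r)) := by
    funext y
    simp only [he]
    congr 1
    linear_combination (T * (y : ℂ) ^ 2) * Complex.I_sq
  have hre : (-T : ℂ).re < 0 := by simpa
  have hi : Integrable e := he1 ▸ integrable_cexp_quadratic' hre _ _
  have hval : ∫ y, e y = (Real.pi / T : ℂ) ^ (1 / 2 : ℂ) * Complex.exp (-(τ ^ 2 / (4 * T))) := by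
    rw [he1, integral_cexp_quadratic hre, neg_neg]
    congr 2
    field_simp
    linear_combination ((2 * T * r - τ : ℂ) ^ 2) * Complex.I_sq
  have hi2 : Integrable fun y : ℝ => (r + y * Complex.I : ℂ) * e y := by
    refine (integrable_mul_cexp_line hT r τ).mono' (Continuous.aestronglyMeasurable (by fun_prop))
      (ae_of_all _ fun y => ?_)
    rw [norm_mul, norm_cexp_line]
  have hd : ∀ y : ℝ, HasDerivAt e (2 * T * Complex.I * ((r + y * Complex.I : ℂ) * e y)
      - Complex.I * τ * e y) y := by
    intro y
    have h1 : HasDerivAt (fun y : ℝ => (r + y * Complex.I : ℂ)) Complex.I y := by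
      simpa using ((Complex.ofRealCLM.hasDerivAt (x := y)).mul_const Complex.I).const_add (r : ℂ)
    have h2 := (((h1.fun_pow 2).const_mul (T : ℂ)).fun_sub (h1.const_mul (τ : ℂ))).cexp
    refine h2.congr_deriv ?_
    simp only [he]
    push_cast
    simp
    ring
  -- The integral of `e'` vanishes, which expresses the first moment through the Gaussian integral
  -- of `e`.
  have h0 := integral_eq_zero_of_hasDerivAt_of_integrable hd
    ((hi2.const_mul _).sub (hi.const_mul _)) hi
  rw [integral_sub (hi2.const_mul _) (hi.const_mul _), integral_const_mul, integral_const_mul,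
    hval] at h0
  have h1 : Complex.I * (2 * T * ∫ y : ℝ, (r + y * Complex.I : ℂ) * e y)
      = Complex.I * (τ * ((Real.pi / T : ℂ) ^ (1 / 2 : ℂ) * Complex.exp (-(τ ^ 2 / (4 * T))))) := by
    linear_combination h0
  have h2 := mul_left_cancel₀ Complex.I_ne_zero h1
  rw [div_mul_eq_mul_div, eq_div_iff (mul_ne_zero two_ne_zero hT')]
  linear_combination h2

/-- `phi n c T` as an inverse Laplace transform. -/
theorem integral_cexp_mul_inv_pow {T r : ℝ} (hT : 0 < T) (hr : 0 < r) (c : ℝ) (n : ℕ) :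
    ∫ y : ℝ, Complex.exp (T * (r + y * Complex.I) ^ 2 - c * (r + y * Complex.I)) *
        ((r + y * Complex.I : ℂ) ^ (n + 1))⁻¹ = Real.pi * phi n c T := by
  have hu : ∀ y : ℝ, 0 < (r + y * Complex.I : ℂ).re := fun y => by simpa
  have hu0 : ∀ y : ℝ, (r + y * Complex.I : ℂ) ≠ 0 := fun y h => by
    have := hu y; rw [h] at this; simp at this
  have hf : ((n + 1).factorial : ℂ) ≠ 0 := by exact_mod_cast Nat.factorial_ne_zero _
  -- With `u = r + iy`, the Laplace transform of `(τ - c)^{n+1}` is one power of `1/u` more than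
  -- required. The compensating factor `u` becomes `τ / (2T)` after the Gaussian integration; this
  -- is the factor `τ` in `phi`.
  have hpt : ∀ y : ℝ, Complex.exp (T * (r + y * Complex.I) ^ 2 - c * (r + y * Complex.I)) *
        ((r + y * Complex.I : ℂ) ^ (n + 1))⁻¹
      = ∫ τ in Ioi c, ((τ : ℂ) - c) ^ (n + 1) / (n + 1).factorial *
        ((r + y * Complex.I : ℂ) *
          Complex.exp (T * (r + y * Complex.I) ^ 2 - τ * (r + y * Complex.I))) := by
    intro y
    have h1 := integral_sub_pow_mul_cexp_neg (hu y) c (n + 1)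
    have h2 : ∀ τ : ℝ, ((τ : ℂ) - c) ^ (n + 1) / (n + 1).factorial *
        ((r + y * Complex.I : ℂ) *
          Complex.exp (T * (r + y * Complex.I) ^ 2 - τ * (r + y * Complex.I)))
        = ((r + y * Complex.I : ℂ) * Complex.exp (T * (r + y * Complex.I) ^ 2)
            / (n + 1).factorial) *
          (((τ : ℂ) - c) ^ (n + 1) * Complex.exp (-((r + y * Complex.I) * τ))) := by
      intro τ
      rw [sub_eq_add_neg (_ * _), Complex.exp_add, mul_comm (τ : ℂ)]
      ring
    simp only [h2]
    rw [integral_const_mul, h1, sub_eq_add_neg, Complex.exp_add, mul_comm (c : ℂ)]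
    have := hu0 y
    field_simp
    ring
  simp only [hpt]
  rw [integral_integral_swap]
  · simp only [integral_const_mul, integral_mul_cexp_line hT]
    rw [phi, ← integral_const_mul, ← integral_const_mul]
    refine setIntegral_congr_fun measurableSet_Ioi fun τ _ => ?_
    have hs : ((Real.pi / T : ℂ) ^ (1 / 2 : ℂ)) = √Real.pi / √T := by
      rw [← Complex.ofReal_div, show (1 / 2 : ℂ) = ((1 / 2 : ℝ) : ℂ) by push_cast; rfl,
        ← Complex.ofReal_cpow (by positivity), ← Real.sqrt_eq_rpow, Real.sqrt_div Real.pi_pos.le]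
      push_cast; rfl
    have hT2 : (T : ℂ) ^ (-(3 / 2) : ℂ) = 1 / (T * √T) := by
      rw [show (-(3 / 2) : ℂ) = ((-(3 / 2) : ℝ) : ℂ) by push_cast; rfl,
        ← Complex.ofReal_cpow hT.le, Real.rpow_neg hT.le,
        show (3 / 2 : ℝ) = 1 + 1 / 2 by norm_num, Real.rpow_add hT, Real.rpow_one,
        ← Real.sqrt_eq_rpow]
      push_cast
      rw [one_div]
    have hpi : (Real.pi : ℂ) = √Real.pi * √Real.pi := by
      rw [← Complex.ofReal_mul, Real.mul_self_sqrt Real.pi_pos.le]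
    have h1 : (√Real.pi : ℂ) ≠ 0 := by exact_mod_cast (Real.sqrt_pos.2 Real.pi_pos).ne'
    have h2 : (√T : ℂ) ≠ 0 := by exact_mod_cast (Real.sqrt_pos.2 hT).ne'
    have h3 : (T : ℂ) ≠ 0 := by exact_mod_cast hT.ne'
    rw [hs, hT2, hpi]
    field_simp
  · have i1 : IntegrableOn (fun τ : ℝ => (τ - c) ^ (n + 1) / (n + 1).factorial
        * Real.exp (-(r * τ))) (Ioi c) := by
      have h := integrableOn_pow_mul_exp_neg hr (n + 1)
      have h' : IntegrableOn (fun τ : ℝ => (τ - c) ^ (n + 1) * Real.exp (-(r * τ))) (Ioi c) := by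
        refine integrableOn_Ioi_of_comp_add
          ((h.mul_const (Real.exp (-(r * c)))).congr (ae_of_all _ fun t => ?_))
        simp only [add_sub_cancel_right, mul_assoc, ← Real.exp_add]
        ring_nf
      refine (h'.div_const ((n + 1).factorial : ℝ)).congr (ae_of_all _ fun t => ?_)
      simp only; ring
    have i2 := (integrable_mul_cexp_line hT r 0).mul_prod i1
    refine i2.mono' (Continuous.aestronglyMeasurable (by
      simp only [Function.uncurry_def]; fun_prop)) ?_
    have : ∀ᵐ q : ℝ × ℝ ∂(volume.prod (volume.restrict (Ioi c))), q.2 ∈ Ioi c := by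
      have h := (Measure.quasiMeasurePreserving_snd (μ := (volume : Measure ℝ))
        (ν := volume.restrict (Ioi c))).ae (ae_restrict_mem measurableSet_Ioi)
      exact h
    filter_upwards [this] with q hq
    have hq' : c < q.2 := hq
    simp only [Function.uncurry]
    rw [norm_mul, norm_mul, norm_cexp_line, norm_div, norm_pow, ← Complex.ofReal_sub,
      Complex.norm_real, Real.norm_of_nonneg (by linarith), Complex.norm_natCast]
    have : Real.exp (T * (r ^ 2 - q.1 ^ 2) - q.2 * r)
        = Real.exp (T * (r ^ 2 - q.1 ^ 2) - 0 * r) * Real.exp (-(r * q.2)) := by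
      rw [← Real.exp_add]; ring_nf
    rw [this]
    apply le_of_eq
    ring

/-- A vertical integral of a function that decays to the left is a residue. -/
theorem integral_vertical_eq_of_left {f : ℂ → ℂ} {a C : ℝ} {J : ℂ} (ha : 0 < a)
    (hf : ∀ z : ℂ, z ≠ 0 → ContinuousAt f z)
    (hb : ∀ z : ℂ, z.re ≤ a → min a 1 ≤ ‖z‖ → ‖f z‖ ≤ C / (z.re ^ 2 + z.im ^ 2))
    (hJ : ∀ b Y : ℝ, b < 0 → 0 < Y → rectInt f b a Y = J) :
    Complex.I * ∫ y : ℝ, f (a + y * Complex.I) = J := by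
  have hC : 0 ≤ C := by
    have h := (norm_nonneg _).trans (hb a (by simp) (by simp [abs_of_pos ha]))
    simp only [Complex.ofReal_re, Complex.ofReal_im] at h
    by_contra hC
    have := div_neg_of_neg_of_pos (not_le.1 hC) (show 0 < a ^ 2 + 0 ^ 2 by positivity)
    linarith
  have hcont : ∀ x : ℝ, x ≠ 0 → Continuous fun y : ℝ => f (x + y * Complex.I) := fun x hx =>
    continuous_iff_continuousAt.2 fun y => ContinuousAt.comp
      (f := fun y : ℝ => (x + y * Complex.I : ℂ)) (hf _ fun h => hx (by
        have := congrArg Complex.re h; simpa using this)) (by fun_prop)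
  set m := min (a ^ 2) 1
  have hm : 0 < m := by positivity
  have h1 : m ≤ a ^ 2 := min_le_left _ _
  have h2 : m ≤ 1 := min_le_right _ _
  have hconst : ∀ x : ℝ, 1 ≤ x → Complex.I * (∫ y : ℝ, f (a + y * Complex.I))
      - J = Complex.I * ∫ y : ℝ, f ((-x : ℝ) + y * Complex.I) := by
    intro x hx
    have := vertical_shift (f := f) (C := 2 * C / m) (J := J) (a := -x) (b := a) (by linarith)
      (fun Y hY => hJ _ Y (by linarith) hY) (hcont _ (by linarith)) (hcont a ha.ne')
      (fun z h3 h4 h5 => ?_)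
    · rw [← this]; ring
    · have hpos : m * (1 + z.im ^ 2) ≤ 2 * (z.re ^ 2 + z.im ^ 2) := by
        rcases h5 with h5 | h5 | h5
        · rw [h5]; nlinarith [sq_nonneg z.im]
        · rw [h5]; nlinarith [sq_nonneg z.im]
        · have : 1 ≤ z.im ^ 2 := by rw [← sq_abs]; nlinarith
          nlinarith [sq_nonneg z.re]
      have hpos2 : 0 < m * (1 + z.im ^ 2) := by positivity
      -- The bound is assumed only away from the singularity at `0`; both vertical lines and the
      -- region `|Im z| ≥ 1` keep that distance.
      have hz0 : min a 1 ≤ ‖z‖ := by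
        rcases h5 with h5 | h5 | h5
        · refine (min_le_right a 1).trans (le_trans ?_ (Complex.abs_re_le_norm z))
          rw [h5, abs_neg]; exact hx.trans (le_abs_self x)
        · refine (min_le_left a 1).trans (le_trans ?_ (Complex.abs_re_le_norm z))
          rw [h5]; exact le_abs_self a
        · exact (min_le_right a 1).trans (h5.trans (Complex.abs_im_le_norm z))
      refine (hb z h4 hz0).trans ?_
      rw [div_div, div_le_div_iff₀ (by linarith) hpos2]
      nlinarith
  have hlim : Tendsto (fun x : ℝ => ∫ y : ℝ, f ((-x : ℝ) + y * Complex.I)) atTop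
      (𝓝 (∫ _ : ℝ, (0 : ℂ))) := by
    have hbx : ∀ x : ℝ, 1 ≤ x → ∀ y : ℝ,
        ‖f ((-x : ℝ) + y * Complex.I)‖ ≤ C / (x ^ 2 + y ^ 2) := fun x hx y => by
      have := hb ((-x : ℝ) + y * Complex.I) (by simp; linarith) (by
        refine (min_le_right a 1).trans (le_trans ?_ (Complex.abs_re_le_norm _))
        simpa using hx.trans (le_abs_self x))
      simpa using this
    refine tendsto_integral_filter_of_dominated_convergence (fun y => C * (1 + y ^ 2)⁻¹)
      ?_ ?_ (integrable_inv_one_add_sq.const_mul _) (ae_of_all _ fun y => ?_)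
    · filter_upwards [eventually_ge_atTop 1] with x hx
      exact (hcont _ (by linarith)).aestronglyMeasurable
    · filter_upwards [eventually_ge_atTop 1] with x hx
      refine ae_of_all _ fun y => (hbx x hx y).trans ?_
      rw [← div_eq_mul_inv]
      gcongr
      nlinarith
    · have h1 : Tendsto (fun b : ℝ => C / (b ^ 2 + y ^ 2)) atTop (𝓝 0) :=
        tendsto_const_nhds.div_atTop
          (tendsto_atTop_add_const_right _ _ (tendsto_pow_atTop two_ne_zero))
      refine squeeze_zero_norm' ?_ h1
      filter_upwards [eventually_ge_atTop 1] with x hx using hbx x hx y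
  have h3 := hlim.const_mul Complex.I
  simp only [integral_zero, mul_zero] at h3
  have h4 : Tendsto (fun _ : ℝ => Complex.I * (∫ y : ℝ, f (a + y * Complex.I)) - J) atTop (𝓝 0) := by
    refine h3.congr' ?_
    filter_upwards [eventually_ge_atTop 1] with x hx using (hconst x hx).symm
  exact sub_eq_zero.1 (tendsto_nhds_unique tendsto_const_nhds h4)

theorem coeff_tay_cexp_mul (τ : ℂ) (n : ℕ) :
    PowerSeries.coeff n (tay fun v => Complex.exp (τ * v)) = τ ^ n / n.factorial := by
  rw [coeff_tay, iteratedDeriv_cexp_const_mul]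
  simp

/-- `τⁿ / n!` as an inverse Laplace transform. -/
theorem integral_cexp_mul_inv_pow_linear {τ r : ℝ} (hτ : 0 ≤ τ) (hr : 0 < r) (n : ℕ) :
    ∫ y : ℝ, Complex.exp (τ * (r + y * Complex.I)) * ((r + y * Complex.I : ℂ) ^ (n + 2))⁻¹
      = 2 * Real.pi * (τ ^ (n + 1) / (n + 1).factorial) := by
  set f : ℂ → ℂ := fun z => Complex.exp (τ * z) * (z ^ (n + 2))⁻¹ with hf
  set m := min r 1
  have hm : 0 < m := by positivity
  -- As `τ ≥ 0`, `e^{τz}` is bounded to the left of the line. Two powers of `1/z` give the decay,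
  -- the other `n` are bounded by `m^{-n}`, and the residue at `0` is a Taylor coefficient of
  -- `e^{τz}`.
  have h := integral_vertical_eq_of_left (f := f) (C := Real.exp (τ * r) / m ^ n)
    (J := 2 * Real.pi * Complex.I * (τ ^ (n + 1) / (n + 1).factorial)) hr ?_ ?_ ?_
  · refine mul_left_cancel₀ Complex.I_ne_zero (h.trans ?_)
    ring
  · intro z hz
    exact ContinuousAt.mul (by fun_prop) (ContinuousAt.inv₀ (by fun_prop) (pow_ne_zero _ hz))
  · intro z h1 h2
    have hz : 0 < ‖z‖ := hm.trans_le h2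
    have h3 : z.re ^ 2 + z.im ^ 2 = ‖z‖ ^ 2 := by
      rw [Complex.sq_norm, Complex.normSq_apply]; ring
    rw [hf, h3]
    simp only
    rw [norm_mul, Complex.norm_exp, norm_inv, norm_pow, ← div_eq_mul_inv, div_div]
    have h4 : (τ * z).re ≤ τ * r := by
      simp
      exact mul_le_mul_of_nonneg_left h1 hτ
    rw [pow_add]
    gcongr
  · intro b Y hb hY
    have := rectInt_pole (ρ := 0) hb hr hY (H := fun z => Complex.exp (τ * z))
      (fun z _ _ => by fun_prop) (by fun_prop) (n + 1)
    simp only [Complex.ofReal_zero, sub_zero, zero_add] at this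
    rw [coeff_tay_cexp_mul] at this
    rw [← this]
    simp only [hf, mul_comm]

end HyperExp

namespace HyperExp

/-! ### Series of functions on the right half-plane -/

/-- Weierstrass' theorem for a series of analytic functions and all its derivatives. -/
theorem tendstoLocallyUniformlyOn_iteratedDeriv {U : Set ℂ} (hU : IsOpen U) {f : ℕ → ℂ → ℂ}
    (hf : ∀ n, DifferentiableOn ℂ (f n) U)
    (hb : ∀ Q, IsCompact Q → Q ⊆ U → ∃ u : ℕ → ℝ, Summable u ∧ ∀ n, ∀ z ∈ Q, ‖f n z‖ ≤ u n)
    (j : ℕ) :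
    TendstoLocallyUniformlyOn (fun (m : ℕ) z => ∑ n ∈ Finset.range m, iteratedDeriv j (f n) z)
      (iteratedDeriv j fun z => ∑' n, f n z) atTop U := by
  have hdiff : ∀ j n, DifferentiableOn ℂ (iteratedDeriv j (f n)) U := by
    intro j n
    induction j with
    | zero => simpa using hf n
    | succ j ih => rw [iteratedDeriv_succ]; exact ih.deriv hU
  induction j with
  | zero =>
    rw [tendstoLocallyUniformlyOn_iff_forall_isCompact hU]
    intro Q hQU hQ
    obtain ⟨u, hu, h⟩ := hb Q hQ hQU
    simpa using tendstoUniformlyOn_tsum_nat hu h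
  | succ j ih =>
    have h := ih.deriv (Eventually.of_forall fun m =>
      DifferentiableOn.fun_sum fun n _ => hdiff j n) hU
    rw [iteratedDeriv_succ]
    refine h.congr fun m z hz => ?_
    simp only [Function.comp]
    rw [deriv_fun_sum fun n _ => (hdiff j n).differentiableAt (hU.mem_nhds hz)]
    simp [iteratedDeriv_succ]

/-- The geometric bound on the coefficients yields the convergence of the price series, the
expansion itself the termwise integration. -/
theorem exists_hasSum_tay {F : ℂ → ℂ} (hF : AnalyticAt ℂ F 0) :
    ∃ r > 0, ∃ A, (∀ n, ‖PowerSeries.coeff n (tay F)‖ ≤ A * (1 / r) ^ n) ∧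
      ∀ s : ℂ, ‖s‖ < r → HasSum (fun n => PowerSeries.coeff n (tay F) * s ^ n) (F s) := by
  obtain ⟨R, hR⟩ := hF.hasFPowerSeriesAt
  obtain ⟨r, hr0, hrR⟩ := ENNReal.lt_iff_exists_nnreal_btwn.1 hR.r_pos
  have hr : 0 < (r : ℝ) := by exact_mod_cast hr0
  obtain ⟨A, -, hA⟩ := FormalMultilinearSeries.norm_mul_pow_le_of_lt_radius _
    (hrR.trans_le hR.r_le)
  refine ⟨r, hr, A, fun n => ?_, fun s hs => ?_⟩
  · have := hA n
    rw [FormalMultilinearSeries.ofScalars_norm, ← coeff_tay] at this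
    rw [div_pow, one_pow, mul_one_div, le_div_iff₀ (by positivity)]
    exact this
  · have h := hR.hasSum (y := s) (by
      rw [Metric.mem_eball, edist_zero_right]
      refine lt_trans ?_ hrR
      rw [enorm_lt_coe]
      exact_mod_cast hs)
    rw [zero_add] at h
    simpa only [FormalMultilinearSeries.ofScalars_apply_eq, ← coeff_tay, smul_eq_mul] using h

theorem half_plane_isOpen : IsOpen {z : ℂ | 0 < z.re} :=
  isOpen_lt continuous_const Complex.continuous_re

theorem integrableOn_pow_mul_exp_neg_sq {δ : ℝ} (hδ : 0 < δ) (m : ℕ) :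
    IntegrableOn (fun τ : ℝ => τ ^ m * Real.exp (-δ * τ ^ 2)) (Ioi 0) := by
  have h := integrable_rpow_mul_exp_neg_mul_sq hδ (s := m)
    (by have : (0 : ℝ) ≤ m := m.cast_nonneg
        linarith)
  simpa using h.integrableOn

theorem norm_cexp_neg_sq_le {w : ℂ} {δ : ℝ} (h : δ ≤ w.re) (τ : ℝ) :
    ‖Complex.exp (-((τ : ℂ) ^ 2 * w))‖ ≤ Real.exp (-δ * τ ^ 2) := by
  rw [Complex.norm_exp, Real.exp_le_exp, ← Complex.ofReal_pow, Complex.neg_re,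
    Complex.re_ofReal_mul]
  nlinarith [sq_nonneg τ]

theorem norm_mul_sub_pow_le {c τ : ℝ} (hc : 0 ≤ c) (hτ : c < τ) (n : ℕ) :
    ‖(τ : ℂ) * ((τ : ℂ) - c) ^ (n + 1)‖ ≤ τ ^ (n + 2) := by
  have h0 : 0 ≤ τ - c := by linarith
  have h1 : 0 ≤ τ := by linarith
  rw [← Complex.ofReal_sub, norm_mul, norm_pow, Complex.norm_real, Complex.norm_real,
    Real.norm_of_nonneg h0, Real.norm_of_nonneg h1, pow_succ' τ (n + 1)]
  gcongr
  linarith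

/-- The integral in the definition of `phi`, as a function of `w = 1 / (4z)`. -/
theorem differentiableAt_phi_integral {c : ℝ} (hc : 0 ≤ c) (n : ℕ) {w₀ : ℂ} (hw : 0 < w₀.re) :
    DifferentiableAt ℂ (fun w : ℂ => ∫ τ in Ioi c, Complex.exp (-((τ : ℂ) ^ 2 * w)) *
      ((τ : ℂ) * ((τ : ℂ) - c) ^ (n + 1))) w₀ := by
  set δ := w₀.re / 2
  have hδ : 0 < δ := by positivity
  have hs : {w : ℂ | δ < w.re} ∈ 𝓝 w₀ :=
    (isOpen_lt continuous_const Complex.continuous_re).mem_nhds (by simp [δ]; linarith)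
  have hsub : Ioi c ⊆ Ioi 0 := Ioi_subset_Ioi hc
  refine (hasDerivAt_integral_of_dominated_loc_of_deriv_le
    (F' := fun w τ => (-(τ : ℂ) ^ 2 * Complex.exp (-((τ : ℂ) ^ 2 * w))) *
      ((τ : ℂ) * ((τ : ℂ) - c) ^ (n + 1)))
    (bound := fun τ => τ ^ (n + 4) * Real.exp (-δ * τ ^ 2)) hs ?_ ?_ ?_ ?_ ?_ ?_).2.differentiableAt
  · exact Eventually.of_forall fun w => Continuous.aestronglyMeasurable (by fun_prop)
  · refine ((integrableOn_pow_mul_exp_neg_sq hδ (n + 2)).mono_set hsub).mono'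
      (Continuous.aestronglyMeasurable (by fun_prop))
      ((ae_restrict_iff' measurableSet_Ioi).2 (ae_of_all _ fun τ hτ => ?_))
    rw [norm_mul, mul_comm]
    have h1 : 0 ≤ τ := hc.trans (le_of_lt hτ)
    exact mul_le_mul (norm_mul_sub_pow_le hc hτ n)
      (norm_cexp_neg_sq_le (by simp only [δ]; linarith) τ) (norm_nonneg _) (by positivity)
  · exact Continuous.aestronglyMeasurable (by fun_prop)
  · refine (ae_restrict_iff' measurableSet_Ioi).2 (ae_of_all _ fun τ hτ w hw => ?_)
    have h1 : 0 ≤ τ := hc.trans (le_of_lt hτ)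
    have h2 := norm_mul_sub_pow_le hc hτ n
    have h3 := norm_cexp_neg_sq_le (le_of_lt hw) τ
    rw [norm_mul, norm_mul, norm_neg, norm_pow, Complex.norm_real, Real.norm_of_nonneg h1]
    calc τ ^ 2 * ‖Complex.exp (-((τ : ℂ) ^ 2 * w))‖ * ‖(τ : ℂ) * ((τ : ℂ) - c) ^ (n + 1)‖
        ≤ τ ^ 2 * Real.exp (-δ * τ ^ 2) * τ ^ (n + 2) := by gcongr
      _ = _ := by ring
  · exact (integrableOn_pow_mul_exp_neg_sq hδ (n + 4)).mono_set hsub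
  · refine ae_of_all _ fun τ w _ => ?_
    have h1 : HasDerivAt (fun w : ℂ => -((τ : ℂ) ^ 2 * w)) (-(τ : ℂ) ^ 2) w := by
      simpa using ((hasDerivAt_id w).const_mul ((τ : ℂ) ^ 2)).fun_neg
    exact (h1.cexp.mul_const _).congr_deriv (by ring)

theorem phi_eq (n : ℕ) (c : ℝ) (z : ℂ) :
    phi n c z = z ^ (-(3 / 2) : ℂ) / (2 * (√Real.pi : ℂ) * ((n + 1).factorial : ℂ)) *
      ∫ τ in Ioi c, Complex.exp (-((τ : ℂ) ^ 2 * (1 / (4 * z)))) *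
        ((τ : ℂ) * ((τ : ℂ) - c) ^ (n + 1)) := by
  rw [phi]
  congr 1
  refine integral_congr_ae (ae_of_all _ fun τ => ?_)
  simp only [mul_assoc, mul_one_div]

theorem re_one_div_pos {z : ℂ} (hz : 0 < z.re) : 0 < (1 / (4 * z)).re := by
  have h0 : z ≠ 0 := fun h => by simp [h] at hz
  have : (1 / (4 * z)).re = z.re / (4 * Complex.normSq z) := by
    rw [one_div, mul_inv, Complex.mul_re, Complex.inv_re, Complex.inv_re]
    simp
    field_simp
  rw [this]
  have := Complex.normSq_pos.2 h0
  positivity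

theorem differentiableAt_phi {c : ℝ} (hc : 0 ≤ c) (n : ℕ) {z : ℂ} (hz : 0 < z.re) :
    DifferentiableAt ℂ (phi n c) z := by
  have h0 : z ≠ 0 := fun h => by simp [h] at hz
  rw [funext (phi_eq n c)]
  refine DifferentiableAt.fun_mul ?_ ?_
  · exact (DifferentiableAt.cpow (by fun_prop) (by fun_prop) (Or.inl hz)).div_const _
  · exact DifferentiableAt.fun_comp' z
      (g := fun w : ℂ => ∫ τ in Ioi c, Complex.exp (-((τ : ℂ) ^ 2 * w)) *
        ((τ : ℂ) * ((τ : ℂ) - c) ^ (n + 1)))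
      (differentiableAt_phi_integral hc n (re_one_div_pos hz))
      (DifferentiableAt.fun_div (by fun_prop) (by fun_prop) (by simpa))

/-- Completing the square, `-δτ² ≤ B²/(4δ) - Bτ`, trades the Gaussian for an exponential of
arbitrary rate `B`. The resulting `(n+2)!` nearly cancels against `(n+1)!`, so `phi n` decays faster
than every geometric sequence. -/
theorem norm_phi_le {c δ B : ℝ} (hc : 0 ≤ c) (hδ : 0 < δ) (hB : 0 < B) (n : ℕ) {z : ℂ}
    (hz : δ ≤ (1 / (4 * z)).re) :
    ‖phi n c z‖ ≤ ‖z ^ (-(3 / 2) : ℂ)‖ / (2 * √Real.pi) *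
      (Real.exp (B ^ 2 / (4 * δ)) * ((n + 2) / B ^ (n + 3))) := by
  have hval : ∫ t in Ioi (0 : ℝ), t ^ (n + 2) * Real.exp (-(B * t))
      = (n + 2).factorial / B ^ (n + 3) := by
    have := integral_pow_mul_cexp_neg (u := B) (by simpa) (n + 2)
    have h2 : ∫ t in Ioi (0 : ℝ), (t : ℂ) ^ (n + 2) * Complex.exp (-(B * t))
        = ((∫ t in Ioi (0 : ℝ), t ^ (n + 2) * Real.exp (-(B * t)) : ℝ) : ℂ) := by
      rw [← integral_complex_ofReal]; push_cast; rfl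
    rw [h2] at this
    exact_mod_cast this
  have hI := integrableOn_pow_mul_exp_neg hB (n + 2)
  have hI' : IntegrableOn (fun t : ℝ => Real.exp (B ^ 2 / (4 * δ)) *
      (t ^ (n + 2) * Real.exp (-(B * t)))) (Ioi 0) := hI.const_mul _
  have hexp : ∀ τ : ℝ, Real.exp (-δ * τ ^ 2) ≤ Real.exp (B ^ 2 / (4 * δ)) * Real.exp (-(B * τ)) := by
    intro τ
    rw [← Real.exp_add, Real.exp_le_exp]
    have : B ^ 2 / (4 * δ) + -(B * τ) - -δ * τ ^ 2 = (2 * δ * τ - B) ^ 2 / (4 * δ) := by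
      field_simp; ring
    have h2 : 0 ≤ (2 * δ * τ - B) ^ 2 / (4 * δ) := by positivity
    linarith
  have hint : ‖∫ τ in Ioi c, Complex.exp (-((τ : ℂ) ^ 2 * (1 / (4 * z)))) *
        ((τ : ℂ) * ((τ : ℂ) - c) ^ (n + 1))‖
      ≤ Real.exp (B ^ 2 / (4 * δ)) * ((n + 2).factorial / B ^ (n + 3)) := by
    rw [← hval, ← integral_const_mul]
    refine (norm_integral_le_of_norm_le (hI'.mono_set (Ioi_subset_Ioi hc))
      ((ae_restrict_iff' measurableSet_Ioi).2 (ae_of_all _ fun τ hτ => ?_))).trans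
      (setIntegral_mono_set hI' ?_ (Ioi_subset_Ioi hc).eventuallyLE)
    · have h1 : 0 ≤ τ := hc.trans (le_of_lt hτ)
      rw [norm_mul]
      calc _ ≤ Real.exp (-δ * τ ^ 2) * τ ^ (n + 2) :=
            mul_le_mul (norm_cexp_neg_sq_le hz τ) (norm_mul_sub_pow_le hc hτ n)
              (norm_nonneg _) (Real.exp_pos _).le
        _ ≤ (Real.exp (B ^ 2 / (4 * δ)) * Real.exp (-(B * τ))) * τ ^ (n + 2) := by
            gcongr; exact hexp τ
        _ = _ := by ring
    · refine (ae_restrict_iff' measurableSet_Ioi).2 (ae_of_all _ fun τ hτ => ?_)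
      have h1 : 0 < τ := hτ
      simp only [Pi.zero_apply]
      positivity
  have hfac : ((n + 2).factorial : ℝ) = (n + 2) * (n + 1).factorial := by
    rw [Nat.factorial_succ]; push_cast; ring
  have hfp : (0 : ℝ) < (n + 1).factorial := by exact_mod_cast Nat.factorial_pos _
  have hsp : 0 < √Real.pi := Real.sqrt_pos.2 Real.pi_pos
  rw [phi_eq, norm_mul, norm_div, norm_mul, norm_mul, Complex.norm_natCast, Complex.norm_real,
    Real.norm_of_nonneg hsp.le, Complex.norm_ofNat]
  calc _ ≤ ‖z ^ (-(3 / 2) : ℂ)‖ / (2 * √Real.pi * (n + 1).factorial) *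
        (Real.exp (B ^ 2 / (4 * δ)) * ((n + 2).factorial / B ^ (n + 3))) := by gcongr
    _ = _ := by rw [hfac]; field_simp

/-- On a compact set `Re (1/(4z))` has a positive minimum, and the rate `2R` in `norm_phi_le` beats
the growth `Rⁿ` by the factor `2⁻ⁿ`. -/
theorem exists_summable_bound_phi {d : ℕ → ℂ} {A R c : ℝ} (hR : 0 < R)
    (hd : ∀ n, ‖d n‖ ≤ A * R ^ n) (hc : 0 ≤ c) {Q : Set ℂ} (hQ : IsCompact Q)
    (hQU : Q ⊆ {z : ℂ | 0 < z.re}) :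
    ∃ u : ℕ → ℝ, Summable u ∧ ∀ n, ∀ z ∈ Q, ‖d n * phi (n + 1) c z‖ ≤ u n := by
  rcases Q.eq_empty_or_nonempty with rfl | hne
  · exact ⟨0, summable_zero, by simp⟩
  have hz0 : ∀ z ∈ Q, z ≠ 0 := fun z hz h => by
    have := hQU hz; simp [h] at this
  have hc1 : ContinuousOn (fun z : ℂ => z ^ (-(3 / 2) : ℂ)) Q := fun z hz =>
    (ContinuousAt.cpow (by fun_prop) (by fun_prop) (Or.inl (hQU hz))).continuousWithinAt
  have hc2 : ContinuousOn (fun z : ℂ => (1 / (4 * z)).re) Q :=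
    Complex.continuous_re.comp_continuousOn
      (ContinuousOn.div (by fun_prop) (by fun_prop) fun z hz => by simpa using hz0 z hz)
  obtain ⟨M, hM⟩ := hQ.exists_bound_of_continuousOn hc1
  obtain ⟨z₀, hz₀, hmin⟩ := hQ.exists_isMinOn hne hc2
  set δ := (1 / (4 * z₀)).re
  have hδ : 0 < δ := re_one_div_pos (hQU hz₀)
  have hA : 0 ≤ A := by simpa using (norm_nonneg _).trans (hd 0)
  set E := Real.exp ((2 * R) ^ 2 / (4 * δ))
  set D := M / (2 * √Real.pi) * E / (2 * R) ^ 4 * A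
  refine ⟨fun n => D * ((n + 3) * (1 / 2) ^ n), ?_, fun n z hz => ?_⟩
  · refine Summable.mul_left _ ?_
    simp only [add_mul]
    refine Summable.add ?_ ((summable_geometric_of_lt_one (by norm_num) (by norm_num)).mul_left _)
    simpa using summable_pow_mul_geometric_of_norm_lt_one 1 (r := (1 / 2 : ℝ))
      (by rw [Real.norm_eq_abs, abs_of_pos] <;> norm_num)
  · have h1 := norm_phi_le hc hδ (show 0 < 2 * R by positivity) (n + 1) (hmin hz)
    have h2 := hM z hz
    rw [norm_mul]
    calc _ ≤ (A * R ^ n) * (M / (2 * √Real.pi) *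
          (E * (((n + 1 : ℕ) + 2) / (2 * R) ^ (n + 1 + 3)))) := by
          refine mul_le_mul (hd n) (h1.trans ?_) (norm_nonneg _) (by positivity)
          gcongr
      _ = _ := by
          simp only [D]
          have : (2 * R) ^ (n + 1 + 3) = (2 * R) ^ 4 * (2 ^ n * R ^ n) := by
            rw [← mul_pow, ← pow_add]; ring_nf
          rw [this]
          have h3 : (1 / 2 : ℝ) ^ n = 1 / 2 ^ n := by rw [div_pow, one_pow]
          rw [h3]
          push_cast
          field_simp
          ring

end HyperExp

namespace HyperExp

/-! ### The expansion of the kernel in terms of `q ∘ ζ_M` -/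

variable {p : Params} {k : ℝ} {κ h : ℂ → ℂ} {κ₀ : ℝ} {ξ : PowerSeries ℝ}

/-- The function represented by `kernelSeries`. -/
noncomputable def kernelFun (k : ℝ) (h : ℂ → ℂ) (s : ℂ) : ℂ :=
  deriv h s * (1 - h s)⁻¹ *
    Complex.exp (Real.log k * -dslope (fun s => (dslope h 0 s)⁻¹) 0 s)

theorem rep_kernelFun (hk : 0 < k) (hξ : Rep ξ h) (h0 : PowerSeries.constantCoeff ξ = 0)
    (h1 : PowerSeries.coeff 1 ξ ≠ 0) : Rep (kernelSeries k ξ) (kernelFun k h) := by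
  have r1 : Rep (sZeta ξ) (fun s => (dslope h 0 s)⁻¹) := by
    refine hξ.shift.inv ?_
    rw [← PowerSeries.coeff_zero_eq_constantCoeff_apply, shift, PowerSeries.coeff_mk]
    exact h1
  have r2 := (hξ.derivative.mul (((Rep.const 1).sub hξ).inv (by simp [h0]))).mul
    (r1.shift.neg.constPow hk)
  rw [map_one, Complex.ofReal_one] at r2
  exact r2

/-- At `s = v / κ v` one has `h s = v`, and `s / h s = 1 / κ v` with value `1 / κ₀` at `0`. The
exponent of `kernelFun` therefore collapses to a difference quotient of `κ`, and the chain rule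
removes `h'`. -/
theorem kernelFun_mul (hκ : AnalyticAt ℂ κ 0) (hκ0 : κ 0 = κ₀) (hpos : 0 < κ₀)
    (hh : AnalyticAt ℂ h 0) (hh0 : h 0 = 0) (hinv : ∀ᶠ v in 𝓝 0, h (v / κ v) = v) :
    ∀ᶠ v in 𝓝 0, κ v ≠ 0 ∧ DifferentiableAt ℂ κ v ∧ (v ≠ 0 →
      kernelFun k h (v / κ v) * deriv (fun v => v / κ v) v
        = Complex.exp (Real.log k / κ₀ * ((κ v - κ₀) / v)) * (1 - v)⁻¹) := by
  have hκne : κ 0 ≠ 0 := by rw [hκ0]; exact_mod_cast hpos.ne'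
  have hκ₀ : (κ₀ : ℂ) ≠ 0 := by exact_mod_cast hpos.ne'
  have hθ : AnalyticAt ℂ (fun v => v / κ v) 0 := analyticAt_fun_id0.div hκ hκne
  have hθ0 : Tendsto (fun v => v / κ v) (𝓝 0) (𝓝 0) := by
    simpa using hθ.continuousAt.tendsto
  have hderiv : ∀ v, h =ᶠ[𝓝 (v / κ v)] h → DifferentiableAt ℂ h (v / κ v) →
      DifferentiableAt ℂ (fun v => v / κ v) v → (∀ᶠ w in 𝓝 v, h (w / κ w) = w) →
      deriv h (v / κ v) * deriv (fun v => v / κ v) v = 1 := by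
    intro v _ h1 h2 h3
    have h4 := (h1.hasDerivAt.comp v h2.hasDerivAt).deriv
    rw [← h4, Function.comp_def, Filter.EventuallyEq.deriv_eq (f := fun w => w) h3, deriv_id'']
  have hd0 : deriv h 0 = κ₀ := by
    have e1 : deriv (fun v => v / κ v) 0 = (κ₀ : ℂ)⁻¹ := by
      have := ((hasDerivAt_id (0 : ℂ)).div hκ.differentiableAt.hasDerivAt hκne).deriv
      rw [show (fun v => v / κ v) = id / κ from rfl, this, id, hκ0]
      field_simp; simp
    have := hderiv 0 EventuallyEq.rfl (by rw [zero_div]; exact hh.differentiableAt)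
      hθ.differentiableAt hinv
    rw [zero_div, e1] at this
    exact (mul_inv_eq_one₀ hκ₀).1 this
  filter_upwards [hκ.eventually_analyticAt, hκ.continuousAt.eventually_ne hκne,
    hθ.eventually_analyticAt, hθ0.eventually hh.eventually_analyticAt,
    hinv.eventually_nhds] with v a1 a2 a3 a4 a5
  refine ⟨a2, a1.differentiableAt, fun hv => ?_⟩
  have hs : v / κ v ≠ 0 := div_ne_zero hv a2
  have hhv : h (v / κ v) = v := a5.self_of_nhds
  have e1 := hderiv v EventuallyEq.rfl a4.differentiableAt a3.differentiableAt a5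
  have e2 : dslope h 0 (v / κ v) = κ v := by
    rw [dslope_of_ne _ hs, slope_def_field, hhv, hh0]
    field_simp; simp [hv]
  have e3 : dslope (fun s => (dslope h 0 s)⁻¹) 0 (v / κ v) = -((κ v - κ₀) / v / κ₀) := by
    rw [dslope_of_ne _ hs, slope_def_field, e2, dslope_same, hd0, sub_zero]
    field_simp; ring
  rw [kernelFun, e3, hhv, neg_neg, show (Real.log k : ℂ) * ((κ v - κ₀) / v / κ₀)
    = Real.log k / κ₀ * ((κ v - κ₀) / v) by ring]
  linear_combination Complex.exp (Real.log k / κ₀ * ((κ v - κ₀) / v)) * (1 - v)⁻¹ * e1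

/-- The change of variables `u = z κ(1/z)` near infinity. The difference `u - κ₀ z` is `dslope κ 0`
at `1/z`, hence bounded: vertical lines are mapped to nearly vertical curves, and the factor by
which `k^{-z}` differs from `k^{-u/κ₀}` is absorbed by the kernel. -/
theorem kernelFun_inv_mul (hκ : AnalyticAt ℂ κ 0) (hκ0 : κ 0 = κ₀) (hpos : 0 < κ₀)
    (hh : AnalyticAt ℂ h 0) (hh0 : h 0 = 0) (hinv : ∀ᶠ v in 𝓝 0, h (v / κ v) = v) :
    ∃ B, ∀ᶠ z in Bornology.cobounded ℂ, ‖z * κ z⁻¹ - κ₀ * z‖ ≤ B ∧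
      ∃ u', HasDerivAt (fun z => z * κ z⁻¹) u' z ∧
        kernelFun k h (z * κ z⁻¹)⁻¹ * ((z * κ z⁻¹) ^ 2)⁻¹ * u'
          = Complex.exp (Real.log k / κ₀ * (z * κ z⁻¹ - κ₀ * z)) * (z * (z - 1))⁻¹ := by
  have hb := ((analyticAt_dslope hκ).continuousAt.norm.eventually_lt_const
    (lt_add_one ‖dslope κ 0 0‖))
  refine ⟨‖dslope κ 0 0‖ + 1, ?_⟩
  filter_upwards [tendsto_inv₀_cobounded.eventually
      (kernelFun_mul (k := k) hκ hκ0 hpos hh hh0 hinv),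
    tendsto_inv₀_cobounded.eventually hb, Bornology.eventually_ne_cobounded (0 : ℂ)] with z h1 h2 hz
  obtain ⟨h3, h4, h5⟩ := h1
  have hv := inv_ne_zero hz
  have e0 : z * κ z⁻¹ - κ₀ * z = dslope κ 0 z⁻¹ := by
    rw [dslope_of_ne _ hv, slope_def_field, hκ0]
    field_simp; simp
  refine ⟨by rw [e0]; exact h2.le, ?_⟩
  set θ := fun v => v / κ v with hθ
  have e1 : (fun z => z * κ z⁻¹) = fun z => (θ z⁻¹)⁻¹ := by
    funext z; simp [hθ, div_eq_mul_inv, mul_comm]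
  have hdθ : HasDerivAt θ (deriv θ z⁻¹) z⁻¹ :=
    (differentiableAt_id.fun_div h4 h3).hasDerivAt
  have hθne : θ z⁻¹ ≠ 0 := div_ne_zero hv h3
  have hd := (hdθ.comp z (hasDerivAt_inv hz)).inv hθne
  refine ⟨_, by rw [e1]; exact hd, ?_⟩
  have e2 : z * κ z⁻¹ = (θ z⁻¹)⁻¹ := congrFun e1 z
  have e3 : z * κ z⁻¹ - κ₀ * z = (κ z⁻¹ - κ₀) / z⁻¹ := by field_simp
  rw [e3, e2, inv_inv]
  have h5 := h5 hv
  have e4 : (z * (z - 1))⁻¹ = (1 - z⁻¹)⁻¹ * (z ^ 2)⁻¹ := by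
    rw [← mul_inv]; congr 1; field_simp
  rw [e4, ← mul_assoc, ← h5]
  change kernelFun k h (θ z⁻¹) * (((θ z⁻¹)⁻¹) ^ 2)⁻¹
    * (-(deriv θ z⁻¹ * -(z ^ 2)⁻¹) / θ z⁻¹ ^ 2) = kernelFun k h (θ z⁻¹) * deriv θ z⁻¹ * (z ^ 2)⁻¹
  generalize θ z⁻¹ = t at hθne ⊢
  rw [inv_pow, inv_inv]
  field_simp

/-- The integral over a line far to the right, expanded in negative powers of `u = q^{1/2}` or
`u = q`. -/
theorem integral_priceKernel_eq_tsum (hκ : AnalyticAt ℂ κ 0) (hκ0 : κ 0 = κ₀) (hpos : 0 < κ₀)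
    (hh : AnalyticAt ℂ h 0) (hh0 : h 0 = 0) (hinv : ∀ᶠ v in 𝓝 0, h (v / κ v) = v)
    (hN : AnalyticAt ℂ (kernelFun k h) 0) {c T : ℝ} (hc : c = Real.log k / κ₀) {q : ℂ → ℂ}
    (hq : Differentiable ℂ q)
    (hqb : ∀ r : ℝ, ∃ C : ℝ, ∀ u : ℂ, 0 ≤ u.re → u.re ≤ r → ‖Complex.exp (q u - c * u)‖ ≤ C)
    (hψ : ∀ᶠ z in Bornology.cobounded ℂ, T * psi p z = q (z * κ z⁻¹)) :
    ∃ R₁ : ℝ, ∀ R ≥ R₁, Integrable (fun y : ℝ => priceKernel p k T (R + y * Complex.I)) →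
      ∃ r > (0 : ℝ), ∫ y : ℝ, priceKernel p k T (R + y * Complex.I)
        = ∑' n, PowerSeries.coeff n (tay (kernelFun k h)) *
          ∫ w : ℝ, Complex.exp (q (r + w * Complex.I) - c * (r + w * Complex.I)) *
            ((r + w * Complex.I : ℂ) ^ (n + 2))⁻¹ := by
  obtain ⟨B, hB⟩ := kernelFun_inv_mul (k := k) hκ hκ0 hpos hh hh0 hinv
  obtain ⟨R₀, -, hR₀⟩ := (hasBasis_cobounded_norm.eventually_iff).1 (hB.and hψ)
  obtain ⟨ρ, hρ, A₀, hA₀, hsum⟩ := exists_hasSum_tay hN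
  obtain ⟨ε, hε, hNε⟩ := Metric.eventually_nhds_iff_ball.1 (hN.eventually_analyticAt.and
    (hN.continuousAt.norm.eventually_lt_const (lt_add_one ‖kernelFun k h 0‖)))
  set N := kernelFun k h
  -- For `Re u > r₁`, the point `1/u` lies both in the disc where the Taylor series of `N` converges
  -- and in the disc where `N` is analytic and bounded.
  set r₁ : ℝ := 1 + ρ⁻¹ + ε⁻¹ with hr₁
  have hB0 : 0 ≤ B := by
    obtain ⟨z, hz⟩ := (hB.and hψ).exists
    exact (norm_nonneg _).trans hz.1.1
  have hr₁1 : 1 < r₁ := by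
    have : 0 < ρ⁻¹ := inv_pos.2 hρ
    have : 0 < ε⁻¹ := inv_pos.2 hε
    linarith
  have hinvlt : ∀ u : ℂ, r₁ < u.re → ‖u⁻¹‖ < ρ ∧ ‖u⁻¹‖ < ε := by
    intro u hu
    have h1 := hu.trans_le (Complex.re_le_norm u)
    have h2 : 0 < ρ⁻¹ := inv_pos.2 hρ
    have h3 : 0 < ε⁻¹ := inv_pos.2 hε
    rw [norm_inv]
    exact ⟨inv_lt_of_inv_lt₀ hρ (by linarith), inv_lt_of_inv_lt₀ hε (by linarith)⟩
  -- `R₀` makes the substitution valid on the line `Re z = R`; the other bound places the strip of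
  -- half-width `B` around `Re u = κ₀ R` to the right of `r₁`.
  refine ⟨max R₀ ((r₁ + B + 1) / κ₀), fun R hR hint => ?_⟩
  have hRR₀ : R₀ ≤ R := (le_max_left _ _).trans hR
  have hr : r₁ + B < κ₀ * R := by
    have := (le_max_right _ _).trans hR
    rw [div_le_iff₀ hpos] at this
    linarith
  set r := κ₀ * R with hrd
  have hr1 : 1 < r := by linarith
  set A : ℂ → ℂ := fun u => Complex.exp (q u - c * u) * (u ^ 2)⁻¹ * N u⁻¹ with hA
  have hne : ∀ u : ℂ, r₁ < u.re → u ≠ 0 := by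
    rintro u hu rfl
    simp at hu; linarith
  have hAd : ∀ u : ℂ, r₁ < u.re → DifferentiableAt ℂ A u := by
    intro u hu
    have h0 := hne u hu
    have h1 : DifferentiableAt ℂ N u⁻¹ :=
      (hNε _ (by simpa using (hinvlt u hu).2)).1.differentiableAt
    have h2 := hq u
    have h3 : DifferentiableAt ℂ (fun u => Complex.exp (q u - c * u)) u := by fun_prop
    have h4 : DifferentiableAt ℂ (fun u : ℂ => (u ^ 2)⁻¹) u :=
      DifferentiableAt.fun_inv (by fun_prop) (pow_ne_zero _ h0)
    exact (h3.fun_mul h4).fun_mul (h1.comp u (differentiableAt_inv h0))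
  obtain ⟨C, hC⟩ := hqb (r + B)
  have hsq : ∀ u : ℂ, 1 ≤ u.re → ‖u ^ 2‖⁻¹ ≤ (1 + u.im ^ 2)⁻¹ := by
    intro u hu
    rw [norm_pow, Complex.sq_norm, Complex.normSq_apply]
    gcongr
    · nlinarith
    · exact (sq _).le
  have hAC : ∀ u : ℂ, |u.re - r| ≤ B → ‖A u‖ ≤ C * (‖N 0‖ + 1) / (1 + u.im ^ 2) := by
    intro u hu
    have h1 := abs_le.1 hu
    have h2 : r₁ < u.re := by linarith
    have h3 := hC u (by linarith) (by linarith)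
    have h4 := (hNε u⁻¹ (by simpa using (hinvlt u h2).2)).2.le
    have h5 := hsq u (by linarith)
    have h6 := (norm_nonneg _).trans h3
    rw [hA]
    simp only [norm_mul, norm_inv]
    calc _ ≤ C * (1 + u.im ^ 2)⁻¹ * (‖N 0‖ + 1) := by gcongr
      _ = _ := by ring
  have hz : ∀ y : ℝ, R₀ ≤ ‖(R + y * Complex.I : ℂ)‖ := fun y =>
    hRR₀.trans (by simpa using Complex.re_le_norm (R + y * Complex.I : ℂ))
  choose u' hu' hker using fun y : ℝ => (hR₀ (hz y)).1.2
  -- As `c = log k / κ₀`, the factor `e^{-cu}` and the exponential from `kernelFun_inv_mul` multiply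
  -- to `k^{-z}`.
  have hval : ∀ y : ℝ, A ((R + y * Complex.I) * κ (R + y * Complex.I)⁻¹) * (u' y * Complex.I)
      = priceKernel p k T (R + y * Complex.I) * Complex.I := by
    intro y
    have h1 := hker y
    have h2 := (hR₀ (hz y)).2
    set z : ℂ := R + y * Complex.I
    set u := z * κ z⁻¹
    have hκ₀ : (κ₀ : ℂ) ≠ 0 := by exact_mod_cast hpos.ne'
    have h3 : A u * u' y = Complex.exp (q u - c * u) * (N u⁻¹ * (u ^ 2)⁻¹ * u' y) := by
      rw [hA]; ring
    rw [← mul_assoc, h3, h1, priceKernel, payoffTransform, h2, ← mul_assoc, ← Complex.exp_add,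
      ← mul_div_assoc, ← Complex.exp_add, div_eq_mul_inv]
    congr 3
    rw [hc]
    push_cast
    field_simp
    ring
  have hline : ∀ y : ℝ, HasDerivAt (fun y : ℝ => (R + y * Complex.I : ℂ)) Complex.I y := fun y => by
    simpa using ((Complex.ofRealCLM.hasDerivAt (x := y)).mul_const Complex.I).const_add (R : ℂ)
  have key := integral_comp_mul_deriv_eq_integral_vertical (A := A)
    (γ := fun y : ℝ => (R + y * Complex.I) * κ (R + y * Complex.I)⁻¹)
    (γ' := fun y => u' y * Complex.I) hpos hr hAd hAC
    (fun y => HasDerivAt.comp_of_eq y (hu' y) (hline y) rfl)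
    (fun y => by
      have := (hR₀ (hz y)).1.1
      convert this using 3
      rw [hrd]; push_cast; ring)
    (by simp_rw [hval]; exact hint.mul_const _)
  simp_rw [hval] at key
  rw [integral_mul_const, mul_comm] at key
  refine ⟨r, by linarith, ?_⟩
  rw [mul_left_cancel₀ Complex.I_ne_zero key]
  have hru : ∀ w : ℝ, (r + w * Complex.I : ℂ).re = r := fun w => by simp
  have hρr : (ρ * r)⁻¹ < 1 := by
    refine inv_lt_one_of_one_lt₀ ?_
    have : ρ⁻¹ < r := by
      have : 0 < ε⁻¹ := inv_pos.2 hε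
      linarith
    rwa [inv_lt_iff_one_lt_mul₀' hρ] at this
  have hr0 : 0 < r := by linarith
  have hA₀0 : 0 ≤ A₀ := by simpa using (norm_nonneg _).trans (hA₀ 0)
  have hC0 : 0 ≤ C := (norm_nonneg _).trans (hC r (by simpa using hr0.le) (by simp [hB0]))
  -- Two of the powers of `1/u` give the integrable `1 / (1 + w²)`; the others combine with the
  -- coefficient bound to a geometric series, of ratio below `1` because `ρ r > 1`.
  set a : ℕ → ℝ := fun n => A₀ * C * ((ρ * r)⁻¹) ^ n with ha
  have hasum : Summable a := (summable_geometric_of_lt_one (by positivity) hρr).mul_left _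
  have hterm := hasSum_integral_of_dominated_convergence (μ := volume)
    (F := fun (n : ℕ) (w : ℝ) => PowerSeries.coeff n (tay N) *
      (Complex.exp (q (r + w * Complex.I) - c * (r + w * Complex.I)) *
        ((r + w * Complex.I : ℂ) ^ (n + 2))⁻¹))
    (f := fun w : ℝ => A (r + w * Complex.I))
    (fun n w => a n * (1 + w ^ 2)⁻¹) (fun n => ?_) (fun n => ?_) ?_ ?_ ?_
  · rw [← hterm.tsum_eq]
    exact tsum_congr fun n => by rw [integral_const_mul]
  · refine (Continuous.aestronglyMeasurable ?_)
    have := hq.continuous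
    refine continuous_const.mul (Continuous.mul (by fun_prop) (Continuous.inv₀ (by fun_prop)
      fun w => pow_ne_zero _ (hne _ ?_)))
    rw [hru]; linarith
  · refine Eventually.of_forall fun w => ?_
    have h1 := hA₀ n
    have h2 := hC (r + w * Complex.I) (by rw [hru]; linarith) (by rw [hru]; linarith)
    have h3 := hsq (r + w * Complex.I) (by rw [hru]; linarith)
    have h4 : ‖(r + w * Complex.I : ℂ) ^ n‖⁻¹ ≤ (r ^ n)⁻¹ := by
      rw [norm_pow]
      have := Complex.re_le_norm (r + w * Complex.I)
      rw [hru] at this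
      gcongr
    have h5 : (r + w * Complex.I : ℂ).im = w := by simp
    rw [h5] at h3
    rw [norm_mul, norm_mul, norm_inv, pow_add, norm_mul, mul_inv]
    calc _ ≤ A₀ * (1 / ρ) ^ n * (C * ((r ^ n)⁻¹ * (1 + w ^ 2)⁻¹)) := by gcongr
      _ = _ := by rw [ha]; simp only [one_div, mul_inv, mul_pow, inv_pow]; ring
  · exact Eventually.of_forall fun w => hasum.mul_right _
  · simp_rw [tsum_mul_right]
    exact integrable_inv_one_add_sq.const_mul _
  · refine Eventually.of_forall fun w => ?_
    have h1 := hsum (r + w * Complex.I)⁻¹ (hinvlt _ (by rw [hru]; linarith)).1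
    have h2 := h1.mul_left (Complex.exp (q (r + w * Complex.I) - c * (r + w * Complex.I)) *
      ((r + w * Complex.I : ℂ) ^ 2)⁻¹)
    refine h2.congr_fun fun n => ?_
    rw [pow_add, mul_inv, inv_pow]; ring

end HyperExp

namespace HyperExp

/-! ### The price formulas -/

variable {p : Params} {k : ℝ}

theorem exists_kernel (hk : 0 < k) {f : PowerSeries ℝ} {κ : ℂ → ℂ} (hf : Rep f κ)
    (h0 : PowerSeries.coeff 0 f ≠ 0) :
    ∃ h : ℂ → ℂ, AnalyticAt ℂ h 0 ∧ h 0 = 0 ∧ (∀ᶠ v in 𝓝 0, h (v / κ v) = v) ∧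
      Rep (kernelSeries k (lagrangeInv f)) (kernelFun k h) := by
  have hκ0 : κ 0 ≠ 0 := by
    rw [hf.eval_zero, ← PowerSeries.coeff_zero_eq_constantCoeff_apply]
    exact_mod_cast h0
  obtain ⟨h, hh, hh0, hinv, -⟩ := exists_analytic_inverse hf.1 hκ0
  exact ⟨h, hh, hh0, hinv, rep_kernelFun hk (Rep.lagrangeInv hf hκ0 hh hh0 hinv)
    (lagrangeInv_constantCoeff f) (by rwa [coeff_one_lagrangeInv])⟩

theorem exists_kernelSeries_bound (hk : 0 < k) {f : PowerSeries ℝ} {κ : ℂ → ℂ} (hf : Rep f κ)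
    (h0 : PowerSeries.coeff 0 f ≠ 0) : ∃ R > 0, ∃ A, ∀ n,
      ‖((PowerSeries.coeff n (kernelSeries k (lagrangeInv f)) : ℝ) : ℂ)‖ ≤ A * R ^ n := by
  obtain ⟨h, -, -, -, hN⟩ := exists_kernel hk hf h0
  obtain ⟨r, hr, A, hA, -⟩ := exists_hasSum_tay hN.1
  refine ⟨1 / r, by positivity, A, fun n => ?_⟩
  rw [← hN.coeff]
  exact hA n

theorem coeff_zero_vhSeries : PowerSeries.coeff 0 (vhSeries p) = p.a := by
  simp [vhSeries]

theorem coeff_zero_sqrt_vvhSeries (hσ : 0 < p.σ) :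
    PowerSeries.coeff 0 (sqrtSeries (vvhSeries p)) = p.σ / √2 := by
  have h := (rep_sqrt_vvhSeries hσ).eval_zero
  rw [kappaGauss_zero hσ] at h
  rw [PowerSeries.coeff_zero_eq_constantCoeff_apply]
  exact_mod_cast h.symm

/-- Here `u = z κ(1/z)` is a square root of `ψ(z)`, so the exponent is `Tu²`; `T > 0` provides its
Gaussian decay along vertical lines. The factor `1/2` in `cGauss_eq` turns the `π` of the inverse
transform into `2π`. -/
theorem integral_priceKernel_gauss (hk : 0 < k) (hσ : 0 < p.σ) {c T : ℝ}
    (hc : c = √2 * Real.log k / p.σ) (hT : 0 < T) :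
    ∃ R₁ : ℝ, ∀ R ≥ R₁, Integrable (fun y : ℝ => priceKernel p k T (R + y * Complex.I)) →
      ∫ y : ℝ, priceKernel p k T (R + y * Complex.I)
        = 2 * Real.pi * ∑' n, gaussTerm p k c (n + 1) T := by
  have hκ := rep_sqrt_vvhSeries hσ
  have hpos : 0 < p.σ / √2 := by positivity
  obtain ⟨h, hh, hh0, hinv, hN⟩ := exists_kernel hk hκ
    (by rw [coeff_zero_sqrt_vvhSeries hσ]; exact hpos.ne')
  have hqb : ∀ r : ℝ, ∃ C : ℝ, ∀ u : ℂ, 0 ≤ u.re → u.re ≤ r →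
      ‖Complex.exp (T * u ^ 2 - c * u)‖ ≤ C := by
    intro r
    refine ⟨Real.exp (T * r ^ 2 + |c| * r), fun u hu0 hur => ?_⟩
    rw [Complex.norm_exp]
    refine Real.exp_le_exp.2 ?_
    have h1 : (T * u ^ 2 - c * u : ℂ).re = T * (u.re ^ 2 - u.im ^ 2) - c * u.re := by
      rw [Complex.sub_re, Complex.re_ofReal_mul, Complex.re_ofReal_mul, sq, Complex.mul_re]
      ring
    have h2 : -(c * u.re) ≤ |c| * r := by
      calc -(c * u.re) = -c * u.re := by ring
        _ ≤ |c| * r := mul_le_mul (neg_le_abs c) hur hu0 (abs_nonneg c)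
    have h3 : u.re ^ 2 ≤ r ^ 2 := by gcongr
    rw [h1]
    nlinarith [mul_nonneg hT.le (sq_nonneg u.im), mul_le_mul_of_nonneg_left h3 hT.le]
  have hψ : ∀ᶠ z in Bornology.cobounded ℂ, T * psi p z = T * (z * kappaGauss p z⁻¹) ^ 2 := by
    filter_upwards [tendsto_inv₀_cobounded.eventually (kappaGauss_mul_self hσ),
      Bornology.eventually_ne_cobounded (0 : ℂ)] with z h1 hz
    have h2 := psi_inv (p := p) (inv_ne_zero hz)
    rw [inv_inv] at h2
    rw [mul_pow, sq (kappaGauss p z⁻¹), h1, h2]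
    push_cast
    field_simp
    ring
  obtain ⟨R₁, hR₁⟩ := integral_priceKernel_eq_tsum (p := p) (k := k) (c := c) (T := T)
    hκ.1 (kappaGauss_zero hσ) hpos hh hh0 hinv hN.1 (by rw [hc]; field_simp)
    (q := fun u => T * u ^ 2) (by fun_prop) hqb hψ
  refine ⟨R₁, fun R hR hint => ?_⟩
  obtain ⟨r, hr, h1⟩ := hR₁ R hR hint
  rw [h1, ← tsum_mul_left]
  refine tsum_congr fun n => ?_
  rw [integral_cexp_mul_inv_pow hT hr c (n + 1), hN.coeff, gaussTerm, cGauss_eq hσ, xiGauss]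
  push_cast
  ring

/-- Here `u = ψ(z)`, and `e^{(T - c)u}` may be closed to the left precisely because `T ≥ c`. -/
theorem integral_priceKernel_drift (hk : 0 < k) (hσ : p.σ = 0) (ha : 0 < p.a) {c T : ℝ}
    (hc : c = Real.log k / p.a) (hT : c ≤ T) :
    ∃ R₁ : ℝ, ∀ R ≥ R₁, Integrable (fun y : ℝ => priceKernel p k T (R + y * Complex.I)) →
      ∫ y : ℝ, priceKernel p k T (R + y * Complex.I)
        = 2 * Real.pi * ∑' n, driftTerm p k c (n + 1) T := by
  have hκ := rep_vhSeries (p := p)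
  obtain ⟨h, hh, hh0, hinv, hN⟩ := exists_kernel hk hκ
    (by rw [coeff_zero_vhSeries]; exact ha.ne')
  have hexp : ∀ u : ℂ, T * u - c * u = ((T - c : ℝ) : ℂ) * u := fun u => by push_cast; ring
  have hτ : 0 ≤ T - c := sub_nonneg.2 hT
  have hqb : ∀ r : ℝ, ∃ C : ℝ, ∀ u : ℂ, 0 ≤ u.re → u.re ≤ r →
      ‖Complex.exp (T * u - c * u)‖ ≤ C := by
    intro r
    refine ⟨Real.exp ((T - c) * r), fun u hu0 hur => ?_⟩
    rw [hexp, Complex.norm_exp, Complex.re_ofReal_mul]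
    exact Real.exp_le_exp.2 (mul_le_mul_of_nonneg_left hur hτ)
  have hψ : ∀ᶠ z in Bornology.cobounded ℂ, T * psi p z = T * (z * (p.a + z⁻¹ * etaFun p z⁻¹)) := by
    filter_upwards [Bornology.eventually_ne_cobounded (0 : ℂ)] with z hz
    have h2 := psi_inv (p := p) (inv_ne_zero hz)
    rw [inv_inv] at h2
    rw [h2, hσ]
    simp only [Complex.ofReal_zero]
    field_simp
    ring
  obtain ⟨R₁, hR₁⟩ := integral_priceKernel_eq_tsum (p := p) (k := k) (c := c) (T := T)
    hκ.1 (by simp) ha hh hh0 hinv hN.1 hc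
    (q := fun u => T * u) (by fun_prop) hqb hψ
  refine ⟨R₁, fun R hR hint => ?_⟩
  obtain ⟨r, hr, h1⟩ := hR₁ R hR hint
  simp_rw [hexp] at h1
  rw [h1, ← tsum_mul_left]
  refine tsum_congr fun n => ?_
  rw [integral_cexp_mul_inv_pow_linear hτ hr n, hN.coeff, driftTerm, cDrift_eq ha.ne', xiDrift]
  push_cast
  ring

theorem summable_driftTerm (hk : 0 < k) (ha : 0 < p.a) (c : ℝ) (z : ℂ) :
    Summable fun n : ℕ => driftTerm p k c (n + 1) z := by
  obtain ⟨R, hR, A, hA⟩ := exists_kernelSeries_bound hk (rep_vhSeries (p := p))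
    (by rw [coeff_zero_vhSeries]; exact ha.ne')
  have hA0 : 0 ≤ A := by simpa using (norm_nonneg _).trans (hA 0)
  have hs := ((summable_nat_add_iff 1).2 (Real.summable_pow_div_factorial (R * ‖z - c‖))).mul_left
    (A / R)
  refine Summable.of_norm_bounded hs fun n => ?_
  have h1 := hA n
  rw [driftTerm, cDrift_eq ha.ne', xiDrift, norm_div, norm_mul, norm_pow, Complex.norm_natCast,
    mul_pow]
  calc _ ≤ A * R ^ n * ‖z - c‖ ^ (n + 1) / (n + 1).factorial := by gcongr
    _ = _ := by rw [pow_succ R]; field_simp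

theorem exists_summable_bound_gaussTerm (hk : 0 < k) (hσ : 0 < p.σ) {c : ℝ} (hc : 0 ≤ c)
    {Q : Set ℂ} (hQ : IsCompact Q) (hQU : Q ⊆ {z : ℂ | 0 < z.re}) :
    ∃ u : ℕ → ℝ, Summable u ∧ ∀ n, ∀ z ∈ Q, ‖gaussTerm p k c (n + 1) z‖ ≤ u n := by
  obtain ⟨R, hR, A, hA⟩ := exists_kernelSeries_bound hk (rep_sqrt_vvhSeries hσ)
    (by rw [coeff_zero_sqrt_vvhSeries hσ]; positivity)
  refine exists_summable_bound_phi (d := fun n => (cGauss p k (n + 3) : ℂ)) (A := 1 / 2 * A) hR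
    (fun n => ?_) hc hQ hQU
  rw [cGauss_eq hσ, xiGauss, Complex.ofReal_mul, norm_mul, mul_assoc]
  have := hA n
  norm_num
  simpa using this

theorem differentiableOn_gaussTerm {c : ℝ} (hc : 0 ≤ c) (n : ℕ) :
    DifferentiableOn ℂ (gaussTerm p k c n) {z : ℂ | 0 < z.re} := fun _ hz =>
  ((differentiableAt_const _).fun_mul (differentiableAt_phi hc n hz)).differentiableWithinAt

theorem tendstoLocallyUniformlyOn_gaussTerm (hk : 0 < k) (hσ : 0 < p.σ) {c : ℝ} (hc : 0 ≤ c)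
    (j : ℕ) : TendstoLocallyUniformlyOn
      (fun (m : ℕ) z => ∑ n ∈ Finset.range m, iteratedDeriv j (gaussTerm p k c (n + 1)) z)
      (iteratedDeriv j fun z => ∑' n, gaussTerm p k c (n + 1) z) atTop {z : ℂ | 0 < z.re} :=
  tendstoLocallyUniformlyOn_iteratedDeriv half_plane_isOpen
    (fun n => differentiableOn_gaussTerm hc (n + 1))
    (fun _ hQ hQU => exists_summable_bound_gaussTerm hk hσ hc hQ hQU) j

theorem analyticOnNhd_tsum_gaussTerm (hk : 0 < k) (hσ : 0 < p.σ) {c : ℝ} (hc : 0 ≤ c) :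
    AnalyticOnNhd ℂ (fun z => ∑' n : ℕ, gaussTerm p k c (n + 1) z) {z : ℂ | 0 < z.re} := by
  refine DifferentiableOn.analyticOnNhd ?_ half_plane_isOpen
  have h := tendstoLocallyUniformlyOn_gaussTerm (p := p) hk hσ hc 0
  simp only [iteratedDeriv_zero] at h
  exact h.differentiableOn (Eventually.of_forall fun m => DifferentiableOn.fun_sum fun n _ =>
    differentiableOn_gaussTerm hc (n + 1)) half_plane_isOpen

theorem exists_one_lt_forall_lt (hρ : ∀ i, 1 < p.ρ i) {R : ℝ} (hR : 1 < R) :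
    ∃ c, 1 < c ∧ c < R ∧ ∀ i, c < p.ρ i := by
  obtain ⟨δ, hδ, h⟩ := exists_pos_forall_le (fun i => p.ρ i - 1) fun i => sub_pos.2 (hρ i)
  refine ⟨1 + min (δ / 2) ((R - 1) / 2), ?_, ?_, fun i => ?_⟩
  · have : 0 < min (δ / 2) ((R - 1) / 2) := lt_min (by linarith) (by linarith)
    linarith
  · have := min_le_right (δ / 2) ((R - 1) / 2)
    linarith
  · have := min_le_left (δ / 2) ((R - 1) / 2)
    linarith [h i]

theorem exists_forall_lt (p : Params) (R₁ : ℝ) : ∃ R ≥ R₁, 1 < R ∧ ∀ i, p.ρ i < R := by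
  have : ∀ᶠ R in atTop, R ≥ R₁ ∧ 1 < R ∧ ∀ i, p.ρ i < R :=
    (eventually_ge_atTop R₁).and ((eventually_gt_atTop 1).and
      (eventually_all.2 fun i => eventually_gt_atTop (p.ρ i)))
  exact this.exists

theorem summable_bTerm (hk : 0 < k) (hρ : ∀ i, 1 < p.ρ i) (z : ℂ) :
    Summable fun n : ℕ => bTerm p k (n + 1) z := by
  obtain ⟨R, -, hR, hρR⟩ := exists_forall_lt p 0
  obtain ⟨c, hc, hcR, hρc⟩ := exists_one_lt_forall_lt hρ hR
  have h := (hasSum_bTerm hk hc hcR one_pos hρc hρR z).summable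
  have hne : -(2 * Real.pi * Complex.I) ≠ 0 := by
    simp [Real.pi_ne_zero]
  exact (summable_mul_left_iff hne).1 h

theorem callPayoff_eq {Ω : Type*} {X : ℝ≥0 → Ω → ℝ} {S₀ K : ℝ} (hS₀ : 0 < S₀) (hk : k = K / S₀) (T : ℝ≥0) (ω : Ω) :
    callPayoff X S₀ K T ω = S₀ * max (Real.exp (X T ω) - k) 0 := by
  have : S₀ * Real.exp (X T ω) - K = S₀ * (Real.exp (X T ω) - k) := by
    rw [hk]; field_simp
  rw [callPayoff, this, mul_max_of_nonneg _ _ hS₀.le, mul_zero]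

/-- The part common to all three cases. The abscissa `R` stays free, since the expansion of the last
integral requires it to be large. -/
theorem integrable_callPayoff_and_callPrice_eq {Ω : Type*} [MeasurableSpace Ω]
    {P : Measure Ω} [IsProbabilityMeasure P] {X : ℝ≥0 → Ω → ℝ} {r S₀ K : ℝ}
    (hX : IsHyperexponential X P p)
    (hρ : ∀ i, 1 < p.ρ i) (hS₀ : 0 < S₀) (hK : S₀ < K) (hk : k = K / S₀) (T : ℝ≥0) {R : ℝ}
    (hR : 1 < R) (hρR : ∀ i, p.ρ i < R) :
    Integrable (callPayoff X S₀ K T) P ∧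
    (callPrice X P r S₀ K T : ℂ) = (Real.exp (-(r * T)) * K : ℝ) *
      (∑' n : ℕ, bTerm p k (n + 1) (T : ℝ)
        + (2 * (Real.pi : ℂ))⁻¹ * ∫ y : ℝ, priceKernel p k T (R + y * Complex.I)) := by
  have hk1 : 1 < k := by rw [hk, one_lt_div hS₀]; exact hK
  have hk0 : 0 < k := one_pos.trans hk1
  obtain ⟨c, hc, hcR, hρc⟩ := exists_one_lt_forall_lt hρ hR
  obtain ⟨h1, h2⟩ := integral_payoff_eq hk0 hc hρc T
  have hm := hX.levy.measurable T
  rw [← map_eq_marginal hX] at h1 h2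
  have hmeas : AEStronglyMeasurable (fun w : ℝ => max (Real.exp w - k) 0) (P.map (X T)) :=
    (Continuous.aestronglyMeasurable (by fun_prop))
  rw [integral_map hm.aemeasurable hmeas] at h2
  have h3 := (integrable_map_measure hmeas hm.aemeasurable).1 h1
  have hpay : callPayoff X S₀ K T = fun ω => S₀ * max (Real.exp (X T ω) - k) 0 :=
    funext fun ω => callPayoff_eq hS₀ hk T ω
  refine ⟨by rw [hpay]; exact h3.const_mul S₀, ?_⟩
  have hSK : (S₀ : ℂ) * k = K := by
    rw [hk]; push_cast
    have : (S₀ : ℂ) ≠ 0 := by exact_mod_cast hS₀.ne'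
    field_simp
  have hpi : (Real.pi : ℂ) ≠ 0 := by exact_mod_cast Real.pi_ne_zero
  rw [callPrice, hpay, integral_const_mul, Complex.ofReal_mul, Complex.ofReal_mul, h2,
    integral_priceKernel_eq hk1.le hc hcR hρc hρR T.coe_nonneg, Complex.ofReal_mul, ← hSK]
  generalize (∫ y : ℝ, priceKernel p k T (R + y * Complex.I)) = I
  generalize (∑' n : ℕ, bTerm p k (n + 1) (T : ℝ)) = B
  field_simp
  ring

end HyperExp

/-! ### The three cases of the price formula -/

theorem mainTheorem4 {Ω : Type*} [MeasurableSpace Ω] (P : Measure Ω) [IsProbabilityMeasure P]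
    (X : ℝ≥0 → Ω → ℝ) (p : HyperExp.Params) (hX : HyperExp.IsHyperexponential X P p)
    (r S₀ K k : ℝ) (hr : HyperExp.RiskNeutral p r) (hS₀ : 0 < S₀) (hK : S₀ < K)
    (hk : k = K / S₀) :
    -- the expectation that defines the price is finite
    (∀ T : ℝ≥0, Integrable (HyperExp.callPayoff X S₀ K T) P) ∧
    -- the first series converges on the whole plane
    (∀ z : ℂ, Summable fun n : ℕ => HyperExp.bTerm p k (n + 1) z) ∧
    -- (i)
    (∀ c : ℝ, 0 < p.σ → c = √2 * Real.log k / p.σ →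
      (∀ T : ℝ≥0, (HyperExp.callPrice X P r S₀ K T : ℂ) =
        (Real.exp (-(r * T)) * K : ℝ) *
          (∑' n : ℕ, HyperExp.bTerm p k (n + 1) (T : ℝ)
            + ∑' n : ℕ, HyperExp.gaussTerm p k c (n + 1) (T : ℝ))) ∧
      (∀ z : ℂ, 0 < z.re → Summable fun n : ℕ => HyperExp.gaussTerm p k c (n + 1) z) ∧
      (∀ n : ℕ, AnalyticOnNhd ℂ (HyperExp.phi n c) {z : ℂ | 0 < z.re}) ∧
      AnalyticOnNhd ℂ (fun z => ∑' n : ℕ, HyperExp.gaussTerm p k c (n + 1) z)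
        {z : ℂ | 0 < z.re} ∧
      -- uniform convergence on compact sets of the series and of all its termwise derivatives
      (∀ (j : ℕ) (Q : Set ℂ), IsCompact Q → Q ⊆ {z : ℂ | 0 < z.re} →
        TendstoUniformlyOn
          (fun (m : ℕ) (z : ℂ) =>
            ∑ n ∈ Finset.range m, iteratedDeriv j (HyperExp.gaussTerm p k c (n + 1)) z)
          (iteratedDeriv j fun z => ∑' n : ℕ, HyperExp.gaussTerm p k c (n + 1) z) atTop Q)) ∧
    -- (ii)
    (∀ c : ℝ, p.σ = 0 → 0 < p.a → c = Real.log k / p.a →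
      (∀ T : ℝ≥0, (HyperExp.callPrice X P r S₀ K T : ℂ) =
        (Real.exp (-(r * T)) * K : ℝ) *
          (∑' n : ℕ, HyperExp.bTerm p k (n + 1) (T : ℝ)
            + if c ≤ (T : ℝ) then ∑' n : ℕ, HyperExp.driftTerm p k c (n + 1) (T : ℝ) else 0)) ∧
      (∀ z : ℂ, Summable fun n : ℕ => HyperExp.driftTerm p k c (n + 1) z)) ∧
    -- (iii)
    (p.σ = 0 → p.a ≤ 0 →
      ∀ T : ℝ≥0, (HyperExp.callPrice X P r S₀ K T : ℂ) =
        (Real.exp (-(r * T)) * K : ℝ) *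
          ∑' n : ℕ, HyperExp.bTerm p k (n + 1) (T : ℝ)) := by
  have hk1 : 1 < k := by rw [hk, one_lt_div hS₀]; exact hK
  have hk0 : 0 < k := one_pos.trans hk1
  have hlog : 0 < Real.log k := Real.log_pos hk1
  have hρ := hr.one_lt_ρ
  have hpi : (Real.pi : ℂ) ≠ 0 := by exact_mod_cast Real.pi_ne_zero
  refine ⟨fun T => ?_, HyperExp.summable_bTerm hk0 hρ, fun c hσ hc => ?_,
    fun c hσ ha hc => ⟨fun T => ?_, HyperExp.summable_driftTerm hk0 ha c⟩, fun hσ ha T => ?_⟩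
  · obtain ⟨R, -, hR, hρR⟩ := HyperExp.exists_forall_lt p 0
    exact (HyperExp.integrable_callPayoff_and_callPrice_eq (r := r) hX hρ hS₀ hK hk T hR hρR).1
  · have hc0 : 0 ≤ c := by rw [hc]; positivity
    refine ⟨fun T => ?_, fun z hz => ?_, fun n => ?_,
      HyperExp.analyticOnNhd_tsum_gaussTerm hk0 hσ hc0, fun j Q hQ hQU => ?_⟩
    -- At `T = 0` the Gaussian decay is missing, but both sides vanish: the option is out of the
    -- money at the start, every term of the first series has a positive power of `T`, and `phi n c
    -- 0 = 0`.
    · rcases eq_or_ne T 0 with rfl | hT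
      · have hpay : ∫ ω, HyperExp.callPayoff X S₀ K 0 ω ∂P = 0 := by
          refine integral_eq_zero_of_ae ?_
          filter_upwards [hX.levy.start_zero] with ω hω
          rw [HyperExp.callPayoff, hω, Real.exp_zero, mul_one, max_eq_right (by linarith)]
          rfl
        simp [HyperExp.callPrice, hpay, HyperExp.bTerm, HyperExp.gaussTerm, HyperExp.phi_zero]
      · have hT' : (0 : ℝ) < T := by exact_mod_cast pos_iff_ne_zero.2 hT
        obtain ⟨R₁, h⟩ := HyperExp.integral_priceKernel_gauss hk0 hσ hc hT'
        obtain ⟨R, hRR, hR, hρR⟩ := HyperExp.exists_forall_lt p R₁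
        rw [(HyperExp.integrable_callPayoff_and_callPrice_eq hX hρ hS₀ hK hk T hR hρR).2,
          h R hRR (HyperExp.integrable_priceKernel_line hR hρR T.coe_nonneg),
          inv_mul_cancel_left₀ (mul_ne_zero two_ne_zero hpi)]
    · obtain ⟨u, hu, hb⟩ := HyperExp.exists_summable_bound_gaussTerm hk0 hσ hc0
        (isCompact_singleton (x := z)) (singleton_subset_iff.2 hz)
      exact hu.of_norm_bounded fun n => hb n z rfl
    · exact DifferentiableOn.analyticOnNhd (fun z hz =>
        (HyperExp.differentiableAt_phi hc0 n hz).differentiableWithinAt) HyperExp.half_plane_isOpen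
    · exact (tendstoLocallyUniformlyOn_iff_forall_isCompact HyperExp.half_plane_isOpen).1
        (HyperExp.tendstoLocallyUniformlyOn_gaussTerm hk0 hσ hc0 j) Q hQU hQ
  · split_ifs with hT
    · obtain ⟨R₁, h⟩ := HyperExp.integral_priceKernel_drift hk0 hσ ha hc hT
      obtain ⟨R, hRR, hR, hρR⟩ := HyperExp.exists_forall_lt p R₁
      rw [(HyperExp.integrable_callPayoff_and_callPrice_eq hX hρ hS₀ hK hk T hR hρR).2,
        h R hRR (HyperExp.integrable_priceKernel_line hR hρR T.coe_nonneg),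
        inv_mul_cancel_left₀ (mul_ne_zero two_ne_zero hpi)]
    -- Before the time `c` the drift cannot outweigh `k^{-z}`, so the integrand decays to the right
    -- instead of to the left.
    · obtain ⟨R, -, hR, hρR⟩ := HyperExp.exists_forall_lt p 0
      have h1 : p.a * T ≤ Real.log k := by
        rw [not_le, hc, lt_div_iff₀ ha] at hT
        linarith
      rw [(HyperExp.integrable_callPayoff_and_callPrice_eq hX hρ hS₀ hK hk T hR hρR).2,
        HyperExp.integral_priceKernel_eq_zero hR hρR T.coe_nonneg hσ h1, mul_zero]
  · obtain ⟨R, -, hR, hρR⟩ := HyperExp.exists_forall_lt p 0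
    -- Without positive drift the vanishing criterion holds at all times, because `log k > 0`.
    have h1 : p.a * T ≤ Real.log k :=
      (mul_nonpos_of_nonpos_of_nonneg ha T.coe_nonneg).trans hlog.le
    rw [(HyperExp.integrable_callPayoff_and_callPrice_eq hX hρ hS₀ hK hk T hR hρR).2,
      HyperExp.integral_priceKernel_eq_zero hR hρR T.coe_nonneg hσ h1, mul_zero, add_zero]
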